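/- **Setting.** On the unit sphere $\mathbb S^2\subset\mathbb R^3$ with its surface measure let, for integers $k\ge 0$, $Y_k=\{\varphi\in C^2(\mathbb S^2;\mathbb C):\Delta\varphi=-k(k+1)\varphi\}$ and let $\Pi_k$ be the orthogonal projection of $L^2(\mathbb S^2)$ onto $Y_k$. For integers $m\ge0$ let $H^m(\mathbb S^2)$ be the space of $\varphi\in L^2(\mathbb S^2)$ with $\|\varphi\|_{H^m}^2:=\|\Pi_0\varphi\|_{L^2}^2+\sum_{k\ge1}(k(k+1))^m\|\Pi_k\varphi\|_{L^2}^2<\infty$; a (complex) tangent field $\xi\in L^2$ on $\mathbb S^2$, identified with a 1-form, is in $H^{m+1}(\mathbb S^2)$ if its weak derivatives $*d\xi$ and $d^*\xi=-\operatorname{div}\xi$ are in $H^m(\mathbb S^2)$. Let $$X=\Big\{(\xi,\xi',\vartheta,\vartheta^*):\ \xi\in H^2,\ \xi'\in H^1\text{ tangent fields},\ \vartheta\in H^2,\ \int_{\mathbb S^2}\vartheta=0,\ \vartheta^*\in H^1\Big\},$$ $$\|(\xi,\xi',\vartheta,\vartheta^*)\|_X^2=\|{*d\xi}\|_{H^1}^2+\|d^*\xi\|_{H^1}^2+\|{*d\xi'}\|_{L^2}^2+\|d^*\xi'\|_{L^2}^2+\|\vartheta\|_{H^2}^2+\|\vartheta^*\|_{H^1}^2,$$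 and let $\mathcal D\subset X$ be the subspace with $\xi\in H^3$, $\xi'\in H^2$, $\vartheta\in H^3$, $\vartheta^*\in H^2$. Define $L_0:\mathcal D\to X$ by $$L_0(\xi,\xi',\vartheta,\vartheta^*)=\big(-\xi',\ -\xi'+\Delta\xi-\nabla(q-2\vartheta),\ -\vartheta^*-q,\ \vartheta^*+3q+\Delta\vartheta\big),\qquad \operatorname{div}\xi+\vartheta+\vartheta^*+q=0,$$ where $\Delta=-(d^*d+dd^*)$ on fields. For $k\in\mathbb Z$ let $E_k=\{\Xi\in\mathcal D:L_0\Xi=k\Xi\}$. For $S\subseteq\mathbb Z$, a spectral projection $P_S$ is a bounded linear operator on $X$ that is the identity on $E_k$ for $k\in S$ and zero on $E_k$ for $k\in\mathbb Z\setminus S$. More generally, $e^{L_0s}P_S$ denotes a bounded linear operator on $X$ that is multiplication by $e^{ks}$ on $E_k$ for $k\in S$ and zero on $E_k$ for $k\in\mathbb Z\setminus S$. Write $P_m=P_{\{m\}}$, $P_{\ge m}=P_{\mathbb Z\cap[m,\infty)}$, $P_{\le m}=P_{\mathbb Z\cap(-\infty,m]}$. **Lemma 3.5.** The spectral projections $P_0,P_1,P_{\ge2},P_{\le-1}$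 exist as bounded operators on $X$ and are unique, and there is a constant $C$ such that for all $\Xi\in X$ $$\|P_0\Xi\|_X+\|P_1\Xi\|_X+\|P_{\ge2}\Xi\|_X+\|P_{\le-1}\Xi\|_X\le C\|\Xi\|_X.$$ Moreover, the operators $e^{L_0s}P_{\ge2}$ for $s\le0$ and $e^{L_0s}P_{\le-1}$ for $s\ge0$ exist as strongly continuous semigroups of bounded operators on $X$ (in the parameter $s$ of the respective half line, with value $P_{\ge2}$, respectively $P_{\le-1}$, at $s=0$), and for all $\Xi\in X$ every such semigroup satisfies $$\|e^{L_0s}P_{\ge2}\Xi\|_X\le C e^{2s}\|\Xi\|_X\quad(s\le0),\qquad \|e^{L_0s}P_{\le-1}\Xi\|_X\le C e^{-s}\|\Xi\|_X\quad(s\ge0).$$ -/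

import Mathlib

open MeasureTheory Filter Topology
open scoped ContDiff

noncomputable section

namespace StokesSphere

/-! ### The unit sphere, and smooth calculus on it

A `C^n` function (or field) on the unit sphere `S²` is the restriction of a `C^n` function
on `ℝ³`. The operators below are written in terms of such an extension; their values on the
sphere depend only on the values of the function (field) on the sphere. -/

/-- Euclidean three-space. -/
abbrev R3 := EuclideanSpace ℝ (Fin 3)

/-- The unit sphere `S²`. -/
abbrev S2 := Metric.sphere (0 : R3) 1

/-- The surface measure of `S²`. -/
def surf : Measure S2 := (volume : Measure R3).toSphere

/-- The partial derivative `∂ᵢ F`. -/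
def pd (i : Fin 3) (F : R3 → ℂ) (x : R3) : ℂ := fderiv ℝ F x (EuclideanSpace.single i 1)

/-- The spherical gradient `∇F` (the tangential part of the Euclidean gradient). -/
def sgrad (F : R3 → ℂ) (x : R3) : Fin 3 → ℂ :=
  fun i => pd i F x - (∑ j, (x j : ℂ) * pd j F x) * (x i : ℂ)

/-- The spherical gradient rotated by a right angle, `x × ∇F`. -/
def srot (F : R3 → ℂ) (x : R3) : Fin 3 → ℂ :=
  crossProduct (fun i => (x i : ℂ)) (fun i => pd i F x)

/-- The spherical divergence of a tangent field, `∑ᵢⱼ (δᵢⱼ - xᵢ xⱼ) ∂ᵢ Vⱼ`. -/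
def sdiv (V : R3 → Fin 3 → ℂ) (x : R3) : ℂ :=
  ∑ i, pd i (fun z => V z i) x - ∑ i, ∑ j, (x i : ℂ) * (x j : ℂ) * pd i (fun z => V z j) x

/-- `∗dV` for a tangent field `V` (identified with a 1-form): the normal component `x · curl V`
of the Euclidean curl, so that `dV = (∗dV) Ω₀` with `Ω₀` the area form for the outer normal. -/
def scurl (V : R3 → Fin 3 → ℂ) (x : R3) : ℂ :=
  (x 0 : ℂ) * (pd 1 (fun z => V z 2) x - pd 2 (fun z => V z 1) x)
    + (x 1 : ℂ) * (pd 2 (fun z => V z 0) x - pd 0 (fun z => V z 2) x)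
    + (x 2 : ℂ) * (pd 0 (fun z => V z 1) x - pd 1 (fun z => V z 0) x)

/-- The Laplace-Beltrami operator of `S²`. -/
def slap (F : R3 → ℂ) (x : R3) : ℂ := sdiv (sgrad F) x

/-- Smooth tangent fields on `S²`. -/
def SmoothTangent (V : R3 → Fin 3 → ℂ) : Prop :=
  ContDiff ℝ ∞ V ∧ ∀ x : R3, ‖x‖ = 1 → ∑ i, V x i * (x i : ℂ) = 0

/-! ### Square integrable functions and fields, weak derivatives -/

/-- Complex valued `L²` functions on `S²`. -/
abbrev Fun2 := Lp ℂ 2 surf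

/-- `L²` fields on `S²` with values in `ℂ³`. -/
abbrev Vec2 := Lp (EuclideanSpace ℂ (Fin 3)) 2 surf

/-- The bilinear pairing `∫ ξ · V` of an `L²` field with a field. -/
def pairV (ξ : Vec2) (V : R3 → Fin 3 → ℂ) : ℂ :=
  ∫ y : S2, ∑ i, ξ y i * V (y : R3) i ∂surf

/-- The bilinear pairing `∫ u φ` of an `L²` function with a function. -/
def pairF (u : Fun2) (φ : R3 → ℂ) : ℂ := ∫ y : S2, u y * φ (y : R3) ∂surf

/-- The field `ξ` is tangent to the sphere (almost everywhere). -/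
def Tangent (ξ : Vec2) : Prop := ∀ᵐ y : S2 ∂surf, ∑ i, ξ y i * ((y : R3) i : ℂ) = 0

/-- `d^∗ ξ = u` weakly (`d^∗ = -div` is the adjoint of the gradient). -/
def HasCodiff (ξ : Vec2) (u : Fun2) : Prop :=
  ∀ φ : R3 → ℂ, ContDiff ℝ ∞ φ → pairF u φ = pairV ξ (sgrad φ)

/-- `∗dξ = w` weakly. -/
def HasCurl (ξ : Vec2) (w : Fun2) : Prop :=
  ∀ φ : R3 → ℂ, ContDiff ℝ ∞ φ → pairF w φ = - pairV ξ (srot φ)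

/-- `∇u = G` weakly. -/
def HasGrad (u : Fun2) (G : Vec2) : Prop :=
  Tangent G ∧ ∀ V, SmoothTangent V → pairV G V = - pairF u (sdiv V)

/-- `Δu = l` weakly, for functions. -/
def HasLap (u l : Fun2) : Prop :=
  ∀ φ : R3 → ℂ, ContDiff ℝ ∞ φ → pairF l φ = pairF u (slap φ)

/-- `Δξ = l` weakly, for tangent fields, where `Δ = -(d^∗ d + d d^∗)`. -/
def HasHodgeLap (ξ l : Vec2) : Prop :=
  Tangent l ∧ ∃ w u : Fun2, HasCurl ξ w ∧ HasCodiff ξ u ∧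
    ∀ V, SmoothTangent V → pairV l V = - pairF w (scurl V) + pairF u (sdiv V)

open Classical in
/-- The weak `∗dξ`, which is unique if it exists (zero if it does not). -/
def curl (ξ : Vec2) : Fun2 := if h : ∃ w, HasCurl ξ w then h.choose else 0

open Classical in
/-- The weak `d^∗ξ`, which is unique if it exists (zero if it does not). -/
def codiff (ξ : Vec2) : Fun2 := if h : ∃ u, HasCodiff ξ u then h.choose else 0

/-! ### Helper facts: these notions are linear -/

instance : IsFiniteMeasure surf := by unfold surf; infer_instance

lemma integrable_mul {u : S2 → ℂ} {φ : R3 → ℂ} (hu : MemLp u 2 surf) (hφ : Continuous φ) :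
    Integrable (fun y : S2 => u y * φ (y : R3)) surf := by
  have h1 : Integrable u surf := hu.integrable (by norm_num)
  have hc : Continuous (fun y : S2 => φ (y : R3)) := hφ.comp continuous_subtype_val
  obtain ⟨C, hC⟩ := (isCompact_range hc).isBounded.exists_norm_le
  refine h1.mul_bdd (c := C) hc.aestronglyMeasurable (Eventually.of_forall fun y => ?_)
  exact hC _ ⟨y, rfl⟩

lemma pairF_add (u v : Fun2) {φ : R3 → ℂ} (hφ : Continuous φ) :
    pairF (u + v) φ = pairF u φ + pairF v φ := by
  unfold pairF
  rw [← integral_add (integrable_mul (Lp.memLp u) hφ) (integrable_mul (Lp.memLp v) hφ)]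
  refine integral_congr_ae ?_
  filter_upwards [Lp.coeFn_add u v] with y hy
  rw [hy, Pi.add_apply]; ring

lemma pairF_smul (c : ℂ) (u : Fun2) (φ : R3 → ℂ) : pairF (c • u) φ = c * pairF u φ := by
  unfold pairF
  rw [← integral_const_mul]
  refine integral_congr_ae ?_
  filter_upwards [Lp.coeFn_smul c u] with y hy
  rw [hy, Pi.smul_apply, smul_eq_mul, mul_assoc]

lemma memLp_coord (ξ : Vec2) (i : Fin 3) : MemLp (fun y => ξ y i) 2 surf :=
  (EuclideanSpace.proj (𝕜 := ℂ) i).comp_memLp' (Lp.memLp ξ)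

lemma pairV_add (ξ η : Vec2) {V : R3 → Fin 3 → ℂ} (hV : Continuous V) :
    pairV (ξ + η) V = pairV ξ V + pairV η V := by
  unfold pairV
  have hi : ∀ ζ : Vec2, Integrable (fun y : S2 => ∑ i, ζ y i * V (y : R3) i) surf := fun ζ =>
    integrable_finsetSum _ fun i _ =>
      integrable_mul (φ := fun x => V x i) (memLp_coord ζ i) ((continuous_apply i).comp hV)
  rw [← integral_add (hi ξ) (hi η)]
  refine integral_congr_ae ?_
  filter_upwards [Lp.coeFn_add ξ η] with y hy
  rw [hy, ← Finset.sum_add_distrib]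
  refine Finset.sum_congr rfl fun i _ => ?_
  simp only [Pi.add_apply, PiLp.add_apply]; ring

lemma pairV_smul (c : ℂ) (ξ : Vec2) (V : R3 → Fin 3 → ℂ) :
    pairV (c • ξ) V = c * pairV ξ V := by
  unfold pairV
  rw [← integral_const_mul]
  refine integral_congr_ae ?_
  filter_upwards [Lp.coeFn_smul c ξ] with y hy
  rw [hy, Finset.mul_sum]
  refine Finset.sum_congr rfl fun i _ => ?_
  simp only [Pi.smul_apply, PiLp.smul_apply, smul_eq_mul, mul_assoc]

lemma contDiff_pd {n m : WithTop ℕ∞} {F : R3 → ℂ} (hF : ContDiff ℝ n F) (h : m + 1 ≤ n)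
    (i : Fin 3) : ContDiff ℝ m (pd i F) :=
  (hF.fderiv_right h).clm_apply contDiff_const

lemma contDiff_coord {n : WithTop ℕ∞} (i : Fin 3) :
    ContDiff ℝ n (fun x : R3 => (x i : ℂ)) :=
  Complex.ofRealCLM.contDiff.comp (EuclideanSpace.proj (𝕜 := ℝ) i).contDiff

lemma contDiff_sgrad {n m : WithTop ℕ∞} {F : R3 → ℂ} (hF : ContDiff ℝ n F) (h : m + 1 ≤ n) :
    ContDiff ℝ m (sgrad F) := by
  refine contDiff_pi.2 fun i => ?_
  exact (contDiff_pd hF h i).sub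
    ((ContDiff.sum fun j _ => (contDiff_coord j).mul (contDiff_pd hF h j)).mul (contDiff_coord i))

lemma continuous_srot {F : R3 → ℂ} (hF : ContDiff ℝ 1 F) : Continuous (srot F) := by
  have hp : ∀ i, Continuous (pd i F) := fun i => (contDiff_pd (m := 0) hF (by simp) i).continuous
  have hc : ∀ i : Fin 3, Continuous (fun x : R3 => (x i : ℂ)) := fun i =>
    (contDiff_coord (n := 0) i).continuous
  refine continuous_pi fun i => ?_
  fin_cases i <;> simp [srot, cross_apply] <;> fun_prop

lemma tangent_zero : Tangent 0 := by
  filter_upwards [Lp.coeFn_zero (EuclideanSpace ℂ (Fin 3)) 2 surf] with y hy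
  rw [hy]
  simp

lemma Tangent.add {ξ η : Vec2} (h : Tangent ξ) (k : Tangent η) : Tangent (ξ + η) := by
  filter_upwards [h, k, Lp.coeFn_add ξ η] with y h k hy
  rw [hy]
  simp only [Pi.add_apply, PiLp.add_apply, add_mul, Finset.sum_add_distrib, h, k, add_zero]

lemma Tangent.smul (c : ℂ) {ξ : Vec2} (h : Tangent ξ) : Tangent (c • ξ) := by
  filter_upwards [h, Lp.coeFn_smul c ξ] with y h hy
  rw [hy]
  simp only [Pi.smul_apply, PiLp.smul_apply, smul_eq_mul, mul_assoc, ← Finset.mul_sum, h, mul_zero]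

lemma HasCodiff.add {ξ η : Vec2} {u v : Fun2} (h : HasCodiff ξ u) (k : HasCodiff η v) :
    HasCodiff (ξ + η) (u + v) := fun φ hφ => by
  rw [pairF_add _ _ hφ.continuous,
    pairV_add _ _ (contDiff_sgrad (m := 0) (hφ.of_le (m := 1) (by simp)) (by simp)).continuous,
    h φ hφ, k φ hφ]

lemma HasCodiff.smul (c : ℂ) {ξ : Vec2} {u : Fun2} (h : HasCodiff ξ u) :
    HasCodiff (c • ξ) (c • u) := fun φ hφ => by
  rw [pairF_smul, pairV_smul, h φ hφ]

lemma HasCurl.add {ξ η : Vec2} {u v : Fun2} (h : HasCurl ξ u) (k : HasCurl η v) :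
    HasCurl (ξ + η) (u + v) := fun φ hφ => by
  rw [pairF_add _ _ hφ.continuous,
    pairV_add _ _ (continuous_srot (hφ.of_le (m := 1) (by simp))), h φ hφ, k φ hφ]
  ring

lemma HasCurl.smul (c : ℂ) {ξ : Vec2} {u : Fun2} (h : HasCurl ξ u) :
    HasCurl (c • ξ) (c • u) := fun φ hφ => by
  rw [pairF_smul, pairV_smul, h φ hφ]
  ring

lemma HasCodiff.zero : HasCodiff 0 0 := fun φ _ => by
  have h1 := pairF_smul 0 0 φ
  have h2 := pairV_smul 0 0 (sgrad φ)
  simp only [smul_zero, zero_mul] at h1 h2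
  rw [h1, h2]

lemma HasCurl.zero : HasCurl 0 0 := fun φ _ => by
  have h1 := pairF_smul 0 0 φ
  have h2 := pairV_smul 0 0 (srot φ)
  simp only [smul_zero, zero_mul] at h1 h2
  rw [h1, h2, neg_zero]

lemma pd_add {F G : R3 → ℂ} {x : R3} (hF : DifferentiableAt ℝ F x)
    (hG : DifferentiableAt ℝ G x) (i : Fin 3) :
    pd i (fun z => F z + G z) x = pd i F x + pd i G x := by
  unfold pd
  rw [fderiv_fun_add hF hG]; rfl

lemma pd_smul (c : ℂ) {F : R3 → ℂ} {x : R3} (hF : DifferentiableAt ℝ F x) (i : Fin 3) :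
    pd i (fun z => c * F z) x = c * pd i F x := by
  unfold pd
  rw [fderiv_const_mul hF]; rfl

lemma slap_add {F G : R3 → ℂ} (hF : ContDiff ℝ 2 F) (hG : ContDiff ℝ 2 G) (x : R3) :
    slap (fun z => F z + G z) x = slap F x + slap G x := by
  have h1 : sgrad (fun z => F z + G z) = fun z i => sgrad F z i + sgrad G z i := by
    funext z i
    simp only [sgrad]
    have := fun j => pd_add (x := z) ((hF.differentiable (by simp)) z)
      ((hG.differentiable (by simp)) z) j
    simp only [this, mul_add, add_mul, Finset.sum_add_distrib]
    ring
  have h2 : ∀ H : R3 → ℂ, ContDiff ℝ 2 H → ∀ i, DifferentiableAt ℝ (fun z => sgrad H z i) x :=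
    fun H hH i => ((contDiff_pi.1 (contDiff_sgrad (m := 1) hH (by norm_num)) i).differentiable
      (by simp)) x
  unfold slap sdiv
  rw [h1]
  have := fun i j => pd_add (x := x) (h2 F hF j) (h2 G hG j) i
  simp only [this, mul_add, Finset.sum_add_distrib]
  ring

lemma slap_smul (c : ℂ) {F : R3 → ℂ} (hF : ContDiff ℝ 2 F) (x : R3) :
    slap (fun z => c * F z) x = c * slap F x := by
  have h1 : sgrad (fun z => c * F z) = fun z i => c * sgrad F z i := by
    funext z i
    simp only [sgrad]
    have := fun j => pd_smul c (x := z) ((hF.differentiable (by simp)) z) j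
    simp only [this, Fin.sum_univ_three]
    ring
  have h2 : ∀ i, DifferentiableAt ℝ (fun z => sgrad F z i) x :=
    fun i => ((contDiff_pi.1 (contDiff_sgrad (m := 1) hF (by norm_num)) i).differentiable
      (by simp)) x
  unfold slap sdiv
  rw [h1]
  have := fun i j => pd_smul c (x := x) (h2 j) i
  simp only [this, Fin.sum_univ_three]
  ring

/-! ### Spherical harmonics and Sobolev spaces -/

/-- `Y_k`: the `C²` functions `φ` on `S²` with `Δφ = -k(k+1)φ`, as a subspace of `L²`. -/
def Y (k : ℕ) : Submodule ℂ Fun2 where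
  carrier := {f | ∃ F : R3 → ℂ, ContDiff ℝ 2 F ∧
    (∀ x : R3, ‖x‖ = 1 → slap F x = -((k : ℂ) * (k + 1)) * F x) ∧
    f =ᵐ[surf] fun y => F (y : R3)}
  zero_mem' := by
    refine ⟨fun _ => 0, contDiff_const, fun x _ => ?_, Lp.coeFn_zero _ _ _⟩
    have := slap_smul 0 (F := fun _ => 0) contDiff_const x
    simp only [zero_mul] at this
    rw [this, mul_zero]
  add_mem' := by
    rintro f g ⟨F, hF, hF', hf⟩ ⟨G, hG, hG', hg⟩
    refine ⟨fun z => F z + G z, hF.add hG, fun x hx => ?_, ?_⟩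
    · rw [slap_add hF hG, hF' x hx, hG' x hx]; ring
    · filter_upwards [hf, hg, Lp.coeFn_add f g] with y hf hg hy
      rw [hy, Pi.add_apply, hf, hg]
  smul_mem' := by
    rintro c f ⟨F, hF, hF', hf⟩
    refine ⟨fun z => c * F z, contDiff_const.mul hF, fun x hx => ?_, ?_⟩
    · rw [slap_smul c hF, hF' x hx]; ring
    · filter_upwards [hf, Lp.coeFn_smul c f] with y hf hy
      rw [hy, Pi.smul_apply, hf, smul_eq_mul]

/-- The component in `Y_k` of an `L²` function: its orthogonal projection to (the closure of)
the finite dimensional space `Y_k`. -/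
def harm (k : ℕ) : Fun2 →L[ℂ] Fun2 := (Y k).topologicalClosure.starProjection

/-- The weights of the Sobolev norms: `k(k+1)` for `k ≥ 1`, and `1` for `k = 0`. -/
def wt (k : ℕ) : ℝ := if k = 0 then 1 else (k : ℝ) * (k + 1)

lemma wt_nonneg (k : ℕ) : 0 ≤ wt k := by unfold wt; split_ifs <;> positivity

/-- The Sobolev space `H^m(S²)` of functions. -/
def Hs (m : ℕ) : Submodule ℂ Fun2 where
  carrier := {f | Summable fun k => wt k ^ m * ‖harm k f‖ ^ 2}
  zero_mem' := by simp
  add_mem' := by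
    intro f g hf hg
    refine Summable.of_nonneg_of_le (fun k => ?_) (fun k => ?_)
      ((hf.mul_left 2).add (hg.mul_left 2))
    · have := wt_nonneg k; positivity
    · have h := norm_add_le (harm k f) (harm k g)
      have h2 : ‖harm k f + harm k g‖ ^ 2 ≤ 2 * ‖harm k f‖ ^ 2 + 2 * ‖harm k g‖ ^ 2 := by
        nlinarith [norm_nonneg (harm k f + harm k g), norm_nonneg (harm k f),
          norm_nonneg (harm k g), sq_nonneg (‖harm k f‖ - ‖harm k g‖)]
      rw [map_add]
      calc _ ≤ wt k ^ m * (2 * ‖harm k f‖ ^ 2 + 2 * ‖harm k g‖ ^ 2) :=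
            mul_le_mul_of_nonneg_left h2 (pow_nonneg (wt_nonneg k) m)
        _ = _ := by ring
  smul_mem' := by
    intro c f hf
    refine (hf.mul_left (‖c‖ ^ 2)).congr fun k => ?_
    rw [map_smul, norm_smul]; ring

/-- The square of the `H^m(S²)` norm of `f ∈ H^m(S²)`. -/
def hsq (m : ℕ) (f : Fun2) : ℝ := ∑' k, wt k ^ m * ‖harm k f‖ ^ 2

/-- The Sobolev space `H^{m+1}(S²)` of tangent fields: square integrable tangent fields whose
weak exterior derivative and codifferential are in `H^m(S²)`. -/
def tanHsSucc (m : ℕ) : Submodule ℂ Vec2 where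
  carrier := {ξ | Tangent ξ ∧ (∃ w ∈ Hs m, HasCurl ξ w) ∧ ∃ u ∈ Hs m, HasCodiff ξ u}
  zero_mem' := ⟨tangent_zero, ⟨0, zero_mem _, HasCurl.zero⟩, ⟨0, zero_mem _, HasCodiff.zero⟩⟩
  add_mem' := by
    rintro ξ η ⟨h, ⟨w, hw, h1⟩, u, hu, h2⟩ ⟨k, ⟨w', hw', k1⟩, u', hu', k2⟩
    exact ⟨h.add k, ⟨_, add_mem hw hw', h1.add k1⟩, _, add_mem hu hu', h2.add k2⟩
  smul_mem' := by
    rintro c ξ ⟨h, ⟨w, hw, h1⟩, u, hu, h2⟩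
    exact ⟨h.smul c, ⟨_, Submodule.smul_mem _ c hw, h1.smul c⟩,
      _, Submodule.smul_mem _ c hu, h2.smul c⟩

/-- Functions of mean zero. -/
def meanZero : Submodule ℂ Fun2 where
  carrier := {f | ∫ y, f y ∂surf = 0}
  zero_mem' := by
    have := pairF_smul 0 0 (fun _ => 1)
    simpa [pairF] using this
  add_mem' := by
    intro f g hf hg
    have := pairF_add f g (φ := fun _ => 1) continuous_const
    simp only [pairF, mul_one] at this
    simp only [Set.mem_ofPred_eq] at hf hg ⊢
    rw [this, hf, hg, add_zero]
  smul_mem' := by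
    intro c f hf
    have := pairF_smul c f (fun _ => 1)
    simp only [pairF, mul_one] at this
    simp only [Set.mem_ofPred_eq] at hf ⊢
    rw [this, hf, mul_zero]

/-! ### The space `X` and the operator `L₀` -/

/-- `X`: quadruples `(ξ, ξ', ϑ, ϑ^∗)` with `ξ` in `H²`, `ξ'` in `H¹` (tangent fields),
`ϑ` in `H²` of mean zero, and `ϑ^∗` in `H¹`. -/
def X : Submodule ℂ (Vec2 × Vec2 × Fun2 × Fun2) :=
  (tanHsSucc 1).prod ((tanHsSucc 0).prod ((Hs 2 ⊓ meanZero).prod (Hs 1)))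

/-- The domain of `L₀`: `ξ` in `H³`, `ξ'` in `H²` (tangent fields), `ϑ` in `H³` of mean zero,
and `ϑ^∗` in `H²`. -/
def Dom : Submodule ℂ (Vec2 × Vec2 × Fun2 × Fun2) :=
  (tanHsSucc 2).prod ((tanHsSucc 1).prod ((Hs 3 ⊓ meanZero).prod (Hs 2)))

/-- The norm of `X`. -/
def normX (Ξ : X) : ℝ :=
  Real.sqrt (hsq 1 (curl Ξ.1.1) + hsq 1 (codiff Ξ.1.1)
    + ‖curl Ξ.1.2.1‖ ^ 2 + ‖codiff Ξ.1.2.1‖ ^ 2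
    + hsq 2 Ξ.1.2.2.1 + hsq 1 Ξ.1.2.2.2)

/-- `L₀ (ξ, ξ', ϑ, ϑ^∗) = (f, f', g, g^∗)`, for `(ξ, ξ', ϑ, ϑ^∗)` in the domain of `L₀`;
here `u` stands for `d^∗ξ = -div ξ`, and `q` is given by `div ξ + ϑ + ϑ^∗ + q = 0`. -/
def IsL0 : X → X → Prop
  | ⟨(ξ, ξ', ϑ, ϑs), _⟩, ⟨(f, f', g, gs), _⟩ =>
    (ξ, ξ', ϑ, ϑs) ∈ Dom ∧ ∃ (u q lapϑ : Fun2) (lapξ gradp : Vec2),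
      HasCodiff ξ u ∧ -u + ϑ + ϑs + q = 0 ∧
      HasHodgeLap ξ lapξ ∧ HasGrad (q - (2 : ℂ) • ϑ) gradp ∧ HasLap ϑ lapϑ ∧
      f = -ξ' ∧
      f' = -ξ' + lapξ - gradp ∧
      g = -ϑs - q ∧
      gs = ϑs + (3 : ℂ) • q + lapϑ

/-- `Ξ` is in the eigenspace `E_k` of `L₀` for the eigenvalue `k`. -/
def InE (k : ℤ) (Ξ : X) : Prop := IsL0 Ξ ((k : ℂ) • Ξ)

/-- Boundedness of a linear operator on `X`. -/
def BoundedX (T : X →ₗ[ℂ] X) : Prop := ∃ C : ℝ, ∀ Ξ, normX (T Ξ) ≤ C * normX Ξ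

open Classical in
/-- `T = e^{L₀ s} P_S`, as a bounded operator: on the eigenspace `E_k` of `L₀` it is
multiplication by `e^{k s}` if `k ∈ S`, and zero otherwise. -/
def IsExpProj (S : Set ℤ) (s : ℝ) (T : X →ₗ[ℂ] X) : Prop :=
  BoundedX T ∧ ∀ (k : ℤ) (Ξ : X), InE k Ξ →
    T Ξ = if k ∈ S then (Real.exp (k * s) : ℂ) • Ξ else 0

open Classical in
/-- `P = P_S` is the spectral projection of `L₀` for the part `S` of the spectrum, as a bounded
operator: it is the identity on the eigenspaces `E_k` with `k ∈ S`, and zero on the others. -/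
def IsSpecProj (S : Set ℤ) (P : X →ₗ[ℂ] X) : Prop :=
  BoundedX P ∧ ∀ (k : ℤ) (Ξ : X), InE k Ξ → P Ξ = if k ∈ S then Ξ else 0

/-- `T s = e^{L₀ s} P` for `s` in the half line `J`, where `P = P_S`: a strongly continuous
semigroup of bounded operators on `X`. -/
structure IsSemigroup (S : Set ℤ) (P : X →ₗ[ℂ] X) (J : Set ℝ) (T : ℝ → X →ₗ[ℂ] X) : Prop where
  isExpProj : ∀ s ∈ J, IsExpProj S s (T s)
  zero : T 0 = P
  add : ∀ s ∈ J, ∀ t ∈ J, T (s + t) = T s ∘ₗ T t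
  cont : ∀ Ξ, ∀ s ∈ J, Tendsto (fun t => normX (T t Ξ - T s Ξ)) (𝓝[J] s) (𝓝 0)

end StokesSphere

end

noncomputable section

namespace StokesSphere

/-! The result is an explicit diagonalisation of L₀, plus one cancellation that makes the estimates
uniform in the degree.

On the sphere there is no nonzero square integrable harmonic field (`eq_zero_of_harmonic`), and
every pair of mean-zero functions is the curl and codifferential of a tangent field
(`exists_hodge`). So X is described by the six scalar functions ∗dξ, ∗dξ', d^∗ξ, d^∗ξ', ϑ, ϑ^∗
(`coord_injective`, `exists_coord`). Expanded in spherical harmonics, the square of the norm is a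
weighted sum over degrees (`hasSum_energy`), and L₀ acts in degree k through the real matrix `genMat
k` (`IsL0.mode_eq`).

For k ≥ 1 this matrix splits into a 2×2 block for the curls, with eigenvalues k and -(k+1), and a
4×4 block with eigenvalues k+1, k-1, -k, -(k+2). In degree 0 only ϑ^∗ survives, with eigenvalue -2.
The eigenvectors are explicit (`colR`, `rowR`), so e^{L₀s}P_S is the operator with matrix `expMat S
s k` in degree k, and the question is whether these matrices are bounded uniformly in k.

A single eigenprojection of the 4×4 block is not: measured in the Sobolev weights, right
eigenvectors have size k² and left ones only 1/k. But the right eigenvectors for k+1 and k-1 are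
parallel to leading order and the left ones opposite, and likewise for -(k+2) and -k. If S contains
both members of a pair, the leading parts cancel up to the difference of the two exponentials; this
difference costs a factor k|s|, which the distance from the spectrum in degree k to the claimed rate
absorbs (`abs_pair_le`, `mul_exp_le`). From degree 4 on the half lines S never break a pair, and the
eigenvalues 0 and 1 do not occur; the lower degrees are finitely many (`exists_low_bound`).

Uniqueness holds because finite sums of eigenvectors are dense (`exists_eigen_sum`,
`exists_expansion`), so that a bounded operator is determined by its values on the eigenspaces.
Strong continuity is dominated convergence over the degrees.

The analysis on the sphere rests on rotation invariance of the measure: the components of x × ∇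
generate rotations and hence integrate to zero (`integral_fderiv_rotGen`), which gives all Green
formulas. Completeness of the harmonics comes from Stone–Weierstrass and the splitting of
polynomials into eigenfunctions (`exists_sum_eigenPoly`). -/

/-! ### Rotations and integration by parts on the sphere -/

/-- A linear isometry of `ℝ³` acting on the sphere. -/
def sphereMap (R : R3 ≃ₗᵢ[ℝ] R3) : S2 ≃ₜ S2 where
  toFun y := ⟨R y, by simp⟩
  invFun y := ⟨R.symm y, by simp⟩
  left_inv y := by ext; simp
  right_inv y := by ext; simp
  continuous_toFun := by fun_prop
  continuous_invFun := by fun_prop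

/-- Up to a constant factor, the surface measure of a set is the volume of the unit cone over it; a
linear isometry commutes with forming cones and preserves volume. -/
lemma measurePreserving_sphereMap (R : R3 ≃ₗᵢ[ℝ] R3) :
    MeasurePreserving (sphereMap R) surf surf := by
  refine ⟨(sphereMap R).continuous.measurable, ?_⟩
  ext s hs
  rw [Measure.map_apply (sphereMap R).continuous.measurable hs]
  unfold surf
  rw [Measure.toSphere_apply' _ hs,
    Measure.toSphere_apply' _ ((sphereMap R).continuous.measurable hs)]
  congr 1
  rw [← R.symm.measurePreserving.measure_preimage_equiv (f := R.symm.toHomeomorph.toMeasurableEquiv)]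
  congr 1
  ext x
  simp only [Set.mem_smul, Set.mem_image, Set.mem_preimage]
  constructor
  · rintro ⟨r, hr, _, ⟨y, hy, rfl⟩, h⟩
    have h' : r • (y : R3) = R.symm x := h
    refine ⟨r, hr, _, ⟨_, hy, rfl⟩, ?_⟩
    have := congrArg R h'
    simpa [sphereMap] using this
  · rintro ⟨r, hr, _, ⟨y, hy, rfl⟩, rfl⟩
    refine ⟨r, hr, _, ⟨(sphereMap R).symm y, by simpa using hy, rfl⟩, ?_⟩
    change r • R.symm (y : R3) = R.symm (r • (y : R3))
    simp

/-- The generators of the rotations: `x ↦ eᵢ × x`. -/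
def rotGen (i : Fin 3) : R3 →L[ℝ] R3 :=
  LinearMap.toContinuousLinearMap
    { toFun := fun x => WithLp.toLp 2 (crossProduct (Pi.single i 1) (WithLp.ofLp x))
      map_add' := by intros; simp
      map_smul' := by intros; simp }

lemma rotGen_mem (i : Fin 3) : rotGen i ∈ skewAdjoint (R3 →L[ℝ] R3) := by
  rw [skewAdjoint.mem_iff, ContinuousLinearMap.star_eq_adjoint]
  refine (ContinuousLinearMap.eq_adjoint_iff _ _).2 ?_ |>.symm
  intro x y
  fin_cases i <;>
  simp [rotGen, cross_apply, PiLp.inner_apply, Fin.sum_univ_three]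

/-- The mean of F over the sphere does not change when F is composed with the rotations exp(tA);
differentiating under the integral at t = 0 gives the claim. Every integration by parts below
descends from this. -/
lemma integral_fderiv_rotGen (i : Fin 3) {F : R3 → ℂ} (hF : ContDiff ℝ 1 F) :
    ∫ y : S2, fderiv ℝ F y (rotGen i y) ∂surf = 0 := by
  set A := rotGen i
  let : NormedAlgebra ℚ (R3 →L[ℝ] R3) := NormedAlgebra.restrictScalars ℚ ℝ _
  have hU : ∀ t : ℝ, NormedSpace.exp (t • A) ∈ unitary (R3 →L[ℝ] R3) := fun t =>
    NormedSpace.exp_mem_unitary_of_mem_skewAdjoint (skewAdjoint.smul_mem t (rotGen_mem i))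
  let R : ℝ → R3 ≃ₗᵢ[ℝ] R3 := fun t => Unitary.linearIsometryEquiv ⟨_, hU t⟩
  have hR : ∀ t x, R t x = NormedSpace.exp (t • A) x := fun _ _ => rfl
  have hconst : ∀ t, ∫ y : S2, F (R t y) ∂surf = ∫ y : S2, F y ∂surf := fun t =>
    (measurePreserving_sphereMap (R t)).integral_comp
      (sphereMap (R t)).measurableEmbedding (fun y : S2 => F y)
  have hd : ∀ t x, HasDerivAt (fun t => R t x) (A (R t x)) t := by
    intro t x
    exact (ContinuousLinearMap.apply ℝ R3 x).hasFDerivAt.comp_hasDerivAt t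
      (hasDerivAt_exp_smul_const' A t)
  have hFd : ∀ x, HasFDerivAt F (fderiv ℝ F x) x := fun x =>
    (hF.differentiable (by simp) x).hasFDerivAt
  have hcont : Continuous fun x => fderiv ℝ F x (A x) :=
    (hF.continuous_fderiv (by simp)).clm_apply A.continuous
  -- One maximum over the sphere dominates the derivative for all t, since rotated points stay on
  -- the sphere.
  obtain ⟨C, hC⟩ := ((isCompact_sphere (0 : R3) 1).image hcont).isBounded.exists_norm_le
  have key := hasDerivAt_integral_of_dominated_loc_of_deriv_le (μ := surf) (𝕜 := ℝ)
    (F := fun t (y : S2) => F (R t y)) (F' := fun t (y : S2) => fderiv ℝ F (R t y) (A (R t y)))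
    (x₀ := 0) (s := Set.univ) (bound := fun _ => C) univ_mem
    (Eventually.of_forall fun t => (hF.continuous.comp
      ((R t).continuous.comp continuous_subtype_val)).aestronglyMeasurable)
    ?_ ?_ ?_ ?_ ?_
  · have h1 := key.2
    simp only [hconst] at h1
    have h2 := h1.unique (hasDerivAt_const _ _)
    have h0 : ∀ x, R 0 x = x := fun x => by
      have hz : NormedSpace.exp ((0 : ℝ) • A) = 1 :=
        (congrArg _ (zero_smul ℝ A)).trans NormedSpace.exp_zero
      rw [hR, hz]; rfl
    simpa only [h0] using h2
  · simpa using integrable_mul (u := fun _ => 1) (φ := fun x => F (R 0 x)) (memLp_const 1)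
      (hF.continuous.comp (R 0).continuous)
  · exact (hcont.comp ((R 0).continuous.comp continuous_subtype_val)).aestronglyMeasurable
  · refine Eventually.of_forall fun y t _ => hC _ ⟨R t y, by simp, rfl⟩
  · exact integrable_const _
  · refine Eventually.of_forall fun y t _ => ?_
    exact (hFd _).comp_hasDerivAt t (hd t y)

lemma fderiv_eq_sum_pd (F : R3 → ℂ) (x v : R3) : fderiv ℝ F x v = ∑ j, (v j : ℂ) * pd j F x := by
  have hv : v = ∑ j, v j • EuclideanSpace.single j (1 : ℝ) := by
    ext i; fin_cases i <;> simp [Fin.sum_univ_three]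
  conv_lhs => rw [hv]
  simp [pd]

/-- By the triple product, (eᵢ × x) · ∇F = eᵢ · (x × ∇F). Hence each component of `srot` is a
derivation with vanishing integral. -/
lemma fderiv_rotGen (i : Fin 3) (F : R3 → ℂ) (x : R3) :
    fderiv ℝ F x (rotGen i x) = srot F x i := by
  rw [fderiv_eq_sum_pd]
  fin_cases i <;> simp [rotGen, srot, cross_apply, Fin.sum_univ_three] <;> ring

lemma integrable_sphere {φ : R3 → ℂ} (hφ : Continuous φ) :
    Integrable (fun y : S2 => φ y) surf := by
  simpa using integrable_mul (u := fun _ => 1) (memLp_const 1) hφ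

lemma pd_mul {F G : R3 → ℂ} {x : R3} (hF : DifferentiableAt ℝ F x)
    (hG : DifferentiableAt ℝ G x) (i : Fin 3) :
    pd i (fun z => F z * G z) x = F x * pd i G x + G x * pd i F x := by
  unfold pd
  rw [fderiv_fun_mul hF hG]; rfl

lemma pd_sub {F G : R3 → ℂ} {x : R3} (hF : DifferentiableAt ℝ F x)
    (hG : DifferentiableAt ℝ G x) (i : Fin 3) :
    pd i (fun z => F z - G z) x = pd i F x - pd i G x := by
  unfold pd
  rw [fderiv_fun_sub hF hG]; rfl

lemma pd_coord (i j : Fin 3) (x : R3) :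
    pd i (fun z => (z j : ℂ)) x = if i = j then 1 else 0 := by
  have h : HasFDerivAt (fun z : R3 => (z j : ℂ))
      (Complex.ofRealCLM.comp (EuclideanSpace.proj (𝕜 := ℝ) j : R3 →L[ℝ] ℝ)) x :=
    (Complex.ofRealCLM.comp (EuclideanSpace.proj (𝕜 := ℝ) j : R3 →L[ℝ] ℝ)).hasFDerivAt
  unfold pd
  rw [h.fderiv]
  by_cases hij : i = j
  · subst hij; simp
  · simp [hij, Ne.symm hij]

@[fun_prop]
lemma differentiableAt_coord (i : Fin 3) (x : R3) :
    DifferentiableAt ℝ (fun z : R3 => (z i : ℂ)) x :=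
  (contDiff_coord (n := 1) i).differentiable (by simp) x

lemma pd_comm {F : R3 → ℂ} (hF : ContDiff ℝ 2 F) (i j : Fin 3) (x : R3) :
    pd i (pd j F) x = pd j (pd i F) x := by
  have hd : DifferentiableAt ℝ (fderiv ℝ F) x :=
    (hF.fderiv_right (m := 1) (by norm_num)).differentiable (by simp) x
  have h : ∀ a b : Fin 3, pd a (pd b F) x =
      fderiv ℝ (fderiv ℝ F) x (EuclideanSpace.single a 1) (EuclideanSpace.single b 1) := by
    intro a b
    change fderiv ℝ (fun z => fderiv ℝ F z (EuclideanSpace.single b 1)) x _ = _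
    rw [fderiv_clm_apply hd (differentiableAt_const _)]
    simp
  rw [h, h]
  exact (hF.contDiffAt.isSymmSndFDerivAt (by simp)).eq _ _

lemma srot_apply_zero (F : R3 → ℂ) (x : R3) :
    srot F x 0 = x 1 * pd 2 F x - x 2 * pd 1 F x := by simp [srot, cross_apply]

lemma srot_apply_one (F : R3 → ℂ) (x : R3) :
    srot F x 1 = x 2 * pd 0 F x - x 0 * pd 2 F x := by simp [srot, cross_apply]

lemma srot_apply_two (F : R3 → ℂ) (x : R3) :
    srot F x 2 = x 0 * pd 1 F x - x 1 * pd 0 F x := by simp [srot, cross_apply]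

lemma contDiff_srot {n m : WithTop ℕ∞} {F : R3 → ℂ} (hF : ContDiff ℝ n F) (h : m + 1 ≤ n) :
    ContDiff ℝ m (srot F) := by
  have hp := fun i => contDiff_pd hF h i
  have hc : ∀ i : Fin 3, ContDiff ℝ m (fun x : R3 => (x i : ℂ)) := fun i => contDiff_coord i
  refine contDiff_pi.2 fun i => ?_
  fin_cases i
  · simpa only [Fin.zero_eta, srot_apply_zero] using
      ((hc 1).mul (hp 2)).sub ((hc 2).mul (hp 1))
  · simpa only [Fin.mk_one, srot_apply_one] using
      ((hc 2).mul (hp 0)).sub ((hc 0).mul (hp 2))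
  · simpa only [Fin.reduceFinMk, srot_apply_two] using
      ((hc 0).mul (hp 1)).sub ((hc 1).mul (hp 0))

lemma continuous_srot_apply {F : R3 → ℂ} (hF : ContDiff ℝ 1 F) (i : Fin 3) :
    Continuous fun x => srot F x i := (continuous_apply i).comp (continuous_srot hF)

lemma srot_mul {F G : R3 → ℂ} (hF : ContDiff ℝ 1 F) (hG : ContDiff ℝ 1 G) (x : R3) (i : Fin 3) :
    srot (fun z => F z * G z) x i = F x * srot G x i + G x * srot F x i := by
  simp only [← fderiv_rotGen]
  rw [fderiv_fun_mul (hF.differentiable (by simp) x) (hG.differentiable (by simp) x)]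
  rfl

lemma integral_srot_mul {F G : R3 → ℂ} (hF : ContDiff ℝ 1 F) (hG : ContDiff ℝ 1 G) (i : Fin 3) :
    ∫ y : S2, srot F y i * G y ∂surf = - ∫ y : S2, F y * srot G y i ∂surf := by
  have h := integral_fderiv_rotGen i (hF.mul hG)
  simp only [fderiv_rotGen, srot_mul hF hG] at h
  rw [integral_add
    (integrable_sphere (φ := fun x => F x * srot G x i)
      (hF.continuous.mul (continuous_srot_apply hG i)))
    (integrable_sphere (φ := fun x => G x * srot F x i)
      (hG.continuous.mul (continuous_srot_apply hF i)))] at h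
  rw [eq_neg_iff_add_eq_zero, add_comm, ← h]
  simp only [mul_comm]

/-! ### Pointwise identities on the sphere -/

lemma sum_sq_eq_one {x : R3} (hx : ‖x‖ = 1) :
    (x 0 : ℂ) ^ 2 + (x 1 : ℂ) ^ 2 + (x 2 : ℂ) ^ 2 = 1 := by
  have h := EuclideanSpace.norm_sq_eq x
  rw [hx, one_pow, Fin.sum_univ_three] at h
  simp only [Real.norm_eq_abs, sq_abs] at h
  have h' := congrArg Complex.ofReal h.symm
  push_cast at h'
  exact h'

lemma pd_srot {F : R3 → ℂ} {x : R3} (hF : ContDiff ℝ 2 F) (i : Fin 3) :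
    pd i (fun z => srot F z 0) x = (x 1 * pd i (pd 2 F) x - x 2 * pd i (pd 1 F) x)
        + ((if i = 1 then 1 else 0) * pd 2 F x - (if i = 2 then 1 else 0) * pd 1 F x) ∧
    pd i (fun z => srot F z 1) x = (x 2 * pd i (pd 0 F) x - x 0 * pd i (pd 2 F) x)
        + ((if i = 2 then 1 else 0) * pd 0 F x - (if i = 0 then 1 else 0) * pd 2 F x) ∧
    pd i (fun z => srot F z 2) x = (x 0 * pd i (pd 1 F) x - x 1 * pd i (pd 0 F) x)
        + ((if i = 0 then 1 else 0) * pd 1 F x - (if i = 1 then 1 else 0) * pd 0 F x) := by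
  have hd : ∀ j, DifferentiableAt ℝ (pd j F) x := fun j =>
    (contDiff_pd (m := 1) hF (by norm_num) j).differentiable (by simp) x
  have hm : ∀ a b : Fin 3, DifferentiableAt ℝ (fun z : R3 => (z a : ℂ) * pd b F z) x := fun a b =>
    (differentiableAt_coord a x).mul (hd b)
  simp only [srot_apply_zero, srot_apply_one, srot_apply_two, pd_sub (hm _ _) (hm _ _),
    pd_mul (differentiableAt_coord _ x) (hd _), pd_coord]
  refine ⟨?_, ?_, ?_⟩ <;> ring

lemma pd_sgrad {F : R3 → ℂ} {x : R3} (hF : ContDiff ℝ 2 F) (i j : Fin 3) :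
    pd i (fun z => sgrad F z j) x = pd i (pd j F) x
      - (x 0 * pd 0 F x + x 1 * pd 1 F x + x 2 * pd 2 F x) * (if i = j then 1 else 0)
      - x j * (pd i F x + x 0 * pd i (pd 0 F) x + x 1 * pd i (pd 1 F) x
        + x 2 * pd i (pd 2 F) x) := by
  have hd : ∀ j, DifferentiableAt ℝ (pd j F) x := fun j =>
    (contDiff_pd (m := 1) hF (by norm_num) j).differentiable (by simp) x
  have hm : ∀ a b : Fin 3, DifferentiableAt ℝ (fun z : R3 => (z a : ℂ) * pd b F z) x := fun a b =>
    (differentiableAt_coord a x).mul (hd b)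
  have ht : DifferentiableAt ℝ (fun z : R3 => (z 0 : ℂ) * pd 0 F z + (z 1 : ℂ) * pd 1 F z) x :=
    (hm 0 0).add (hm 1 1)
  have hs : DifferentiableAt ℝ (fun z : R3 => (z 0 : ℂ) * pd 0 F z + (z 1 : ℂ) * pd 1 F z
    + (z 2 : ℂ) * pd 2 F z) x := ht.add (hm 2 2)
  simp only [sgrad, Fin.sum_univ_three]
  rw [pd_sub (G := fun z => ((z 0 : ℂ) * pd 0 F z + (z 1 : ℂ) * pd 1 F z
    + (z 2 : ℂ) * pd 2 F z) * (z j : ℂ)) (hd j) (hs.mul (differentiableAt_coord j x)),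
    pd_mul hs (differentiableAt_coord j x), pd_add ht (hm 2 2),
    pd_add (hm 0 0) (hm 1 1)]
  simp only [pd_mul (differentiableAt_coord _ x) (hd _), pd_coord]
  fin_cases i <;> simp <;> ring

/-- The Laplace-Beltrami operator in terms of Euclidean derivatives. -/
lemma slap_eq {F : R3 → ℂ} (hF : ContDiff ℝ 2 F) {x : R3} (hx : ‖x‖ = 1) :
    slap F x = ∑ i, pd i (pd i F) x - ∑ i, ∑ j, (x i : ℂ) * x j * pd i (pd j F) x
      - 2 * ∑ i, x i * pd i F x := by
  have h1 := sum_sq_eq_one hx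
  simp only [slap, sdiv, Fin.sum_univ_three, pd_sgrad hF]
  simp only [Fin.isValue, if_true, Fin.reduceEq, if_false]
  linear_combination (x 0 * x 0 * pd 0 (pd 0 F) x + x 0 * x 1 * pd 0 (pd 1 F) x
    + x 0 * x 2 * pd 0 (pd 2 F) x + x 1 * x 0 * pd 1 (pd 0 F) x + x 1 * x 1 * pd 1 (pd 1 F) x
    + x 1 * x 2 * pd 1 (pd 2 F) x + x 2 * x 0 * pd 2 (pd 0 F) x + x 2 * x 1 * pd 2 (pd 1 F) x
    + x 2 * x 2 * pd 2 (pd 2 F) x + 2 * (x 0 * pd 0 F x + x 1 * pd 1 F x + x 2 * pd 2 F x)) * h1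

/-- The Casimir form of the Laplacian: a sum of squares of the rotation generators. -/
lemma slap_eq_srot {F : R3 → ℂ} (hF : ContDiff ℝ 2 F) {x : R3} (hx : ‖x‖ = 1) :
    slap F x = ∑ i, srot (fun z => srot F z i) x i := by
  have h1 := sum_sq_eq_one hx
  rw [slap_eq hF hx]
  simp only [Fin.sum_univ_three, srot_apply_zero (fun z => srot F z 0),
    srot_apply_one (fun z => srot F z 1), srot_apply_two (fun z => srot F z 2), pd_srot hF]
  simp only [pd_comm hF 1 0, pd_comm hF 2 0, pd_comm hF 2 1]
  simp
  linear_combination (-(pd 0 (pd 0 F) x + pd 1 (pd 1 F) x + pd 2 (pd 2 F) x)) * h1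

lemma sum_sgrad_mul_coord (F : R3 → ℂ) {x : R3} (hx : ‖x‖ = 1) :
    ∑ i, sgrad F x i * x i = 0 := by
  have h1 := sum_sq_eq_one hx
  simp only [Fin.sum_univ_three, sgrad]
  linear_combination (-(x 0 * pd 0 F x + x 1 * pd 1 F x + x 2 * pd 2 F x)) * h1

lemma sum_srot_mul_coord (F : R3 → ℂ) (x : R3) : ∑ i, srot F x i * x i = 0 := by
  simp only [Fin.sum_univ_three, srot_apply_zero, srot_apply_one, srot_apply_two]
  ring

lemma sum_srot_mul_sgrad (F G : R3 → ℂ) (x : R3) :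
    ∑ i, srot F x i * sgrad G x i = ∑ i, srot F x i * pd i G x := by
  simp only [Fin.sum_univ_three, sgrad, srot_apply_zero, srot_apply_one, srot_apply_two]
  ring

lemma sum_srot_pd {G : R3 → ℂ} (hG : ContDiff ℝ 2 G) (x : R3) : ∑ i, srot (pd i G) x i = 0 := by
  simp only [Fin.sum_univ_three, srot_apply_zero, srot_apply_one, srot_apply_two]
  simp only [pd_comm hG 1 0, pd_comm hG 2 0, pd_comm hG 2 1]
  ring

lemma scurl_eq_srot (V : R3 → Fin 3 → ℂ) (x : R3) :
    scurl V x = ∑ i, srot (fun z => V z i) x i := by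
  simp only [scurl, Fin.sum_univ_three, srot_apply_zero, srot_apply_one, srot_apply_two]
  ring

lemma scurl_srot {F : R3 → ℂ} (hF : ContDiff ℝ 2 F) {x : R3} (hx : ‖x‖ = 1) :
    scurl (srot F) x = slap F x := by
  rw [scurl_eq_srot, slap_eq_srot hF hx]

lemma scurl_sgrad {F : R3 → ℂ} (hF : ContDiff ℝ 2 F) {x : R3} :
    scurl (sgrad F) x = 0 := by
  simp only [scurl, pd_sgrad hF]
  simp only [pd_comm hF 1 0, pd_comm hF 2 0, pd_comm hF 2 1]
  simp
  ring

lemma sdiv_srot {F : R3 → ℂ} (hF : ContDiff ℝ 2 F) {x : R3} :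
    sdiv (srot F) x = 0 := by
  simp only [sdiv, Fin.sum_univ_three, pd_srot hF]
  simp only [pd_comm hF 1 0, pd_comm hF 2 0, pd_comm hF 2 1]
  simp
  ring

/-- The field `x ↦ x × V`. -/
def rotV (V : R3 → Fin 3 → ℂ) (x : R3) : Fin 3 → ℂ := crossProduct (fun i => (x i : ℂ)) (V x)

/-- A quarter turn in the tangent plane exchanges divergence and curl, so the Green formula for
`srot` also yields the one for the gradient. -/
lemma sdiv_eq_srot {V : R3 → Fin 3 → ℂ} (hV : ContDiff ℝ 1 V) {x : R3} (hx : ‖x‖ = 1)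
    (ht : ∑ i, V x i * x i = 0) : sdiv V x = ∑ i, srot (fun z => rotV V z i) x i := by
  have h1 := sum_sq_eq_one hx
  have hd : ∀ j, DifferentiableAt ℝ (fun z => V z j) x := fun j =>
    (contDiff_pi.1 hV j).differentiable (by simp) x
  have hm : ∀ a b : Fin 3, DifferentiableAt ℝ (fun z : R3 => (z a : ℂ) * V z b) x := fun a b =>
    (differentiableAt_coord a x).mul (hd b)
  simp only [Fin.sum_univ_three, srot_apply_zero, srot_apply_one, srot_apply_two]
  simp only [rotV, cross_apply, Matrix.cons_val, sdiv, Fin.sum_univ_three, pd_sub (hm _ _) (hm _ _),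
    pd_mul (differentiableAt_coord _ x) (hd _), pd_coord]
  simp only [Fin.isValue, if_true, Fin.reduceEq, if_false, Fin.sum_univ_three] at ht ⊢
  linear_combination -(pd 0 (fun z => V z 0) x + pd 1 (fun z => V z 1) x
    + pd 2 (fun z => V z 2) x) * h1 + 2 * ht

lemma sum_sgrad_mul (F : R3 → ℂ) {V : R3 → Fin 3 → ℂ} {x : R3} (hx : ‖x‖ = 1) :
    ∑ i, sgrad F x i * V x i = ∑ i, srot F x i * rotV V x i := by
  have h1 := sum_sq_eq_one hx
  simp only [Fin.sum_univ_three, srot_apply_zero, srot_apply_one, srot_apply_two]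
  simp only [rotV, cross_apply, Matrix.cons_val, sgrad, Fin.sum_univ_three]
  linear_combination -(pd 0 F x * V x 0 + pd 1 F x * V x 1 + pd 2 F x * V x 2) * h1

/-- The tangential part of `(ΔF) eᵢ` is the sum of a gradient and a rotated gradient. -/
lemma slap_mul_tangent {F : R3 → ℂ} (hF : ContDiff ℝ 3 F) {x : R3} (hx : ‖x‖ = 1) (i j : Fin 3) :
    slap F x * ((if i = j then 1 else 0) - x i * x j) =
      sgrad (fun z => sgrad F z i) x j + srot (fun z => srot F z i) x j := by
  have h1 := sum_sq_eq_one hx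
  have hF2 : ContDiff ℝ 2 F := hF.of_le (by norm_num)
  -- Off the sphere the Euclidean expressions differ by a multiple of |x|² - 1; with that multiple
  -- made explicit, what remains is a ring identity.
  suffices h : slap F x * ((if i = j then 1 else 0) - x i * x j) =
      sgrad (fun z => sgrad F z i) x j + srot (fun z => srot F z i) x j
      + (pd i (pd j F) x - (∑ i, pd i (pd i F) x) * (if i = j then 1 else 0))
        * ((x 0 : ℂ) ^ 2 + (x 1 : ℂ) ^ 2 + (x 2 : ℂ) ^ 2 - 1) by
    rw [h, h1, sub_self, mul_zero, add_zero]
  rw [slap_eq hF2 hx]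
  simp only [sgrad.eq_1 (fun z => sgrad F z i), pd_sgrad hF2, Fin.sum_univ_three]
  fin_cases i <;> fin_cases j <;>
  simp only [Fin.zero_eta, Fin.mk_one, Fin.reduceFinMk, srot_apply_zero (fun z => srot F z _),
    srot_apply_one (fun z => srot F z _), srot_apply_two (fun z => srot F z _), pd_srot hF2,
    pd_comm hF2 1 0, pd_comm hF2 2 0, pd_comm hF2 2 1, Fin.isValue, if_true, Fin.reduceEq,
    if_false] <;> ring

/-! ### Green's formulas -/

lemma two_le_infty : (2 : WithTop ℕ∞) ≤ ∞ := ENat.LEInfty.out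

lemma norm_coe_S2 (y : S2) : ‖(y : R3)‖ = 1 := by simp

lemma contDiff_rotV {n : WithTop ℕ∞} {V : R3 → Fin 3 → ℂ} (hV : ContDiff ℝ n V) :
    ContDiff ℝ n (rotV V) := by
  have hp := contDiff_pi.1 hV
  have hc : ∀ i : Fin 3, ContDiff ℝ n (fun x : R3 => (x i : ℂ)) := fun i => contDiff_coord i
  refine contDiff_pi.2 fun i => ?_
  fin_cases i
  · simpa only [rotV, cross_apply, Fin.zero_eta, Matrix.cons_val] using
      ((hc 1).mul (hp 2)).sub ((hc 2).mul (hp 1))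
  · simpa only [rotV, cross_apply, Fin.mk_one, Matrix.cons_val] using
      ((hc 2).mul (hp 0)).sub ((hc 0).mul (hp 2))
  · simpa only [rotV, cross_apply, Fin.reduceFinMk, Matrix.cons_val] using
      ((hc 0).mul (hp 1)).sub ((hc 1).mul (hp 0))

lemma integral_sum_srot_mul {F : R3 → ℂ} {V : R3 → Fin 3 → ℂ} (hF : ContDiff ℝ 1 F)
    (hV : ContDiff ℝ 1 V) :
    ∫ y : S2, ∑ i, srot F y i * V y i ∂surf
      = - ∫ y : S2, F y * ∑ i, srot (fun z => V z i) y i ∂surf := by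
  have hV' := contDiff_pi.1 hV
  simp only [Finset.mul_sum]
  rw [integral_finsetSum _ fun i _ => integrable_sphere (φ := fun x => srot F x i * V x i)
      ((continuous_srot_apply hF i).mul (hV' i).continuous),
    integral_finsetSum _ fun i _ => integrable_sphere
      (φ := fun x => F x * srot (fun z => V z i) x i)
      (hF.continuous.mul (continuous_srot_apply (hV' i) i)), ← Finset.sum_neg_distrib]
  exact Finset.sum_congr rfl fun i _ => integral_srot_mul hF (hV' i) i

lemma integral_srot_mul_eq_scurl {F : R3 → ℂ} {V : R3 → Fin 3 → ℂ} (hF : ContDiff ℝ 1 F)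
    (hV : ContDiff ℝ 1 V) :
    ∫ y : S2, ∑ i, srot F y i * V y i ∂surf = - ∫ y : S2, F y * scurl V y ∂surf := by
  rw [integral_sum_srot_mul hF hV]
  simp only [scurl_eq_srot]

lemma integral_sgrad_mul_eq_sdiv {F : R3 → ℂ} {V : R3 → Fin 3 → ℂ} (hF : ContDiff ℝ 1 F)
    (hV : ContDiff ℝ 1 V) (ht : ∀ x : R3, ‖x‖ = 1 → ∑ i, V x i * (x i : ℂ) = 0) :
    ∫ y : S2, ∑ i, sgrad F y i * V y i ∂surf = - ∫ y : S2, F y * sdiv V y ∂surf := by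
  have h1 : ∀ y : S2, ∑ i, sgrad F y i * V y i = ∑ i, srot F y i * rotV V y i := fun y =>
    sum_sgrad_mul F (norm_coe_S2 y)
  have h2 : ∀ y : S2, sdiv V y = ∑ i, srot (fun z => rotV V z i) y i := fun y =>
    sdiv_eq_srot hV (norm_coe_S2 y) (ht y (norm_coe_S2 y))
  simp only [h1, h2]
  exact integral_sum_srot_mul hF (contDiff_rotV hV)

/-- The integrated form of d² = 0: after integration by parts only antisymmetrised second
derivatives of G remain. -/
lemma integral_srot_mul_sgrad {F G : R3 → ℂ} (hF : ContDiff ℝ 1 F) (hG : ContDiff ℝ 2 G) :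
    ∫ y : S2, ∑ i, srot F y i * sgrad G y i ∂surf = 0 := by
  simp only [sum_srot_mul_sgrad]
  rw [integral_sum_srot_mul hF (V := fun x i => pd i G x)
    (contDiff_pi.2 fun i => contDiff_pd hG (by norm_num) i)]
  simp [sum_srot_pd hG]

lemma integral_slap_mul {F G : R3 → ℂ} (hF : ContDiff ℝ 2 F) (hG : ContDiff ℝ 1 G) :
    ∫ y : S2, G y * slap F y ∂surf = - ∫ y : S2, ∑ i, sgrad G y i * sgrad F y i ∂surf := by
  rw [integral_sgrad_mul_eq_sdiv hG (contDiff_sgrad hF (by norm_num))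
    (fun x hx => sum_sgrad_mul_coord F hx), neg_neg]
  rfl

lemma integral_slap_symm {F G : R3 → ℂ} (hF : ContDiff ℝ 2 F) (hG : ContDiff ℝ 2 G) :
    ∫ y : S2, G y * slap F y ∂surf = ∫ y : S2, F y * slap G y ∂surf := by
  rw [integral_slap_mul hF (hG.of_le (by norm_num)), integral_slap_mul hG (hF.of_le (by norm_num))]
  simp only [mul_comm]

/-! ### Smooth representatives -/

/-- The `L²` function `f` is the restriction of `F`. -/
def IsRep (f : Fun2) (F : R3 → ℂ) : Prop := ∀ᵐ y : S2 ∂surf, f y = F y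

/-- The `L²` field `ξ` is the restriction of `V`. -/
def IsRepV (ξ : Vec2) (V : R3 → Fin 3 → ℂ) : Prop := ∀ᵐ y : S2 ∂surf, ∀ i, ξ y i = V y i

lemma exists_isRep {F : R3 → ℂ} (hF : Continuous F) : ∃ f, IsRep f F := by
  have hc : Continuous (fun y : S2 => F y) := hF.comp continuous_subtype_val
  obtain ⟨C, hC⟩ := (isCompact_range hc).isBounded.exists_norm_le
  have : MemLp (fun y : S2 => F y) 2 surf :=
    MemLp.of_bound hc.aestronglyMeasurable C (Eventually.of_forall fun y => hC _ ⟨y, rfl⟩)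
  exact ⟨this.toLp _, this.coeFn_toLp⟩

lemma exists_isRepV {V : R3 → Fin 3 → ℂ} (hV : Continuous V) : ∃ ξ, IsRepV ξ V := by
  have hc : Continuous (fun y : S2 => (WithLp.toLp 2 (V y) : EuclideanSpace ℂ (Fin 3))) :=
    (PiLp.continuous_toLp 2 _).comp (hV.comp continuous_subtype_val)
  obtain ⟨C, hC⟩ := (isCompact_range hc).isBounded.exists_norm_le
  have : MemLp (fun y : S2 => (WithLp.toLp 2 (V y) : EuclideanSpace ℂ (Fin 3))) 2 surf :=
    MemLp.of_bound hc.aestronglyMeasurable C (Eventually.of_forall fun y => hC _ ⟨y, rfl⟩)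
  refine ⟨this.toLp _, ?_⟩
  filter_upwards [this.coeFn_toLp] with y hy i
  rw [hy]

lemma IsRep.pairF_eq {f : Fun2} {F : R3 → ℂ} (h : IsRep f F) (φ : R3 → ℂ) :
    pairF f φ = ∫ y : S2, F y * φ y ∂surf := by
  refine integral_congr_ae ?_
  filter_upwards [h] with y hy
  rw [hy]

lemma IsRepV.pairV_eq {ξ : Vec2} {V : R3 → Fin 3 → ℂ} (h : IsRepV ξ V) (W : R3 → Fin 3 → ℂ) :
    pairV ξ W = ∫ y : S2, ∑ i, V y i * W y i ∂surf := by
  refine integral_congr_ae ?_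
  filter_upwards [h] with y hy
  simp only [hy]

lemma IsRep.add {f g : Fun2} {F G : R3 → ℂ} (hf : IsRep f F) (hg : IsRep g G) :
    IsRep (f + g) (fun x => F x + G x) := by
  filter_upwards [hf, hg, Lp.coeFn_add f g] with y h1 h2 h3
  rw [h3, Pi.add_apply, h1, h2]

lemma IsRep.smul (c : ℂ) {f : Fun2} {F : R3 → ℂ} (hf : IsRep f F) :
    IsRep (c • f) (fun x => c * F x) := by
  filter_upwards [hf, Lp.coeFn_smul c f] with y h1 h3
  rw [h3, Pi.smul_apply, h1, smul_eq_mul]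

lemma pairF_zero (φ : R3 → ℂ) : pairF 0 φ = 0 := by simpa using pairF_smul 0 0 φ

section fields

variable {F : R3 → ℂ} {ξ : Vec2}

lemma IsRepV.tangent_sgrad (h : IsRepV ξ (sgrad F)) : Tangent ξ := by
  filter_upwards [h] with y hy
  simp only [hy]
  exact sum_sgrad_mul_coord F (norm_coe_S2 y)

lemma IsRepV.tangent_srot (h : IsRepV ξ (srot F)) : Tangent ξ := by
  filter_upwards [h] with y hy
  simp only [hy]
  exact sum_srot_mul_coord F y

lemma IsRepV.hasCodiff_sgrad (hF : ContDiff ℝ ∞ F) (h : IsRepV ξ (sgrad F)) {u : Fun2}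
    (hu : IsRep u (fun x => -slap F x)) : HasCodiff ξ u := fun φ hφ => by
  rw [h.pairV_eq, hu.pairF_eq]
  have := integral_slap_mul (hF.of_le (two_le_infty)) (hφ.of_le (m := 1) (by simp))
  simp only [neg_mul, integral_neg]
  rw [← neg_eq_iff_eq_neg] at this
  simp only [mul_comm] at this ⊢
  exact this

lemma IsRepV.hasCurl_sgrad (hF : ContDiff ℝ ∞ F) (h : IsRepV ξ (sgrad F)) : HasCurl ξ 0 :=
  fun φ hφ => by
  rw [h.pairV_eq, pairF_zero]
  have := integral_srot_mul_sgrad (hφ.of_le (m := 1) (by simp))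
    (hF.of_le (m := 2) (two_le_infty))
  simp only [mul_comm] at this ⊢
  rw [this, neg_zero]

lemma IsRepV.hasCurl_srot (hF : ContDiff ℝ ∞ F) (h : IsRepV ξ (srot F)) {w : Fun2}
    (hw : IsRep w (slap F)) : HasCurl ξ w := fun φ hφ => by
  rw [h.pairV_eq, hw.pairF_eq]
  have hF2 : ContDiff ℝ 2 F := hF.of_le (two_le_infty)
  have := integral_srot_mul_eq_scurl (hφ.of_le (m := 1) (by simp))
    (contDiff_srot (m := 1) hF2 (by norm_num))
  simp only [scurl_srot hF2 (norm_coe_S2 _)] at this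
  simp only [mul_comm] at this ⊢
  rw [this, neg_neg]

lemma IsRepV.hasCodiff_srot (hF : ContDiff ℝ ∞ F) (h : IsRepV ξ (srot F)) : HasCodiff ξ 0 :=
  fun φ hφ => by
  rw [h.pairV_eq, pairF_zero]
  exact (integral_srot_mul_sgrad (hF.of_le (m := 1) (by simp))
    (hφ.of_le (m := 2) (two_le_infty))).symm

lemma IsRepV.pairV_sgrad (hF : ContDiff ℝ ∞ F) (h : IsRepV ξ (sgrad F)) {u : Fun2}
    (hu : IsRep u F) {V : R3 → Fin 3 → ℂ} (hV : SmoothTangent V) :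
    pairV ξ V = - pairF u (sdiv V) := by
  rw [h.pairV_eq, hu.pairF_eq]
  exact integral_sgrad_mul_eq_sdiv (hF.of_le (m := 1) (by simp)) (hV.1.of_le (m := 1) (by simp))
    hV.2

lemma IsRepV.pairV_srot (hF : ContDiff ℝ ∞ F) (h : IsRepV ξ (srot F)) {w : Fun2}
    (hw : IsRep w F) {V : R3 → Fin 3 → ℂ} (hV : SmoothTangent V) :
    pairV ξ V = - pairF w (scurl V) := by
  rw [h.pairV_eq, hw.pairF_eq]
  exact integral_srot_mul_eq_scurl (hF.of_le (m := 1) (by simp)) (hV.1.of_le (m := 1) (by simp))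

lemma IsRepV.hasGrad (hF : ContDiff ℝ ∞ F) (h : IsRepV ξ (sgrad F)) {u : Fun2}
    (hu : IsRep u F) : HasGrad u ξ :=
  ⟨h.tangent_sgrad, fun _ hV => h.pairV_sgrad hF hu hV⟩

lemma IsRep.hasLap (hF : ContDiff ℝ ∞ F) {u l : Fun2} (hu : IsRep u F) (hl : IsRep l (slap F)) :
    HasLap u l := fun φ hφ => by
  rw [hu.pairF_eq, hl.pairF_eq]
  have := integral_slap_symm (hF.of_le (m := 2) (two_le_infty))
    (hφ.of_le (m := 2) (two_le_infty))
  rw [← this]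
  simp only [mul_comm]

end fields

lemma smoothTangent_sgrad {F : R3 → ℂ} (hF : ContDiff ℝ ∞ F) : SmoothTangent (sgrad F) :=
  ⟨contDiff_sgrad hF (by simp), fun _ hx => sum_sgrad_mul_coord F hx⟩

lemma smoothTangent_srot {F : R3 → ℂ} (hF : ContDiff ℝ ∞ F) : SmoothTangent (srot F) :=
  ⟨contDiff_srot hF (by simp), fun x _ => sum_srot_mul_coord F x⟩

/-! ### Polynomial eigenfunctions of the Laplacian -/

/-- The algebra of smooth functions on `ℝ³`. -/
def Sm : Subalgebra ℂ (R3 → ℂ) where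
  carrier := {F | ContDiff ℝ ∞ F}
  mul_mem' := by
    intro F G hF hG
    simp only [Set.mem_ofPred_eq] at *
    exact hF.mul hG
  add_mem' := by
    intro F G hF hG
    simp only [Set.mem_ofPred_eq] at *
    exact hF.add hG
  algebraMap_mem' := by
    intro c
    simp only [Set.mem_ofPred_eq]
    exact contDiff_const

lemma mem_Sm {F : R3 → ℂ} : F ∈ Sm ↔ ContDiff ℝ ∞ F := Iff.rfl

lemma contDiff_Sm (F : Sm) : ContDiff ℝ ∞ (F : R3 → ℂ) := mem_Sm.1 F.2

lemma differentiable_Sm (F : Sm) : Differentiable ℝ (F : R3 → ℂ) :=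
  (contDiff_Sm F).differentiable (by simp)

/-- The partial derivatives of smooth functions. -/
def pdSm (i : Fin 3) : Sm →ₗ[ℂ] Sm where
  toFun F := ⟨pd i F, mem_Sm.2 (contDiff_pd (n := ∞) (contDiff_Sm F) (by simp) i)⟩
  map_add' F G := by
    ext x
    exact pd_add (differentiable_Sm F x) (differentiable_Sm G x) i
  map_smul' c F := by
    ext x
    exact pd_smul c (differentiable_Sm F x) i

/-- The coordinate functions. -/
def coordSm (i : Fin 3) : Sm := ⟨fun x => (x i : ℂ), mem_Sm.2 (contDiff_coord i)⟩

lemma pdSm_mul (i : Fin 3) (F G : Sm) : pdSm i (F * G) = F * pdSm i G + G * pdSm i F := by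
  ext x
  exact pd_mul (differentiable_Sm F x) (differentiable_Sm G x) i

lemma pdSm_coord (i j : Fin 3) : pdSm i (coordSm j) = if i = j then 1 else 0 := by
  ext x
  have := pd_coord i j x
  split_ifs at this ⊢ <;> exact this

lemma pdSm_one (i : Fin 3) : pdSm i 1 = 0 := by
  ext x
  have : pd i (fun _ => 1) x = 0 := by simp [pd]
  exact this

/-- Multiplication by a coordinate. -/
abbrev mulCoord (i : Fin 3) : Sm →ₗ[ℂ] Sm := LinearMap.mulLeft ℂ (coordSm i)

/-- The Euler operator. -/
def euler : Sm →ₗ[ℂ] Sm := ∑ i, mulCoord i ∘ₗ pdSm i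

/-- The Laplace-Beltrami operator, in Euclidean coordinates. -/
def lapSm : Sm →ₗ[ℂ] Sm :=
  ∑ i, pdSm i ∘ₗ pdSm i - ∑ i, ∑ j, mulCoord i ∘ₗ mulCoord j ∘ₗ pdSm i ∘ₗ pdSm j
    - (2 : ℂ) • euler

lemma slap_eq_lapSm (F : Sm) {x : R3} (hx : ‖x‖ = 1) : slap F x = (lapSm F : R3 → ℂ) x := by
  rw [slap_eq ((contDiff_Sm F).of_le two_le_infty) hx]
  simp [lapSm, euler, Fin.sum_univ_three, coordSm, pdSm]
  ring

/-- Polynomial functions of degree less than `n`. -/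
def polyLt : ℕ → Submodule ℂ Sm
  | 0 => ⊥
  | n + 1 => Submodule.span ℂ {1} ⊔ ⨆ i, (polyLt n).map (mulCoord i)

lemma one_mem_polyLt (n : ℕ) : 1 ∈ polyLt (n + 1) :=
  Submodule.mem_sup_left (Submodule.mem_span_singleton_self _)

lemma coord_mul_mem_polyLt {n : ℕ} (i : Fin 3) {F : Sm} (hF : F ∈ polyLt n) :
    coordSm i * F ∈ polyLt (n + 1) :=
  Submodule.mem_sup_right (Submodule.mem_iSup_of_mem i ⟨F, hF, rfl⟩)

lemma polyLt_succ_le {n : ℕ} {S : Submodule ℂ Sm} (h1 : 1 ∈ S)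
    (h : ∀ i, ∀ F ∈ polyLt n, coordSm i * F ∈ S) : polyLt (n + 1) ≤ S := by
  refine sup_le (by simpa using h1) (iSup_le fun i => ?_)
  rintro _ ⟨F, hF, rfl⟩
  exact h i F hF

lemma polyLt_mono : Monotone polyLt := by
  refine monotone_nat_of_le_succ fun n => ?_
  induction n with
  | zero => exact bot_le
  | succ n ih =>
    exact polyLt_succ_le (one_mem_polyLt _) fun i F hF => coord_mul_mem_polyLt i (ih hF)

instance (n : ℕ) : FiniteDimensional ℂ (polyLt n) := by
  induction n with
  | zero => exact inferInstanceAs (FiniteDimensional ℂ (⊥ : Submodule ℂ Sm))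
  | succ n ih =>
    exact inferInstanceAs (FiniteDimensional ℂ
      (Submodule.span ℂ {1} ⊔ ⨆ i, (polyLt n).map (mulCoord i) : Submodule ℂ Sm))

lemma euler_one : euler 1 = 0 := by simp [euler, pdSm_one]

lemma lapSm_one : lapSm 1 = 0 := by simp [lapSm, euler_one, pdSm_one]

lemma euler_coord_mul (j : Fin 3) (F : Sm) :
    euler (coordSm j * F) = coordSm j * F + coordSm j * euler F := by
  simp only [euler, Fin.sum_univ_three, LinearMap.add_apply, LinearMap.comp_apply,
    LinearMap.mulLeft_apply, pdSm_mul, pdSm_coord]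
  fin_cases j <;> simp <;> ring

lemma lapSm_coord_mul (j : Fin 3) (F : Sm) :
    lapSm (coordSm j * F) = coordSm j * lapSm F + 2 * pdSm j F - 2 * (coordSm j * euler F)
      - 2 * (coordSm j * F) := by
  simp only [lapSm, LinearMap.sub_apply, euler_coord_mul, two_smul,
    Fin.sum_univ_three, LinearMap.add_apply, LinearMap.comp_apply,
    LinearMap.mulLeft_apply, pdSm_mul, pdSm_coord, map_add]
  simp only [euler, Fin.sum_univ_three, LinearMap.add_apply, LinearMap.comp_apply,
    LinearMap.mulLeft_apply]
  fin_cases j <;> simp [pdSm_one] <;> ring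

/-- On homogeneous polynomials of degree n the Euler operator is n and ∑ xᵢxⱼ∂ᵢ∂ⱼ is n(n-1), while
the Euclidean Laplacian lowers the degree; so the leading part of `lapSm` is -n(n+1). The three
claims are proved together because the commutator of `lapSm` with a coordinate contains a partial
derivative and the Euler operator. -/
lemma degree_lowering (n : ℕ) : ∀ F ∈ polyLt (n + 1), (∀ i, pdSm i F ∈ polyLt n) ∧
    euler F - (n : ℂ) • F ∈ polyLt n ∧ lapSm F + ((n : ℂ) * (n + 1)) • F ∈ polyLt n := by
  suffices polyLt (n + 1) ≤ (⨅ i, (polyLt n).comap (pdSm i)) ⊓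
      ((polyLt n).comap (euler - (n : ℂ) • LinearMap.id) ⊓
        (polyLt n).comap (lapSm + ((n : ℂ) * (n + 1)) • LinearMap.id)) by
    intro F hF
    simpa using this hF
  induction n with
  | zero =>
    refine polyLt_succ_le ?_ ?_
    · simp [pdSm_one, euler_one, lapSm_one]
    · intro i F hF
      have : F = 0 := by simpa [polyLt] using hF
      simp [this]
  | succ n ih =>
    refine polyLt_succ_le ?_ ?_
    · simp only [Submodule.mem_inf, Submodule.mem_iInf, Submodule.mem_comap, pdSm_one, zero_mem,
        implies_true, LinearMap.sub_apply, LinearMap.add_apply, euler_one, lapSm_one,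
        LinearMap.smul_apply, LinearMap.id_apply, zero_add, zero_sub, true_and]
      exact ⟨neg_mem (Submodule.smul_mem _ _ (one_mem_polyLt n)),
        Submodule.smul_mem _ _ (one_mem_polyLt n)⟩
    · intro j F hF
      have h := ih hF
      simp only [Submodule.mem_inf, Submodule.mem_iInf, Submodule.mem_comap,
        LinearMap.sub_apply, LinearMap.add_apply, LinearMap.smul_apply,
        LinearMap.id_apply] at h ⊢
      obtain ⟨h1, h2, h3⟩ := h
      refine ⟨fun i => ?_, ?_, ?_⟩
      · rw [pdSm_mul, pdSm_coord]
        refine add_mem (coord_mul_mem_polyLt j (h1 i)) ?_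
        split_ifs
        · rwa [mul_one]
        · rw [mul_zero]; exact zero_mem _
      · convert coord_mul_mem_polyLt j h2 using 1
        rw [euler_coord_mul, mul_sub, mul_smul_comm]
        push_cast
        module
      -- The scalars match because (n+1)(n+2) = n(n+1) + 2n + 2.
      · have e : lapSm (coordSm j * F) + (((n + 1 : ℕ) : ℂ) * ((n + 1 : ℕ) + 1)) • (coordSm j * F)
            = coordSm j * (lapSm F + ((n : ℂ) * (n + 1)) • F) + (2 : ℂ) • pdSm j F
              - (2 : ℂ) • (coordSm j * (euler F - (n : ℂ) • F)) := by
          have h2 : ∀ G : Sm, 2 * G = (2 : ℂ) • G := fun G => by rw [two_smul, two_mul]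
          have h4 : ∀ (c : ℂ) (G : Sm), coordSm j * c • G = c • (coordSm j * G) := fun c G =>
            mul_smul_comm c _ G
          rw [lapSm_coord_mul, mul_sub (coordSm j), mul_add (coordSm j), h2, h2, h2, h4, h4]
          push_cast
          module
        rw [e]
        exact sub_mem (add_mem (coord_mul_mem_polyLt j h3)
          (Submodule.smul_mem _ _ (polyLt_mono n.le_succ (h1 j))))
          (Submodule.smul_mem _ _ (coord_mul_mem_polyLt j h2))

/-- Polynomials of degree at most `k` that are eigenfunctions for `-k(k+1)`. -/
def eigenPoly (k : ℕ) : Submodule ℂ Sm :=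
  polyLt (k + 1) ⊓ LinearMap.ker (lapSm + ((k : ℂ) * (k + 1)) • LinearMap.id)

instance (k : ℕ) : FiniteDimensional ℂ (eigenPoly k) :=
  Submodule.finiteDimensional_inf_left _ _

lemma mem_eigenPoly {k : ℕ} {F : Sm} : F ∈ eigenPoly k ↔
    F ∈ polyLt (k + 1) ∧ lapSm F = -((k : ℂ) * (k + 1)) • F := by
  simp [eigenPoly, add_eq_zero_iff_eq_neg]

lemma eigenvalue_ne {j k : ℕ} (h : j ≠ k) : (j : ℂ) * (j + 1) ≠ (k : ℂ) * (k + 1) := by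
  intro e
  have e' : j * (j + 1) = k * (k + 1) := by exact_mod_cast e
  rcases lt_or_gt_of_ne h with h | h <;> nlinarith

/-- Applying `lapSm` + n(n+1) to F lowers its degree, so by induction the result is a sum of
eigenfunctions of degrees k < n. Dividing each by n(n+1) - k(k+1) ≠ 0 inverts the operator on that
sum, and F minus the outcome is an eigenfunction of degree n. -/
lemma exists_sum_eigenPoly (n : ℕ) : ∀ F ∈ polyLt n,
    ∃ p : ℕ → Sm, (∀ k, p k ∈ eigenPoly k) ∧ F = ∑ k ∈ Finset.range n, p k := by
  induction n with
  | zero =>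
    intro F hF
    exact ⟨0, fun k => zero_mem _, by simpa [polyLt] using hF⟩
  | succ n ih =>
    intro F hF
    obtain ⟨q, hq, hq'⟩ := ih _ (degree_lowering n F hF).2.2
    let p : ℕ → Sm := fun k => ((n : ℂ) * (n + 1) - (k : ℂ) * (k + 1))⁻¹ • q k
    have hp : ∀ k, p k ∈ eigenPoly k := fun k => Submodule.smul_mem _ _ (hq k)
    have hpq : ∀ k ∈ Finset.range n, lapSm (p k) + ((n : ℂ) * (n + 1)) • p k = q k := by
      intro k hk
      have hne : (n : ℂ) * (n + 1) - (k : ℂ) * (k + 1) ≠ 0 :=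
        sub_ne_zero.2 (eigenvalue_ne (Finset.mem_range.1 hk).ne')
      rw [(mem_eigenPoly.1 (hp k)).2, ← add_smul, smul_smul,
        show -((k : ℂ) * (k + 1)) + n * (n + 1) = n * (n + 1) - (k : ℂ) * (k + 1) by ring,
        mul_inv_cancel₀ hne, one_smul]
    set G := F - ∑ k ∈ Finset.range n, p k with hG
    have hGe : G ∈ eigenPoly n := by
      refine mem_eigenPoly.2 ⟨sub_mem hF (sum_mem fun k hk => ?_), ?_⟩
      · exact polyLt_mono (by have := Finset.mem_range.1 hk; omega) (mem_eigenPoly.1 (hp k)).1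
      · have h2 := Finset.sum_congr rfl hpq
        rw [Finset.sum_add_distrib, ← map_sum, ← Finset.smul_sum, ← hq'] at h2
        rw [neg_smul, eq_neg_iff_add_eq_zero, hG, map_sub, smul_sub, sub_add_sub_comm, h2, sub_self]
    refine ⟨fun k => if k < n then p k else if k = n then G else 0, fun k => ?_, ?_⟩
    · dsimp only
      split_ifs with h1 h2
      · exact hp k
      · subst h2; exact hGe
      · exact zero_mem _
    · rw [Finset.sum_range_succ, Finset.sum_congr rfl (g := p)
        fun k hk => if_pos (Finset.mem_range.1 hk)]
      simp [hG]

/-! ### Complex conjugation -/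

lemma pd_conj (i : Fin 3) (F : R3 → ℂ) (x : R3) :
    pd i (fun z => starRingEnd ℂ (F z)) x = starRingEnd ℂ (pd i F x) := by
  unfold pd
  have := ContinuousLinearEquiv.comp_fderiv (Complex.conjCLE) (f := F) (x := x)
  change fderiv ℝ (Complex.conjCLE ∘ F) x _ = _
  rw [this]
  rfl

lemma slap_conj (F : R3 → ℂ) (x : R3) :
    slap (fun z => starRingEnd ℂ (F z)) x = starRingEnd ℂ (slap F x) := by
  have h1 : ∀ z i, sgrad (fun z => starRingEnd ℂ (F z)) z i = starRingEnd ℂ (sgrad F z i) := by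
    intro z i
    simp [sgrad, pd_conj]
  simp only [slap, sdiv, h1, pd_conj]
  simp

/-- Complex conjugation of smooth functions. -/
def conjSm (F : Sm) : Sm :=
  ⟨fun z => starRingEnd ℂ ((F : R3 → ℂ) z), mem_Sm.2 (Complex.conjCLE.contDiff.comp (contDiff_Sm F))⟩

lemma conjSm_mul (F G : Sm) : conjSm (F * G) = conjSm F * conjSm G := by
  ext x; simp [conjSm]

lemma conjSm_add (F G : Sm) : conjSm (F + G) = conjSm F + conjSm G := by
  ext x; simp [conjSm]

lemma conjSm_smul (c : ℂ) (F : Sm) : conjSm (c • F) = starRingEnd ℂ c • conjSm F := by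
  ext x; simp [conjSm]

lemma conjSm_mem_polyLt {n : ℕ} : ∀ F ∈ polyLt n, conjSm F ∈ polyLt n := by
  induction n with
  | zero =>
    intro F hF
    have : F = 0 := by simpa [polyLt] using hF
    subst this
    convert hF
    ext x; simp [conjSm]
  | succ n ih =>
    let S : Submodule ℂ Sm :=
      { carrier := {F | conjSm F ∈ polyLt (n + 1)}
        zero_mem' := by
          simp only [Set.mem_ofPred_eq]
          have : conjSm 0 = 0 := by ext x; simp [conjSm]
          simp [this]
        add_mem' := fun {F G} hF hG => by
          simp only [Set.mem_ofPred_eq, conjSm_add] at *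
          exact add_mem hF hG
        smul_mem' := fun c F hF => by
          simp only [Set.mem_ofPred_eq, conjSm_smul] at *
          exact Submodule.smul_mem _ _ hF }
    refine polyLt_succ_le (S := S) ?_ ?_
    · change conjSm 1 ∈ polyLt (n + 1)
      convert one_mem_polyLt n
      ext x; simp [conjSm]
    · intro i F hF
      change conjSm (coordSm i * F) ∈ polyLt (n + 1)
      rw [conjSm_mul]
      convert coord_mul_mem_polyLt i (ih F hF) using 2
      ext x; simp [conjSm, coordSm]

/-! ### Completeness of the spherical harmonics -/

lemma IsRep.ext {f g : Fun2} {F : R3 → ℂ} (hf : IsRep f F) (hg : IsRep g F) : f = g := by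
  refine Lp.ext ?_
  filter_upwards [hf, hg] with y h1 h2
  rw [h1, h2]

/-- Restriction of smooth functions to the sphere. -/
def res : Sm →ₗ[ℂ] Fun2 where
  toFun F := (exists_isRep (contDiff_Sm F).continuous).choose
  map_add' F G := (exists_isRep (contDiff_Sm (F + G)).continuous).choose_spec.ext
    ((exists_isRep (contDiff_Sm F).continuous).choose_spec.add
      (exists_isRep (contDiff_Sm G).continuous).choose_spec)
  map_smul' c F := (exists_isRep (contDiff_Sm (c • F)).continuous).choose_spec.ext
    ((exists_isRep (contDiff_Sm F).continuous).choose_spec.smul c)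

lemma isRep_res (F : Sm) : IsRep (res F) F :=
  (exists_isRep (contDiff_Sm F).continuous).choose_spec

lemma slap_of_mem_eigenPoly {k : ℕ} {F : Sm} (hF : F ∈ eigenPoly k) {x : R3} (hx : ‖x‖ = 1) :
    slap F x = -((k : ℂ) * (k + 1)) * (F : R3 → ℂ) x := by
  rw [slap_eq_lapSm F hx, (mem_eigenPoly.1 hF).2]
  rfl

/-- Restrictions to the sphere of polynomial eigenfunctions. -/
def polyY (k : ℕ) : Submodule ℂ Fun2 := (eigenPoly k).map res

instance (k : ℕ) : FiniteDimensional ℂ (polyY k) := by unfold polyY; infer_instance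

lemma polyY_le_Y (k : ℕ) : polyY k ≤ Y k := by
  rintro _ ⟨F, hF, rfl⟩
  exact ⟨F, (contDiff_Sm F).of_le two_le_infty, fun x hx => slap_of_mem_eigenPoly hF hx,
    isRep_res F⟩

lemma inner_eq_pairF {f : Fun2} {F : R3 → ℂ} (hf : IsRep f F) (g : Fun2) :
    inner ℂ f g = pairF g (fun x => starRingEnd ℂ (F x)) := by
  rw [L2.inner_def]
  refine integral_congr_ae ?_
  filter_upwards [hf] with y hy
  rw [hy]
  rfl

lemma inner_Y_eq_zero {j k : ℕ} (hjk : j ≠ k) {f g : Fun2} (hf : f ∈ Y j) (hg : g ∈ Y k) :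
    inner ℂ f g = 0 := by
  obtain ⟨F, hF, hF', hfF⟩ := hf
  obtain ⟨G, hG, hG', hgG⟩ := hg
  rw [inner_eq_pairF hfF, IsRep.pairF_eq hgG]
  have hc : ContDiff ℝ 2 (fun x => starRingEnd ℂ (F x)) := Complex.conjCLE.contDiff.comp hF
  have h := integral_slap_symm hG hc
  have e1 : ∀ y : S2, starRingEnd ℂ (F y) * slap G y
      = -((k : ℂ) * (k + 1)) * (G y * starRingEnd ℂ (F y)) := fun y => by
    rw [hG' y (norm_coe_S2 y)]; ring
  have e2 : ∀ y : S2, G y * slap (fun x => starRingEnd ℂ (F x)) y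
      = -((j : ℂ) * (j + 1)) * (G y * starRingEnd ℂ (F y)) := fun y => by
    rw [slap_conj, hF' y (norm_coe_S2 y)]
    simp
    ring
  simp only [e1, e2] at h
  rw [integral_const_mul, integral_const_mul] at h
  by_contra h0
  exact eigenvalue_ne hjk.symm (neg_injective (mul_right_cancel₀ h0 h))

/-- Continuous functions on the sphere that are restrictions of polynomials. -/
def polyStar : StarSubalgebra ℂ C(S2, ℂ) where
  carrier := {f | ∃ n, ∃ F ∈ polyLt n, ∀ y : S2, f y = (F : R3 → ℂ) y}
  mul_mem' := by
    rintro f g ⟨n, F, hF, hf⟩ ⟨m, G, hG, hg⟩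
    suffices ∀ n, ∀ F ∈ polyLt n, F * G ∈ ⨆ l, polyLt l by
      obtain ⟨l, hl⟩ := (Submodule.mem_iSup_of_directed _
        (polyLt_mono.directed_le)).1 (this n F hF)
      exact ⟨l, _, hl, fun y => by simp [hf, hg]⟩
    intro n
    induction n with
    | zero =>
      intro F hF
      have : F = 0 := by simpa [polyLt] using hF
      simp [this]
    | succ n ih =>
      let S : Submodule ℂ Sm := (⨆ l, polyLt l).comap (LinearMap.mulRight ℂ G)
      refine polyLt_succ_le (S := S) ?_ ?_
      · simpa [S] using Submodule.mem_iSup_of_mem m hG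
      · intro i F hF
        obtain ⟨l, hl⟩ := (Submodule.mem_iSup_of_directed _ (polyLt_mono.directed_le)).1 (ih F hF)
        refine Submodule.mem_iSup_of_mem (l + 1) ?_
        simpa [mul_assoc] using coord_mul_mem_polyLt i hl
  add_mem' := by
    rintro f g ⟨n, F, hF, hf⟩ ⟨m, G, hG, hg⟩
    exact ⟨max n m, _, add_mem (polyLt_mono (le_max_left n m) hF)
      (polyLt_mono (le_max_right n m) hG), fun y => by simp [hf, hg]⟩
  algebraMap_mem' := fun c =>
    ⟨1, c • 1, Submodule.smul_mem _ c (one_mem_polyLt 0), fun y => by simp⟩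
  star_mem' := by
    rintro f ⟨n, F, hF, hf⟩
    exact ⟨n, _, conjSm_mem_polyLt F hF, fun y => by simp [hf, conjSm]⟩

lemma polyStar_closure : polyStar.topologicalClosure = ⊤ := by
  refine ContinuousMap.starSubalgebra_topologicalClosure_eq_top_of_separatesPoints _ ?_
  intro y z hyz
  have : ∃ i, (y : R3) i ≠ (z : R3) i := by
    by_contra! h
    exact hyz (Subtype.ext (PiLp.ext h))
  obtain ⟨i, hi⟩ := this
  refine ⟨_, ⟨⟨fun y : S2 => ((y : R3) i : ℂ), by fun_prop⟩, ⟨2, coordSm i, ?_, fun y => rfl⟩, rfl⟩, ?_⟩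
  · simpa using coord_mul_mem_polyLt i (one_mem_polyLt 0)
  · simpa using hi

/-- Polynomials are uniformly dense in the continuous functions by Stone–Weierstrass, these are
dense in L², and each polynomial is a finite sum of eigenfunctions. -/
lemma iSup_polyY_closure : (⨆ k, polyY k).topologicalClosure = ⊤ := by
  set U := (⨆ k, polyY k).topologicalClosure with hU
  have hUc : IsClosed (U : Set Fun2) := Submodule.isClosed_topologicalClosure _
  let T := ContinuousMap.toLp (E := ℂ) 2 surf ℂ
  have h1 : ∀ f ∈ polyStar, T f ∈ U := by
    rintro f ⟨n, F, hF, hf⟩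
    have h : T f = res F := IsRep.ext (F := F) (by
      filter_upwards [ContinuousMap.coeFn_toLp (𝕜 := ℂ) (p := 2) surf f] with y hy
      rw [← hf]; exact hy) (isRep_res F)
    obtain ⟨p, hp, rfl⟩ := exists_sum_eigenPoly n F hF
    rw [h, map_sum]
    exact sum_mem fun k _ => Submodule.le_topologicalClosure _
      (Submodule.mem_iSup_of_mem k ⟨p k, hp k, rfl⟩)
  have h2 : ∀ f, T f ∈ U := by
    intro f
    have hc : IsClosed (T ⁻¹' U) := hUc.preimage T.continuous
    have : f ∈ polyStar.topologicalClosure := by rw [polyStar_closure]; trivial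
    have hf : f ∈ closure (polyStar : Set C(S2, ℂ)) := this
    exact closure_minimal (fun g hg => h1 g hg) hc hf
  rw [eq_top_iff]
  intro f _
  have hd : DenseRange T := ContinuousMap.toLp_denseRange ℂ surf ℂ (by norm_num)
  exact closure_minimal (by rintro _ ⟨g, rfl⟩; exact h2 g) hUc (hd f)

/-- The part of a C² eigenfunction orthogonal to `polyY k` is also orthogonal to all other `polyY
j`, as the eigenvalues differ, so completeness kills it. This gives finite dimension and smooth
representatives without elliptic regularity. -/
lemma Y_eq_polyY (k : ℕ) : Y k = polyY k := by
  refine le_antisymm (fun f hf => ?_) (polyY_le_Y k)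
  set g := (polyY k).starProjection f
  have hg : g ∈ polyY k := Submodule.starProjection_apply_mem _ _
  have hfg : f - g ∈ Y k := sub_mem hf (polyY_le_Y k hg)
  have h0 : f - g ∈ (⨆ j, polyY j)ᗮ := by
    rw [Submodule.mem_orthogonal]
    suffices (⨆ j, polyY j) ≤ (Submodule.span ℂ {f - g})ᗮ by
      intro u hu
      have := this hu
      rw [Submodule.mem_orthogonal_singleton_iff_inner_left] at this
      exact this
    refine iSup_le fun j u hu => ?_
    rw [Submodule.mem_orthogonal_singleton_iff_inner_left]
    by_cases hjk : j = k
    · subst hjk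
      exact Submodule.sub_starProjection_mem_orthogonal (K := polyY j) f u hu
    · exact inner_Y_eq_zero hjk (polyY_le_Y j hu) hfg
  rw [← Submodule.orthogonal_closure, iSup_polyY_closure, Submodule.top_orthogonal_eq_bot] at h0
  rw [sub_eq_zero.1 ((Submodule.mem_bot ℂ).1 h0)]
  exact hg

instance (k : ℕ) : FiniteDimensional ℂ (Y k) := by rw [Y_eq_polyY]; infer_instance

lemma orthogonalFamily_Y : OrthogonalFamily ℂ (fun k => Y k) fun k => (Y k).subtypeₗᵢ :=
  fun _ _ hjk f g => inner_Y_eq_zero hjk f.2 g.2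

lemma isHilbertSum_Y : IsHilbertSum ℂ (fun k => Y k) fun k => (Y k).subtypeₗᵢ := by
  refine IsHilbertSum.mkInternal _ orthogonalFamily_Y ?_
  simp only [Y_eq_polyY, iSup_polyY_closure, le_refl]

lemma closure_Y (k : ℕ) : (Y k).topologicalClosure = Y k :=
  (Submodule.closed_of_finiteDimensional (Y k)).submodule_topologicalClosure_eq

lemma harm_mem (k : ℕ) (f : Fun2) : harm k f ∈ Y k := by
  exact (closure_Y k).le (Submodule.starProjection_apply_mem (Y k).topologicalClosure f)

lemma harm_of_mem {k : ℕ} {f : Fun2} (hf : f ∈ Y k) : harm k f = f :=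
  Submodule.starProjection_eq_self_iff.2 (Submodule.le_topologicalClosure _ hf)

lemma harm_of_mem_ne {j k : ℕ} (hjk : k ≠ j) {f : Fun2} (hf : f ∈ Y j) : harm k f = 0 := by
  refine (Submodule.starProjection_apply_eq_zero_iff _).2 ?_
  rw [closure_Y, Submodule.mem_orthogonal]
  exact fun u hu => inner_Y_eq_zero hjk hu hf

lemma harm_harm (j k : ℕ) (f : Fun2) : harm j (harm k f) = if j = k then harm k f else 0 := by
  split_ifs with h
  · subst h; exact harm_of_mem (harm_mem _ _)
  · exact harm_of_mem_ne h (harm_mem k f)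

lemma harm_hasSum {a : ℕ → Fun2} (ha : ∀ k, a k ∈ Y k) {f : Fun2} (h : HasSum a f) (k : ℕ) :
    harm k f = a k := by
  have h1 := (harm k).hasSum h
  refine h1.unique ?_
  convert hasSum_ite_eq k (a k) using 2 with j
  split_ifs with hjk
  · subst hjk; exact harm_of_mem (ha _)
  · exact harm_of_mem_ne (Ne.symm hjk) (ha j)

lemma exists_lp (f : Fun2) : ∃ w : lp (fun k => Y k) 2, isHilbertSum_Y.linearIsometryEquiv.symm w = f
    ∧ ∀ k, harm k f = w k := by
  refine ⟨isHilbertSum_Y.linearIsometryEquiv f, by simp, fun k => ?_⟩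
  refine harm_hasSum (a := fun k => (isHilbertSum_Y.linearIsometryEquiv f k : Fun2))
    (fun k => Subtype.property _) ?_ k
  convert isHilbertSum_Y.hasSum_linearIsometryEquiv_symm (isHilbertSum_Y.linearIsometryEquiv f)
  · rfl
  · exact (isHilbertSum_Y.linearIsometryEquiv.symm_apply_apply f).symm

lemma hasSum_harm (f : Fun2) : HasSum (fun k => harm k f) f := by
  obtain ⟨w, hw, h⟩ := exists_lp f
  have := isHilbertSum_Y.hasSum_linearIsometryEquiv_symm w
  rw [hw] at this
  simp only [h]
  exact this

lemma hasSum_norm_harm (f : Fun2) : HasSum (fun k => ‖harm k f‖ ^ 2) (‖f‖ ^ 2) := by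
  obtain ⟨w, hw, h⟩ := exists_lp f
  have h1 := lp.hasSum_norm (p := 2) (by norm_num) w
  rw [← hw, LinearIsometryEquiv.norm_map]
  simp only [hw, h]
  simpa using h1

lemma harm_ext {f g : Fun2} (h : ∀ k, harm k f = harm k g) : f = g :=
  (hasSum_harm f).unique (by simpa only [h] using hasSum_harm g)

lemma exists_of_summable {a : ℕ → Fun2} (ha : ∀ k, a k ∈ Y k) (h : Summable fun k => ‖a k‖ ^ 2) :
    ∃ f, ∀ k, harm k f = a k := by
  have hs : Memℓp (fun k => (⟨a k, ha k⟩ : Y k)) 2 := by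
    refine memℓp_gen ?_
    simpa using h
  exact ⟨_, harm_hasSum ha (isHilbertSum_Y.hasSum_linearIsometryEquiv_symm ⟨_, hs⟩)⟩

/-- Test functions: smooth eigenfunctions of the Laplacian. -/
lemma exists_rep_of_mem_Y {k : ℕ} {f : Fun2} (hf : f ∈ Y k) : ∃ F : R3 → ℂ, ContDiff ℝ ∞ F ∧
    (∀ x : R3, ‖x‖ = 1 → slap F x = -((k : ℂ) * (k + 1)) * F x) ∧ IsRep f F := by
  rw [Y_eq_polyY] at hf
  obtain ⟨F, hF, rfl⟩ := hf
  exact ⟨F, contDiff_Sm F, fun x hx => slap_of_mem_eigenPoly hF hx, isRep_res F⟩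

/-- The component of `f` in `Y_k` is determined by the pairings with smooth eigenfunctions. -/
lemma harm_eq_zero_of_pairF {k : ℕ} {f : Fun2} (h : ∀ Φ : R3 → ℂ, ContDiff ℝ ∞ Φ →
    (∀ x : R3, ‖x‖ = 1 → slap Φ x = -((k : ℂ) * (k + 1)) * Φ x) → pairF f Φ = 0) :
    harm k f = 0 := by
  refine (Submodule.starProjection_apply_eq_zero_iff _).2 ?_
  rw [closure_Y, Submodule.mem_orthogonal]
  intro u hu
  obtain ⟨F, hF, hF', hu⟩ := exists_rep_of_mem_Y hu
  rw [inner_eq_pairF hu]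
  refine h _ (Complex.conjCLE.contDiff.comp hF) fun x hx => ?_
  rw [slap_conj, hF' x hx]
  simp

/-! ### Hodge theory -/

lemma pairF_sub (u v : Fun2) {φ : R3 → ℂ} (hφ : Continuous φ) :
    pairF (u - v) φ = pairF u φ - pairF v φ := by
  have h := pairF_add u ((-1 : ℂ) • v) hφ
  rw [pairF_smul, neg_one_smul, ← sub_eq_add_neg] at h
  rw [h]; ring

lemma pairV_sub (u v : Vec2) {V : R3 → Fin 3 → ℂ} (hV : Continuous V) :
    pairV (u - v) V = pairV u V - pairV v V := by
  have h := pairV_add u ((-1 : ℂ) • v) hV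
  rw [pairV_smul, neg_one_smul, ← sub_eq_add_neg] at h
  rw [h]; ring

lemma eq_of_pairF {f g : Fun2} (h : ∀ φ : R3 → ℂ, ContDiff ℝ ∞ φ → pairF f φ = pairF g φ) :
    f = g := by
  refine sub_eq_zero.1 (harm_ext fun k => ?_)
  rw [map_zero]
  refine harm_eq_zero_of_pairF fun Φ hΦ _ => ?_
  rw [pairF_sub _ _ hΦ.continuous, h Φ hΦ, sub_self]

lemma HasCurl.unique {ξ : Vec2} {w w' : Fun2} (h : HasCurl ξ w) (h' : HasCurl ξ w') : w = w' :=
  eq_of_pairF fun φ hφ => by rw [h φ hφ, h' φ hφ]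

lemma HasCodiff.unique {ξ : Vec2} {u u' : Fun2} (h : HasCodiff ξ u) (h' : HasCodiff ξ u') :
    u = u' :=
  eq_of_pairF fun φ hφ => by rw [h φ hφ, h' φ hφ]

lemma HasCurl.curl_eq {ξ : Vec2} {w : Fun2} (h : HasCurl ξ w) : curl ξ = w := by
  have h' : ∃ w, HasCurl ξ w := ⟨w, h⟩
  rw [curl, dif_pos h']
  exact h'.choose_spec.unique h

lemma HasCodiff.codiff_eq {ξ : Vec2} {u : Fun2} (h : HasCodiff ξ u) : codiff ξ = u := by
  have h' : ∃ u, HasCodiff ξ u := ⟨u, h⟩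
  rw [codiff, dif_pos h']
  exact h'.choose_spec.unique h

lemma exists_const_of_mem_Y_zero {f : Fun2} (hf : f ∈ Y 0) : ∃ c : ℂ, IsRep f fun _ => c := by
  rw [Y_eq_polyY] at hf
  obtain ⟨F, hF, rfl⟩ := hf
  have h := (mem_eigenPoly.1 hF).1
  have h1 : F ∈ Submodule.span ℂ {(1 : Sm)} := by simpa [polyLt] using h
  obtain ⟨c, rfl⟩ := Submodule.mem_span_singleton.1 h1
  refine ⟨c, ?_⟩
  filter_upwards [isRep_res (c • 1)] with y hy
  rw [hy]; simp

lemma mem_meanZero {f : Fun2} : f ∈ meanZero ↔ pairF f (fun _ => 1) = 0 := by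
  simp [meanZero, pairF]

lemma meanZero_iff {f : Fun2} : f ∈ meanZero ↔ harm 0 f = 0 := by
  have h0 : harm 0 f = 0 ↔ f ∈ (Y 0)ᗮ := by
    rw [← closure_Y 0]
    exact Submodule.starProjection_apply_eq_zero_iff _
  rw [h0, Submodule.mem_orthogonal, mem_meanZero]
  constructor
  · intro h u hu
    obtain ⟨c, hc⟩ := exists_const_of_mem_Y_zero hu
    rw [inner_eq_pairF hc]
    simp only [pairF, mul_one] at h ⊢
    rw [integral_mul_const, h, zero_mul]
  · intro h
    have h1 : (1 : Sm) ∈ eigenPoly 0 := mem_eigenPoly.2 ⟨one_mem_polyLt 0, by simp [lapSm_one]⟩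
    have h2 := h (res 1) (polyY_le_Y 0 ⟨1, h1, rfl⟩)
    rw [inner_eq_pairF (isRep_res 1)] at h2
    simpa using h2

lemma sgrad_const (c : ℂ) : sgrad (fun _ => c) = 0 := by
  funext x i
  simp [sgrad, pd]

lemma srot_const (c : ℂ) : srot (fun _ => c) = 0 := by
  funext x i
  simp [← fderiv_rotGen]

lemma pairV_zero_right (ξ : Vec2) : pairV ξ 0 = 0 := by simp [pairV]

lemma HasCurl.harm_zero {ξ : Vec2} {w : Fun2} (h : HasCurl ξ w) : harm 0 w = 0 := by
  rw [← meanZero_iff, mem_meanZero, h _ contDiff_const, srot_const, pairV_zero_right, neg_zero]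

lemma HasCodiff.harm_zero {ξ : Vec2} {u : Fun2} (h : HasCodiff ξ u) : harm 0 u = 0 := by
  rw [← meanZero_iff, mem_meanZero, h _ contDiff_const, sgrad_const, pairV_zero_right]

lemma integrable_pairV (ξ : Vec2) {V : R3 → Fin 3 → ℂ} (hV : Continuous V) :
    Integrable (fun y : S2 => ∑ i, ξ y i * V (y : R3) i) surf :=
  integrable_finsetSum _ fun i _ =>
    integrable_mul (φ := fun x => V x i) (memLp_coord ξ i) ((continuous_apply i).comp hV)

instance : surf.IsOpenPosMeasure := by unfold surf; infer_instance

/-- There are no nonzero square integrable harmonic fields on the sphere. -/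
lemma eq_zero_of_harmonic {ξ : Vec2} (ht : Tangent ξ) (hw : HasCurl ξ 0) (hu : HasCodiff ξ 0) :
    ξ = 0 := by
  have hg : ∀ φ : R3 → ℂ, ContDiff ℝ ∞ φ → pairV ξ (sgrad φ) = 0 := fun φ hφ => by
    rw [← hu φ hφ, pairF_zero]
  have hr : ∀ φ : R3 → ℂ, ContDiff ℝ ∞ φ → pairV ξ (srot φ) = 0 := fun φ hφ => by
    rw [← neg_eq_zero, ← hw φ hφ, pairF_zero]
  have hc : ∀ i, ∃ c : ℂ, ∀ᵐ y : S2 ∂surf, ξ y i = c := by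
    intro i
    set f : Fun2 := (memLp_coord ξ i).toLp with hf
    have hfξ : ∀ᵐ y : S2 ∂surf, f y = ξ y i := (memLp_coord ξ i).coeFn_toLp
    have hk : ∀ k, k ≠ 0 → harm k f = 0 := by
      intro k hk
      refine harm_eq_zero_of_pairF fun Φ hΦ hΦ' => ?_
      have hcg : ContDiff ℝ ∞ fun z => sgrad Φ z i :=
        contDiff_pi.1 (contDiff_sgrad (n := ∞) (m := ∞) hΦ (by simp)) i
      have hcr : ContDiff ℝ ∞ fun z => srot Φ z i :=
        contDiff_pi.1 (contDiff_srot (n := ∞) (m := ∞) hΦ (by simp)) i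
      have h3 : ContDiff ℝ 3 Φ := hΦ.of_le ENat.LEInfty.out
      -- Since ξ is tangent, it only sees the tangential part of (ΔΦ)eᵢ, which `slap_mul_tangent`
      -- writes as a gradient plus a rotated gradient. Both pair to zero with ξ, so each Cartesian
      -- component of ξ has only its degree 0 part.
      have e : -((k : ℂ) * (k + 1)) * pairF f Φ =
          pairV ξ (sgrad fun z => sgrad Φ z i) + pairV ξ (srot fun z => srot Φ z i) := by
        unfold pairF pairV
        rw [← integral_const_mul, ← integral_add
          (integrable_pairV ξ (contDiff_sgrad (n := ∞) (m := 0) hcg (by simp)).continuous)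
          (integrable_pairV ξ (continuous_srot (hcr.of_le (by simp))))]
        refine integral_congr_ae ?_
        filter_upwards [ht, hfξ] with y hy hfy
        rw [hfy, ← Finset.sum_add_distrib]
        simp only [← mul_add, ← slap_mul_tangent h3 (norm_coe_S2 y), hΦ' y (norm_coe_S2 y)]
        have : ∑ j, ξ y j * (-((k : ℂ) * (k + 1)) * Φ y *
            ((if i = j then 1 else 0) - (y : R3) i * (y : R3) j))
            = -((k : ℂ) * (k + 1)) * Φ y * (ξ y i)
              - -((k : ℂ) * (k + 1)) * Φ y * (y : R3) i * ∑ j, ξ y j * ((y : R3) j : ℂ) := by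
          rw [Finset.mul_sum]
          fin_cases i <;> simp [Fin.sum_univ_three] <;> ring
        rw [this, hy]
        ring
      rw [hg _ hcg, hr _ hcr, add_zero] at e
      refine (mul_eq_zero.1 e).resolve_left (neg_ne_zero.2 ?_)
      have : (k : ℂ) ≠ 0 := Nat.cast_ne_zero.2 hk
      exact mul_ne_zero this (by exact_mod_cast Nat.succ_ne_zero k)
    have hf0 : f = harm 0 f := by
      refine harm_ext fun k => ?_
      rw [harm_harm]
      split_ifs with h
      · rw [h]
      · exact hk k h
    obtain ⟨c, hc⟩ := exists_const_of_mem_Y_zero (harm_mem 0 f)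
    rw [← hf0] at hc
    refine ⟨c, ?_⟩
    filter_upwards [hc, hfξ] with y h1 h2
    rw [← h2, h1]
  choose c hc using hc
  -- ξ is now a constant vector orthogonal to almost every point of the sphere, hence by continuity
  -- to every point, in particular to the basis vectors.
  have hz : (fun y : S2 => ∑ i, c i * ((y : R3) i : ℂ)) = fun _ => 0 := by
    refine Continuous.ae_eq_iff_eq surf (by fun_prop) continuous_const |>.1 ?_
    filter_upwards [ht, hc 0, hc 1, hc 2] with y h h0 h1 h2
    rw [← h]
    simp [Fin.sum_univ_three, h0, h1, h2]
  have hc0 : ∀ i, c i = 0 := by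
    intro i
    have := congrFun hz ⟨EuclideanSpace.single i 1, by simp⟩
    simpa [Pi.single_apply, apply_ite, ite_mul] using this
  refine Lp.ext ?_
  filter_upwards [hc 0, hc 1, hc 2, Lp.coeFn_zero (EuclideanSpace ℂ (Fin 3)) 2 surf]
    with y h0 h1 h2 hy
  rw [hy]
  ext i
  fin_cases i
  · simpa [hc0] using h0
  · simpa [hc0] using h1
  · simpa [hc0] using h2

lemma inner_eq_pairV {ξ : Vec2} {V : R3 → Fin 3 → ℂ} (hξ : IsRepV ξ V) (η : Vec2) :
    inner ℂ ξ η = pairV η (fun x i => starRingEnd ℂ (V x i)) := by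
  rw [L2.inner_def]
  refine integral_congr_ae ?_
  filter_upwards [hξ] with y hy
  rw [PiLp.inner_apply]
  simp only [hy]
  rfl

lemma HasSum.pairV {ξ : ℕ → Vec2} {η : Vec2} (h : HasSum ξ η) {V : R3 → Fin 3 → ℂ}
    (hV : Continuous V) : HasSum (fun k => pairV (ξ k) V) (pairV η V) := by
  have hc : Continuous (fun x i => starRingEnd ℂ (V x i)) :=
    continuous_pi fun i => Complex.continuous_conj.comp ((continuous_apply i).comp hV)
  obtain ⟨ζ, hζ⟩ := exists_isRepV hc
  have e : ∀ η, StokesSphere.pairV η V = innerSL ℂ ζ η := fun η => by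
    rw [innerSL_apply_apply, inner_eq_pairV hζ]
    simp
  simp only [e]
  exact (innerSL ℂ ζ).hasSum h

lemma HasSum.pairF {u : ℕ → Fun2} {v : Fun2} (h : HasSum u v) {φ : R3 → ℂ}
    (hφ : Continuous φ) : HasSum (fun k => pairF (u k) φ) (pairF v φ) := by
  obtain ⟨ζ, hζ⟩ := exists_isRep (Complex.continuous_conj.comp hφ)
  have e : ∀ η, StokesSphere.pairF η φ = innerSL ℂ ζ η := fun η => by
    rw [innerSL_apply_apply, inner_eq_pairF hζ]
    simp
  simp only [e]
  exact (innerSL ℂ ζ).hasSum h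

/-- Tangency as the vanishing of continuous linear functionals, a form that passes to L² limits;
`exists_hodge` needs it for an infinite sum. -/
lemma tangent_iff {ξ : Vec2} :
    Tangent ξ ↔ ∀ φ : R3 → ℂ, ContDiff ℝ ∞ φ → pairV ξ (fun x i => φ x * (x i : ℂ)) = 0 := by
  have hm : MemLp (fun y : S2 => ∑ i, ξ y i * ((y : R3) i : ℂ)) 2 surf := by
    refine memLp_finsetSum _ fun i _ => ?_
    refine (memLp_coord ξ i).of_le_mul (c := 1) ?_ (Eventually.of_forall fun y => ?_)
    · exact (memLp_coord ξ i).1.mul (by fun_prop : Continuous fun y : S2 =>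
        ((y : R3) i : ℂ)).aestronglyMeasurable
    · rw [norm_mul, one_mul, Complex.norm_real]
      have := PiLp.norm_apply_le (y : R3) i
      rw [norm_coe_S2] at this
      exact mul_le_of_le_one_right (norm_nonneg _) this
  set t : Fun2 := hm.toLp with ht
  have hty : ∀ᵐ y : S2 ∂surf, t y = ∑ i, ξ y i * ((y : R3) i : ℂ) := hm.coeFn_toLp
  have e : ∀ φ : R3 → ℂ, pairV ξ (fun x i => φ x * (x i : ℂ)) = pairF t φ := fun φ => by
    refine integral_congr_ae ?_
    filter_upwards [hty] with y hy
    rw [hy, Finset.sum_mul]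
    exact Finset.sum_congr rfl fun i _ => by ring
  simp only [e]
  constructor
  · intro h φ _
    rw [pairF, integral_eq_zero_of_ae]
    filter_upwards [h, hty] with y h1 h2
    rw [h2, h1, zero_mul, Pi.zero_apply]
  · intro h
    have : t = 0 := eq_of_pairF fun φ hφ => by rw [h φ hφ, pairF_zero]
    filter_upwards [hty, Lp.coeFn_zero ℂ 2 surf] with y h1 h2
    rw [← h1, this, h2, Pi.zero_apply]

lemma contDiff_conj {n : WithTop ℕ∞} {F : R3 → ℂ} (hF : ContDiff ℝ n F) :
    ContDiff ℝ n (fun x => starRingEnd ℂ (F x)) := Complex.conjCLE.contDiff.comp hF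

/-- The gradient of a spherical harmonic. -/
lemma exists_grad_field {k : ℕ} {f : Fun2} (hf : f ∈ Y k) : ∃ ξ : Vec2, Tangent ξ ∧
    HasCodiff ξ (((k : ℂ) * (k + 1)) • f) ∧ HasCurl ξ 0 ∧ HasGrad f ξ ∧
    ‖ξ‖ ^ 2 = (k : ℝ) * (k + 1) * ‖f‖ ^ 2 := by
  obtain ⟨F, hF, hF', hfF⟩ := exists_rep_of_mem_Y hf
  have hs := contDiff_sgrad (m := ∞) hF (by simp)
  obtain ⟨ξ, hξ⟩ := exists_isRepV hs.continuous
  have hcod : HasCodiff ξ (((k : ℂ) * (k + 1)) • f) := by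
    refine hξ.hasCodiff_sgrad hF ?_
    filter_upwards [hfF.smul ((k : ℂ) * (k + 1))] with y hy
    rw [hy, hF' y (norm_coe_S2 y)]
    ring
  refine ⟨ξ, hξ.tangent_sgrad, hcod, hξ.hasCurl_sgrad hF, hξ.hasGrad hF hfF, ?_⟩
  have e1 : (inner ℂ ξ ξ : ℂ) = ((k : ℂ) * (k + 1)) * inner ℂ f f := by
    rw [inner_eq_pairV hξ, inner_eq_pairF hfF, ← pairF_smul,
      hcod _ (contDiff_conj hF)]
    congr 1
    funext x i
    simp [sgrad, pd_conj]
  rw [inner_self_eq_norm_sq_to_K, inner_self_eq_norm_sq_to_K] at e1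
  refine Complex.ofReal_injective ?_
  push_cast
  exact e1

/-- The rotated gradient of a spherical harmonic. -/
lemma exists_rot_field {k : ℕ} {f : Fun2} (hf : f ∈ Y k) : ∃ ξ : Vec2, Tangent ξ ∧
    HasCodiff ξ 0 ∧ HasCurl ξ (-((k : ℂ) * (k + 1)) • f) ∧
    (∀ V, SmoothTangent V → pairV ξ V = - pairF f (scurl V)) ∧
    ‖ξ‖ ^ 2 = (k : ℝ) * (k + 1) * ‖f‖ ^ 2 := by
  obtain ⟨F, hF, hF', hfF⟩ := exists_rep_of_mem_Y hf
  have hs := contDiff_srot (m := ∞) hF (by simp)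
  obtain ⟨ξ, hξ⟩ := exists_isRepV hs.continuous
  have hcurl : HasCurl ξ (-((k : ℂ) * (k + 1)) • f) := by
    refine hξ.hasCurl_srot hF ?_
    filter_upwards [hfF.smul (-((k : ℂ) * (k + 1)))] with y hy
    rw [hy, hF' y (norm_coe_S2 y)]
  refine ⟨ξ, hξ.tangent_srot, hξ.hasCodiff_srot hF, hcurl,
    fun V hV => hξ.pairV_srot hF hfF hV, ?_⟩
  have e1 : (inner ℂ ξ ξ : ℂ) = ((k : ℂ) * (k + 1)) * inner ℂ f f := by
    have h := hcurl _ (contDiff_conj hF)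
    rw [pairF_smul] at h
    rw [inner_eq_pairV hξ, inner_eq_pairF hfF]
    have e : (fun x i => starRingEnd ℂ (srot F x i)) = srot fun x => starRingEnd ℂ (F x) := by
      funext x i
      fin_cases i <;> simp [srot, cross_apply, pd_conj]
    rw [e, ← neg_eq_iff_eq_neg.2 h]
    simp only [neg_mul, neg_neg]
  rw [inner_self_eq_norm_sq_to_K, inner_self_eq_norm_sq_to_K] at e1
  refine Complex.ofReal_injective ?_
  push_cast
  exact e1

lemma summable_inv_eigenvalue : Summable fun k : ℕ => ((k : ℝ) * (k + 1))⁻¹ := by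
  refine Summable.of_nonneg_of_le (fun k => by positivity) (fun k => ?_)
    (Real.summable_one_div_nat_pow.2 (by norm_num : 1 < 2))
  rcases Nat.eq_zero_or_pos k with rfl | hk
  · simp
  · rw [one_div]
    have : (0 : ℝ) < k := by exact_mod_cast hk
    gcongr
    nlinarith

/-- Fields with norms controlled by the harmonics of an `L²` function can be summed. -/
lemma summable_fields (u : Fun2) {ξ : ℕ → Vec2}
    (h : ∀ k : ℕ, ‖ξ k‖ ^ 2 = (k : ℝ) * (k + 1) * ‖harm k u‖ ^ 2) (c : ℕ → ℂ)
    (hc : ∀ k : ℕ, ‖c k‖ = ((k : ℝ) * (k + 1))⁻¹) : Summable fun k => c k • ξ k := by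
  refine Summable.of_norm_bounded
    (summable_inv_eigenvalue.add (hasSum_norm_harm u).summable) fun k => ?_
  rw [norm_smul, hc]
  rcases Nat.eq_zero_or_pos k with rfl | hk
  · simp
  have hpos : (0 : ℝ) < (k : ℝ) * (k + 1) := by positivity
  -- The square of the norm is a product ab of the two summands of the majorant, and ab ≤ (a + b)²
  -- for a, b ≥ 0.
  have h2 : (((k : ℝ) * (k + 1))⁻¹ * ‖ξ k‖) ^ 2 = ((k : ℝ) * (k + 1))⁻¹ * ‖harm k u‖ ^ 2 := by
    rw [mul_pow, h]; field_simp
  have h3 : 0 < ((k : ℝ) * (k + 1))⁻¹ := inv_pos.2 hpos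
  have h4 : 0 ≤ ‖harm k u‖ ^ 2 := by positivity
  refine abs_le_of_sq_le_sq' ?_ (by positivity) |>.2
  rw [h2]
  nlinarith [sq_nonneg (((k : ℝ) * (k + 1))⁻¹), sq_nonneg (‖harm k u‖ ^ 2)]

/-- Solved degree by degree: the gradient of `harm k u` has codifferential k(k+1) times it, the
rotated gradient of `harm k w` has curl -k(k+1) times it. After division the series of fields
converges absolutely. -/
lemma exists_hodge {w u : Fun2} (hw : harm 0 w = 0) (hu : harm 0 u = 0) :
    ∃ ξ : Vec2, Tangent ξ ∧ HasCurl ξ w ∧ HasCodiff ξ u := by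
  choose G hGt hGd hGc _ hGn using fun k => exists_grad_field (harm_mem k u)
  choose R hRt hRd hRc _ hRn using fun k => exists_rot_field (harm_mem k w)
  have hG := (summable_fields u hGn (fun k => ((k : ℂ) * (k + 1))⁻¹) (fun k => by
    rw [norm_inv, norm_mul]; norm_cast)).hasSum
  have hR := (summable_fields w hRn (fun k => -((k : ℂ) * (k + 1))⁻¹) (fun k => by
    rw [norm_neg, norm_inv, norm_mul]; norm_cast)).hasSum
  have hne : ∀ k : ℕ, k ≠ 0 → (k : ℂ) * (k + 1) ≠ 0 := fun k hk =>
    mul_ne_zero (Nat.cast_ne_zero.2 hk) (by exact_mod_cast Nat.succ_ne_zero k)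
  -- In degree 0 the inverse is 0 by convention, and the identity holds only because the mean
  -- vanishes.
  have hGu : ∀ k : ℕ, ((k : ℂ) * (k + 1))⁻¹ • ((k : ℂ) * (k + 1)) • harm k u = harm k u := by
    intro k
    rcases eq_or_ne k 0 with rfl | hk
    · rw [hu]; simp
    · rw [smul_smul, inv_mul_cancel₀ (hne k hk), one_smul]
  have hRw : ∀ k : ℕ, -((k : ℂ) * (k + 1))⁻¹ • -((k : ℂ) * (k + 1)) • harm k w = harm k w := by
    intro k
    rcases eq_or_ne k 0 with rfl | hk
    · rw [hw]; simp
    · rw [smul_smul, neg_mul_neg, inv_mul_cancel₀ (hne k hk), one_smul]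
  obtain ⟨ξ, hS⟩ : ∃ ξ, HasSum (fun k : ℕ => ((k : ℂ) * (k + 1))⁻¹ • G k
      + -((k : ℂ) * (k + 1))⁻¹ • R k) ξ := ⟨_, hG.add hR⟩
  refine ⟨ξ, tangent_iff.2 fun φ hφ => ?_, fun φ hφ => ?_, fun φ hφ => ?_⟩
  · have h1 := HasSum.pairV hS (V := fun x i => φ x * (x i : ℂ))
      (continuous_pi fun i => hφ.continuous.mul (contDiff_coord (n := 0) i).continuous)
    refine h1.unique ?_
    convert hasSum_zero with k
    exact tangent_iff.1 (((hGt k).smul _).add ((hRt k).smul _)) φ hφ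
  · have h1 := HasSum.pairV hS (continuous_srot (hφ.of_le (m := 1) (by simp)))
    have h2 := HasSum.pairF (hasSum_harm w) hφ.continuous
    refine h2.unique (h1.neg.congr_fun ?_)
    intro k
    have := ((hGc k).smul ((k : ℂ) * (k + 1))⁻¹).add ((hRc k).smul (-((k : ℂ) * (k + 1))⁻¹))
    rw [hRw, smul_zero, zero_add] at this
    exact this φ hφ
  · have h1 := HasSum.pairV hS (contDiff_sgrad (m := 0) hφ (by simp)).continuous
    have h2 := HasSum.pairF (hasSum_harm u) hφ.continuous
    refine h2.unique (h1.congr_fun ?_)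
    intro k
    have := ((hGd k).smul ((k : ℂ) * (k + 1))⁻¹).add ((hRd k).smul (-((k : ℂ) * (k + 1))⁻¹))
    rw [hGu, smul_zero, add_zero] at this
    exact this φ hφ

/-! ### Scalar coordinates on `X` -/

section fields

variable {m : ℕ} {ξ : Vec2}

lemma hasCurl_curl (h : ξ ∈ tanHsSucc m) : HasCurl ξ (curl ξ) := by
  obtain ⟨_, ⟨w, _, hw⟩, _⟩ := h
  rwa [hw.curl_eq]

lemma curl_mem (h : ξ ∈ tanHsSucc m) : curl ξ ∈ Hs m := by
  obtain ⟨_, ⟨w, hm, hw⟩, _⟩ := h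
  rwa [hw.curl_eq]

lemma hasCodiff_codiff (h : ξ ∈ tanHsSucc m) : HasCodiff ξ (codiff ξ) := by
  obtain ⟨_, _, u, _, hu⟩ := h
  rwa [hu.codiff_eq]

lemma codiff_mem (h : ξ ∈ tanHsSucc m) : codiff ξ ∈ Hs m := by
  obtain ⟨_, _, u, hm, hu⟩ := h
  rwa [hu.codiff_eq]

end fields

/-- A tangent field is determined by its curl and its codifferential. -/
lemma field_ext {ξ η : Vec2} {w u : Fun2} (hξ : Tangent ξ) (hη : Tangent η) (hξw : HasCurl ξ w)
    (hηw : HasCurl η w) (hξu : HasCodiff ξ u) (hηu : HasCodiff η u) : ξ = η := by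
  have h := eq_zero_of_harmonic (hξ.add (hη.smul (-1)))
    (by simpa using hξw.add (hηw.smul (-1))) (by simpa using hξu.add (hηu.smul (-1)))
  rwa [neg_one_smul, ← sub_eq_add_neg, sub_eq_zero] at h

/-- The orders of the Sobolev norms of the scalar coordinates. -/
def ord : Fin 6 → ℕ := ![1, 0, 1, 0, 2, 1]

lemma X_fst (Ξ : X) : Ξ.1.1 ∈ tanHsSucc 1 := Ξ.2.1
lemma X_snd (Ξ : X) : Ξ.1.2.1 ∈ tanHsSucc 0 := Ξ.2.2.1
lemma X_trd (Ξ : X) : Ξ.1.2.2.1 ∈ Hs 2 ∧ Ξ.1.2.2.1 ∈ meanZero := Ξ.2.2.2.1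
lemma X_fth (Ξ : X) : Ξ.1.2.2.2 ∈ Hs 1 := Ξ.2.2.2.2

lemma curl_add {m n : ℕ} {ξ η : Vec2} (h : ξ ∈ tanHsSucc m) (k : η ∈ tanHsSucc n) :
    curl (ξ + η) = curl ξ + curl η := ((hasCurl_curl h).add (hasCurl_curl k)).curl_eq

lemma curl_smul {m : ℕ} {ξ : Vec2} (c : ℂ) (h : ξ ∈ tanHsSucc m) :
    curl (c • ξ) = c • curl ξ := ((hasCurl_curl h).smul c).curl_eq

lemma codiff_add {m n : ℕ} {ξ η : Vec2} (h : ξ ∈ tanHsSucc m) (k : η ∈ tanHsSucc n) :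
    codiff (ξ + η) = codiff ξ + codiff η := ((hasCodiff_codiff h).add (hasCodiff_codiff k)).codiff_eq

lemma codiff_smul {m : ℕ} {ξ : Vec2} (c : ℂ) (h : ξ ∈ tanHsSucc m) :
    codiff (c • ξ) = c • codiff ξ := ((hasCodiff_codiff h).smul c).codiff_eq

/-- The scalar coordinates `(∗dξ, ∗dξ', d^∗ξ, d^∗ξ', ϑ, ϑ^∗)` on `X`. -/
def coord0 (Ξ : X) : Fin 6 → Fun2 :=
  ![curl Ξ.1.1, curl Ξ.1.2.1, codiff Ξ.1.1, codiff Ξ.1.2.1, Ξ.1.2.2.1, Ξ.1.2.2.2]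

lemma coord0_add (Ξ Θ : X) : coord0 (Ξ + Θ) = coord0 Ξ + coord0 Θ := by
  simp only [coord0, Submodule.coe_add, Prod.fst_add, Prod.snd_add, curl_add (X_fst Ξ) (X_fst Θ),
    curl_add (X_snd Ξ) (X_snd Θ), codiff_add (X_fst Ξ) (X_fst Θ), codiff_add (X_snd Ξ) (X_snd Θ),
    Matrix.cons_add_cons, Matrix.empty_add_empty]

lemma coord0_smul (c : ℂ) (Ξ : X) : coord0 (c • Ξ) = c • coord0 Ξ := by
  simp only [coord0, Submodule.coe_smul, Prod.smul_fst, Prod.smul_snd, curl_smul c (X_fst Ξ),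
    curl_smul c (X_snd Ξ), codiff_smul c (X_fst Ξ), codiff_smul c (X_snd Ξ),
    Matrix.smul_cons, Matrix.smul_empty]

/-- The scalar coordinates, as a linear map. -/
def coord : X →ₗ[ℂ] (Fin 6 → Fun2) where
  toFun := coord0
  map_add' := coord0_add
  map_smul' := coord0_smul

lemma coord_apply (Ξ : X) : coord Ξ =
    ![curl Ξ.1.1, curl Ξ.1.2.1, codiff Ξ.1.1, codiff Ξ.1.2.1, Ξ.1.2.2.1, Ξ.1.2.2.2] := rfl

lemma mem_Hs_zero (f : Fun2) : f ∈ Hs 0 := by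
  have := (hasSum_norm_harm f).summable
  simpa [Hs] using this

lemma hsq_zero (f : Fun2) : hsq 0 f = ‖f‖ ^ 2 := by
  simp [hsq, (hasSum_norm_harm f).tsum_eq]

lemma coord_mem (Ξ : X) (i : Fin 6) : coord Ξ i ∈ Hs (ord i) := by
  fin_cases i
  · change curl Ξ.1.1 ∈ Hs 1
    exact curl_mem (X_fst Ξ)
  · change curl Ξ.1.2.1 ∈ Hs 0
    exact mem_Hs_zero _
  · change codiff Ξ.1.1 ∈ Hs 1
    exact codiff_mem (X_fst Ξ)
  · change codiff Ξ.1.2.1 ∈ Hs 0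
    exact mem_Hs_zero _
  · change Ξ.1.2.2.1 ∈ Hs 2
    exact (X_trd Ξ).1
  · change Ξ.1.2.2.2 ∈ Hs 1
    exact X_fth Ξ

/-- Index 5 is ϑ^∗, the only coordinate with a free mean: curls and codifferentials integrate to
zero, and ϑ does by definition of X. -/
lemma harm_zero_coord (Ξ : X) {i : Fin 6} (hi : i ≠ 5) : harm 0 (coord Ξ i) = 0 := by
  fin_cases i
  · change harm 0 (curl Ξ.1.1) = 0
    exact (hasCurl_curl (X_fst Ξ)).harm_zero
  · change harm 0 (curl Ξ.1.2.1) = 0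
    exact (hasCurl_curl (X_snd Ξ)).harm_zero
  · change harm 0 (codiff Ξ.1.1) = 0
    exact (hasCodiff_codiff (X_fst Ξ)).harm_zero
  · change harm 0 (codiff Ξ.1.2.1) = 0
    exact (hasCodiff_codiff (X_snd Ξ)).harm_zero
  · change harm 0 Ξ.1.2.2.1 = 0
    exact meanZero_iff.1 (X_trd Ξ).2
  · exact absurd rfl hi

lemma coord_injective : Function.Injective coord := by
  intro Ξ Θ h
  have e : ∀ i, coord Ξ i = coord Θ i := congrFun h
  have e0 : curl Ξ.1.1 = curl Θ.1.1 := e 0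
  have e1 : curl Ξ.1.2.1 = curl Θ.1.2.1 := e 1
  have e2 : codiff Ξ.1.1 = codiff Θ.1.1 := e 2
  have e3 : codiff Ξ.1.2.1 = codiff Θ.1.2.1 := e 3
  have c0 := hasCurl_curl (X_fst Θ)
  have c1 := hasCurl_curl (X_snd Θ)
  have c2 := hasCodiff_codiff (X_fst Θ)
  have c3 := hasCodiff_codiff (X_snd Θ)
  rw [← e0] at c0
  rw [← e1] at c1
  rw [← e2] at c2
  rw [← e3] at c3
  have f1 : Ξ.1.1 = Θ.1.1 :=
    field_ext (X_fst Ξ).1 (X_fst Θ).1 (hasCurl_curl (X_fst Ξ)) c0 (hasCodiff_codiff (X_fst Ξ)) c2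
  have f2 : Ξ.1.2.1 = Θ.1.2.1 :=
    field_ext (X_snd Ξ).1 (X_snd Θ).1 (hasCurl_curl (X_snd Ξ)) c1 (hasCodiff_codiff (X_snd Ξ)) c3
  exact Subtype.ext (Prod.ext f1 (Prod.ext f2 (Prod.ext (e 4) (e 5))))

lemma exists_coord {a : Fin 6 → Fun2} (h : ∀ i, a i ∈ Hs (ord i))
    (h0 : ∀ i, i ≠ 5 → harm 0 (a i) = 0) : ∃ Ξ, coord Ξ = a := by
  obtain ⟨ξ, t1, w1, u1⟩ := exists_hodge (h0 0 (by decide)) (h0 2 (by decide))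
  obtain ⟨ξ', t2, w2, u2⟩ := exists_hodge (h0 1 (by decide)) (h0 3 (by decide))
  refine ⟨⟨(ξ, ξ', a 4, a 5), ⟨t1, ⟨_, h 0, w1⟩, _, h 2, u1⟩, ⟨t2, ⟨_, h 1, w2⟩, _, h 3, u2⟩,
    ⟨h 4, meanZero_iff.2 (h0 4 (by decide))⟩, h 5⟩, ?_⟩
  rw [coord_apply]
  simp only [w1.curl_eq, w2.curl_eq, u1.codiff_eq, u2.codiff_eq]
  funext i
  fin_cases i <;> rfl

/-- The energy of the component of degree `k`. -/
def energy (k : ℕ) (v : Fin 6 → Fun2) : ℝ := ∑ i, wt k ^ ord i * ‖v i‖ ^ 2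

lemma energy_nonneg (k : ℕ) (v : Fin 6 → Fun2) : 0 ≤ energy k v :=
  Finset.sum_nonneg fun _ _ => mul_nonneg (pow_nonneg (wt_nonneg k) _) (sq_nonneg _)

/-- The component of degree `k` of the coordinates. -/
def mode (Ξ : X) (k : ℕ) : Fin 6 → Fun2 := fun i => harm k (coord Ξ i)

lemma mode_add (Ξ Θ : X) (k : ℕ) : mode (Ξ + Θ) k = mode Ξ k + mode Θ k := by
  funext i; simp [mode]

lemma mode_sub (Ξ Θ : X) (k : ℕ) : mode (Ξ - Θ) k = mode Ξ k - mode Θ k := by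
  funext i; simp [mode]

lemma mode_smul (c : ℂ) (Ξ : X) (k : ℕ) : mode (c • Ξ) k = c • mode Ξ k := by
  funext i; simp [mode]

lemma mode_ext {Ξ Θ : X} (h : ∀ k, mode Ξ k = mode Θ k) : Ξ = Θ :=
  coord_injective (funext fun i => harm_ext fun k => congrFun (h k) i)

lemma normX_nonneg (Ξ : X) : 0 ≤ normX Ξ := Real.sqrt_nonneg _

lemma hasSum_energy (Ξ : X) : HasSum (fun k => energy k (mode Ξ k)) (normX Ξ ^ 2) := by
  have h : HasSum (fun k => energy k (mode Ξ k)) (∑ i, hsq (ord i) (coord Ξ i)) :=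
    hasSum_sum fun i _ => Summable.hasSum (coord_mem Ξ i)
  convert h
  rw [normX, Real.sq_sqrt]
  · simp [Fin.sum_univ_six, ord, coord_apply, hsq_zero]
    ring
  · have hq : ∀ (m : ℕ) (f : Fun2), 0 ≤ hsq m f := fun m f => tsum_nonneg fun k =>
      mul_nonneg (pow_nonneg (wt_nonneg k) _) (sq_nonneg _)
    have h1 := hq 1 (curl Ξ.1.1)
    have h2 := hq 1 (codiff Ξ.1.1)
    have h3 := hq 2 Ξ.1.2.2.1
    have h4 := hq 1 Ξ.1.2.2.2
    positivity

lemma exists_mode {a : ℕ → Fin 6 → Fun2} (ha : ∀ k i, a k i ∈ Y k)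
    (h : Summable fun k => energy k (a k)) (h0 : ∀ i, i ≠ 5 → a 0 i = 0) :
    ∃ Ξ, ∀ k, mode Ξ k = a k := by
  have hs : ∀ i, Summable fun k => wt k ^ ord i * ‖a k i‖ ^ 2 := fun i =>
    Summable.of_nonneg_of_le (fun k => mul_nonneg (pow_nonneg (wt_nonneg k) _) (sq_nonneg _))
      (fun k => Finset.single_le_sum (f := fun i => wt k ^ ord i * ‖a k i‖ ^ 2)
        (fun _ _ => mul_nonneg (pow_nonneg (wt_nonneg k) _) (sq_nonneg _)) (Finset.mem_univ i)) h
  have hw : ∀ k, 1 ≤ wt k := fun k => by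
    unfold wt
    split_ifs with hk
    · exact le_rfl
    · have : (1 : ℝ) ≤ k := by exact_mod_cast Nat.one_le_iff_ne_zero.2 hk
      nlinarith
  have hf : ∀ i, ∃ f, ∀ k, harm k f = a k i := fun i =>
    exists_of_summable (fun k => ha k i) (Summable.of_nonneg_of_le (fun k => sq_nonneg _)
      (fun k => le_mul_of_one_le_left (sq_nonneg _) (one_le_pow₀ (hw k))) (hs i))
  choose f hf using hf
  obtain ⟨Ξ, hΞ⟩ := exists_coord (a := f)
    (fun i => by
      change Summable _
      simpa only [hf] using hs i) (fun i hi => by rw [hf, h0 i hi])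
  exact ⟨Ξ, fun k => funext fun i => by rw [mode, hΞ, hf]⟩

/-! ### The operator in coordinates -/

/-- The action of a real matrix on vectors of `L²` functions. -/
def mulV (M : Matrix (Fin 6) (Fin 6) ℝ) (v : Fin 6 → Fun2) : Fin 6 → Fun2 :=
  fun i => ∑ j, (M i j : ℂ) • v j

lemma mulV_mulV (M N : Matrix (Fin 6) (Fin 6) ℝ) (v : Fin 6 → Fun2) :
    mulV M (mulV N v) = mulV (M * N) v := by
  funext i
  simp only [mulV, Matrix.mul_apply, Finset.smul_sum, smul_smul, Complex.ofReal_sum,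
    Finset.sum_smul, Complex.ofReal_mul]
  exact Finset.sum_comm

lemma mulV_one (v : Fin 6 → Fun2) : mulV 1 v = v := by
  funext i
  simp [mulV, Matrix.one_apply, apply_ite, ite_smul]

lemma mulV_add (M : Matrix (Fin 6) (Fin 6) ℝ) (v w : Fin 6 → Fun2) :
    mulV M (v + w) = mulV M v + mulV M w := by
  funext i
  simp [mulV, Finset.sum_add_distrib]

lemma mulV_smul (M : Matrix (Fin 6) (Fin 6) ℝ) (c : ℂ) (v : Fin 6 → Fun2) :
    mulV M (c • v) = c • mulV M v := by
  funext i
  simp only [mulV, Pi.smul_apply, Finset.smul_sum, smul_comm c]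

lemma mulV_mem {k : ℕ} (M : Matrix (Fin 6) (Fin 6) ℝ) {v : Fin 6 → Fun2} (hv : ∀ i, v i ∈ Y k)
    (i : Fin 6) : mulV M v i ∈ Y k :=
  sum_mem fun j _ => Submodule.smul_mem _ _ (hv j)

/-- The matrix of `L₀` on the components of degree `k`. -/
def genMat (k : ℕ) : Matrix (Fin 6) (Fin 6) ℝ :=
  !![0, -1, 0, 0, 0, 0;
     -((k : ℝ) * (k + 1)), -1, 0, 0, 0, 0;
     0, 0, 0, -1, 0, 0;
     0, 0, -2 * ((k : ℝ) * (k + 1)), -1, 3 * ((k : ℝ) * (k + 1)), (k : ℝ) * (k + 1);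
     0, 0, -1, 0, 1, 0;
     0, 0, 3, 0, -3 - (k : ℝ) * (k + 1), -2]

lemma pairF_congr (u : Fun2) {φ ψ : R3 → ℂ} (h : ∀ x : R3, ‖x‖ = 1 → φ x = ψ x) :
    pairF u φ = pairF u ψ := by
  unfold pairF
  congr 1
  funext y
  rw [h y (norm_coe_S2 y)]

lemma pairF_const_mul (u : Fun2) (c : ℂ) (φ : R3 → ℂ) :
    pairF u (fun x => c * φ x) = c * pairF u φ := by
  unfold pairF
  rw [← integral_const_mul]
  congr 1
  funext y
  ring

lemma pairF_slap (u : Fun2) {k : ℕ} {Φ : R3 → ℂ}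
    (h : ∀ x : R3, ‖x‖ = 1 → slap Φ x = -((k : ℂ) * (k + 1)) * Φ x) :
    pairF u (slap Φ) = -((k : ℂ) * (k + 1)) * pairF u Φ := by
  rw [pairF_congr u h, pairF_const_mul]

lemma HasLap.harm_eq {u l : Fun2} (h : HasLap u l) (k : ℕ) :
    harm k l = -((k : ℂ) * (k + 1)) • harm k u := by
  rw [← sub_eq_zero, ← map_smul, ← map_sub]
  refine harm_eq_zero_of_pairF fun Φ hΦ hΦ' => ?_
  rw [pairF_sub _ _ hΦ.continuous, pairF_smul, h Φ hΦ, pairF_slap u hΦ', sub_self]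

lemma pairV_neg_add_sub (ξ η ζ : Vec2) {V : R3 → Fin 3 → ℂ} (hV : Continuous V) :
    pairV (-ξ + η - ζ) V = -pairV ξ V + pairV η V - pairV ζ V := by
  rw [pairV_sub _ _ hV, pairV_add _ _ hV, ← neg_one_smul ℂ ξ, pairV_smul]
  ring

section generator

variable {ξ ξ' l g : Vec2} {w u w' u' p c : Fun2}

/-- Test against gradients of degree k eigenfunctions: they have no curl, so only the codifferential
half of the Hodge Laplacian contributes, and `sdiv` of the test field is an eigenvalue times the
eigenfunction. Here p plays the role of q - 2ϑ. -/
lemma harm_codiff_forcing (hw : HasCurl ξ w) (hu : HasCodiff ξ u) (hu' : HasCodiff ξ' u')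
    (hl : HasHodgeLap ξ l) (hg : HasGrad p g) (hc : HasCodiff (-ξ' + l - g) c) (k : ℕ) :
    harm k c = -harm k u' - ((k : ℂ) * (k + 1)) • harm k u - ((k : ℂ) * (k + 1)) • harm k p := by
  obtain ⟨-, w₁, u₁, hw₁, hu₁, hl⟩ := hl
  rw [hw₁.unique hw, hu₁.unique hu] at *
  have e : harm k (c - ((-1 : ℂ) • u' - ((k : ℂ) * (k + 1)) • u - ((k : ℂ) * (k + 1)) • p)) = 0 := by
    refine harm_eq_zero_of_pairF fun Φ hΦ hΦ' => ?_
    have hV := smoothTangent_sgrad hΦ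
    have h0 : pairF w (scurl (sgrad Φ)) = 0 := by
      have : scurl (sgrad Φ) = fun _ => 0 := funext fun x => scurl_sgrad (hΦ.of_le two_le_infty)
      simp [pairF, this]
    have h1 : sdiv (sgrad Φ) = slap Φ := rfl
    have hΦc := hΦ.continuous
    rw [pairF_sub _ _ hΦc, pairF_sub _ _ hΦc, pairF_sub _ _ hΦc, pairF_smul, pairF_smul, pairF_smul,
      hc Φ hΦ, pairV_neg_add_sub _ _ _ hV.1.continuous, ← hu' Φ hΦ, hl _ hV, hg.2 _ hV, h0, h1,
      pairF_slap _ hΦ', pairF_slap _ hΦ']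
    ring
  simp only [map_sub, map_smul, sub_eq_zero] at e
  rw [e, neg_one_smul]

/-- Test against rotated gradients, which are divergence free: the pressure term drops out, and the
curls decouple from the other coordinates. -/
lemma harm_curl_forcing (hw : HasCurl ξ w) (hw' : HasCurl ξ' w')
    (hl : HasHodgeLap ξ l) (hg : HasGrad p g) (hc : HasCurl (-ξ' + l - g) c) (k : ℕ) :
    harm k c = -harm k w' - ((k : ℂ) * (k + 1)) • harm k w := by
  obtain ⟨-, w₁, u₁, hw₁, hu₁, hl⟩ := hl
  rw [hw₁.unique hw] at *
  have e : harm k (c - ((-1 : ℂ) • w' - ((k : ℂ) * (k + 1)) • w)) = 0 := by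
    refine harm_eq_zero_of_pairF fun Φ hΦ hΦ' => ?_
    have hV := smoothTangent_srot hΦ
    have h2 := hΦ.of_le two_le_infty
    have h0 : sdiv (srot Φ) = fun _ => 0 := funext fun x => sdiv_srot h2
    have h0' : ∀ v : Fun2, pairF v (sdiv (srot Φ)) = 0 := fun v => by simp [pairF, h0]
    have h1 : pairF w (scurl (srot Φ)) = pairF w (slap Φ) :=
      pairF_congr w fun x hx => scurl_srot h2 hx
    have hΦc := hΦ.continuous
    rw [pairF_sub _ _ hΦc, pairF_sub _ _ hΦc, pairF_smul, pairF_smul,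
      hc Φ hΦ, pairV_neg_add_sub _ _ _ hV.1.continuous, hw' Φ hΦ, hl _ hV, hg.2 _ hV, h0', h0', h1,
      pairF_slap _ hΦ']
    ring
  simp only [map_sub, map_smul, sub_eq_zero] at e
  rw [e, neg_one_smul]

end generator

lemma IsL0.mode_eq {Ξ Θ : X} (h : IsL0 Ξ Θ) (k : ℕ) :
    mode Θ k = mulV (genMat k) (mode Ξ k) := by
  obtain ⟨⟨ξ, ξ', ϑ, ϑs⟩, hΞ⟩ := Ξ
  obtain ⟨⟨f, f', g, gs⟩, hΘ⟩ := Θ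
  have hΞ1 : ξ ∈ tanHsSucc 1 := X_fst ⟨_, hΞ⟩
  have hΞ2 : ξ' ∈ tanHsSucc 0 := X_snd ⟨_, hΞ⟩
  have hΘ1 : f ∈ tanHsSucc 1 := X_fst ⟨_, hΘ⟩
  have hΘ2 : f' ∈ tanHsSucc 0 := X_snd ⟨_, hΘ⟩
  obtain ⟨-, u, q, lapϑ, lapξ, gradp, hu, hq, hl, hg, hlap, rfl, rfl, rfl, rfl⟩ := h
  have hcu := hu.codiff_eq
  have hq' : q = u - ϑ - ϑs := by rw [← sub_eq_zero, ← hq]; abel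
  have e0 := ((hasCurl_curl hΞ2).smul (-1)).curl_eq
  have e2 := ((hasCodiff_codiff hΞ2).smul (-1)).codiff_eq
  have e1 := harm_curl_forcing (hasCurl_curl hΞ1) (hasCurl_curl hΞ2) hl hg (hasCurl_curl hΘ2) k
  have e3 := harm_codiff_forcing (hasCurl_curl hΞ1) (hasCodiff_codiff hΞ1) (hasCodiff_codiff hΞ2)
    hl hg (hasCodiff_codiff hΘ2) k
  have e5 := hlap.harm_eq k
  rw [neg_one_smul] at e0 e2
  simp only [hcu, hq', map_sub, map_smul] at e0 e1 e2 e3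
  funext i
  fin_cases i
  · simp [mode, mulV, coord_apply, genMat, Fin.sum_univ_six, e0]
    module
  · simp [mode, mulV, coord_apply, genMat, Fin.sum_univ_six, e1]
    module
  · simp [mode, mulV, coord_apply, genMat, Fin.sum_univ_six, e2]
    module
  · simp [mode, mulV, coord_apply, genMat, Fin.sum_univ_six, e3, hcu]
    module
  · simp [mode, mulV, coord_apply, genMat, Fin.sum_univ_six, hcu, hq']
    module
  · simp [mode, mulV, coord_apply, genMat, Fin.sum_univ_six, e5, hcu, hq']
    module

lemma mem_Hs_of_mem_Y {k : ℕ} {f : Fun2} (hf : f ∈ Y k) (m : ℕ) : f ∈ Hs m := by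
  refine summable_of_ne_finset_zero (s := {k}) fun j hj => ?_
  rw [harm_of_mem_ne (by simpa using hj) hf]
  simp

/-- The converse of `IsL0.mode_eq` within one degree, which supplies genuine eigenvectors of L₀. The
weak derivatives are exhibited: Δξ is the rotated gradient of the curl minus the gradient of the
codifferential. The two field equations then follow from `field_ext`, by comparing curls and
codifferentials. -/
lemma isL0_of_mem_Y {k : ℕ} {Ξ Θ : X} (hΞY : ∀ i, coord Ξ i ∈ Y k)
    (h : coord Θ = mulV (genMat k) (coord Ξ)) : IsL0 Ξ Θ := by
  obtain ⟨⟨ξ, ξ', ϑ, ϑs⟩, hΞ⟩ := Ξ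
  obtain ⟨⟨f, f', g, gs⟩, hΘ⟩ := Θ
  have hΞ1 : ξ ∈ tanHsSucc 1 := X_fst ⟨_, hΞ⟩
  have hΞ2 : ξ' ∈ tanHsSucc 0 := X_snd ⟨_, hΞ⟩
  have hΘ1 : f ∈ tanHsSucc 1 := X_fst ⟨_, hΘ⟩
  have hΘ2 : f' ∈ tanHsSucc 0 := X_snd ⟨_, hΘ⟩
  have hΞ3 : ϑ ∈ meanZero := (X_trd ⟨_, hΞ⟩).2
  have hw : curl ξ ∈ Y k := hΞY 0
  have hw' : curl ξ' ∈ Y k := hΞY 1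
  have hu : codiff ξ ∈ Y k := hΞY 2
  have hu' : codiff ξ' ∈ Y k := hΞY 3
  have hϑ : ϑ ∈ Y k := hΞY 4
  have hϑs : ϑs ∈ Y k := hΞY 5
  have h0 := congrFun h 0
  have h1 := congrFun h 1
  have h2 := congrFun h 2
  have h3 := congrFun h 3
  have h4 := congrFun h 4
  have h5 := congrFun h 5
  simp [mulV, coord_apply, genMat, Fin.sum_univ_six] at h0 h1 h2 h3 h4 h5
  set q := codiff ξ - ϑ - ϑs with hq
  have hqY : q ∈ Y k := sub_mem (sub_mem hu hϑ) hϑs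
  obtain ⟨R, hRt, hRu, hRw, hRV, -⟩ := exists_rot_field hw
  obtain ⟨G, hGt, hGu, hGw, hGV, -⟩ := exists_grad_field hu
  obtain ⟨P, hPt, hPu, hPw, hPV, -⟩ := exists_grad_field
    (sub_mem hqY (Submodule.smul_mem _ (2 : ℂ) hϑ))
  obtain ⟨T, hT, hT', hϑT⟩ := exists_rep_of_mem_Y hϑ
  refine ⟨⟨⟨hΞ1.1, ⟨_, mem_Hs_of_mem_Y hw 2, hasCurl_curl hΞ1⟩, _, mem_Hs_of_mem_Y hu 2,
      hasCodiff_codiff hΞ1⟩, ⟨hΞ2.1, ⟨_, mem_Hs_of_mem_Y hw' 1, hasCurl_curl hΞ2⟩, _,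
      mem_Hs_of_mem_Y hu' 1, hasCodiff_codiff hΞ2⟩, ⟨mem_Hs_of_mem_Y hϑ 3, hΞ3⟩,
      mem_Hs_of_mem_Y hϑs 2⟩,
    codiff ξ, q, -((k : ℂ) * (k + 1)) • ϑ, R + (-1 : ℂ) • G, P, hasCodiff_codiff hΞ1,
    by rw [hq]; abel, ⟨hRt.add (hGt.smul _), _, _, hasCurl_curl hΞ1, hasCodiff_codiff hΞ1,
      fun V hV => ?_⟩, hPV, hϑT.hasLap hT ?_, ?_, ?_, ?_, ?_⟩
  · rw [pairV_add _ _ hV.1.continuous, pairV_smul, hRV V hV, hGV.2 V hV]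
    ring
  · filter_upwards [hϑT.smul (-((k : ℂ) * (k + 1)))] with y hy
    rw [hy, hT' y (norm_coe_S2 y)]
  · have a1 := hasCurl_curl hΘ1
    have a2 := hasCodiff_codiff hΘ1
    have b1 := (hasCurl_curl hΞ2).smul (-1)
    have b2 := (hasCodiff_codiff hΞ2).smul (-1)
    have e0 : curl f = (-1 : ℂ) • curl ξ' := by rw [h0]; module
    have e2 : codiff f = (-1 : ℂ) • codiff ξ' := by rw [h2]; module
    rw [e0] at a1
    rw [e2] at a2
    rw [← neg_one_smul ℂ]
    exact field_ext hΘ1.1 (hΞ2.1.smul (-1)) a1 b1 a2 b2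
  · have a1 := hasCurl_curl hΘ2
    have a2 := hasCodiff_codiff hΘ2
    have b1 := (((hasCurl_curl hΞ2).smul (-1)).add (hRw.add (hGw.smul (-1)))).add (hPw.smul (-1))
    have b2 := (((hasCodiff_codiff hΞ2).smul (-1)).add (hRu.add (hGu.smul (-1)))).add
      (hPu.smul (-1))
    have b3 := ((hΞ2.1.smul (-1)).add (hRt.add (hGt.smul (-1)))).add (hPt.smul (-1))
    have e : -ξ' + (R + (-1 : ℂ) • G) - P
      = (-1 : ℂ) • ξ' + (R + (-1 : ℂ) • G) + (-1 : ℂ) • P := by module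
    rw [e]
    refine field_ext hΘ2.1 b3 a1 ?_ a2 ?_
    · convert b1 using 1
      simp only [h1]
      module
    · convert b2 using 1
      simp only [h3, hq]
      module
  · rw [h4, hq]; module
  · rw [h5, hq]; module

/-! ### Diagonalisation of the generator on the components of degree `k` -/

/-- The eigenvalues of `genMat k`, for `k ≥ 1`. -/
def evR (x : ℝ) : Fin 6 → ℝ := ![x, -(x + 1), x + 1, x - 1, -x, -(x + 2)]

/-- The matrix of eigenvectors of `genMat k` (its columns), at `x = k ≥ 1`. -/
def colR (x : ℝ) : Matrix (Fin 6) (Fin 6) ℝ :=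
  !![1, 1, 0, 0, 0, 0;
     -x, x + 1, 0, 0, 0, 0;
     0, 0, -x, 2 - x, x + 1, x + 3;
     0, 0, x * (x + 1), (x - 1) * (x - 2), x * (x + 1), (x + 2) * (x + 3);
     0, 0, 1, 1, 1, 1;
     0, 0, -(x + 1), (3 - 4 * x - x ^ 2) / (x + 1), x, (x ^ 2 - 2 * x - 6) / x]

/-- The inverse of `colR x`; its rows are left eigenvectors of `genMat k`, at `x = k ≥ 1`. -/
def rowR (x : ℝ) : Matrix (Fin 6) (Fin 6) ℝ :=
  !![(x + 1) / (2 * x + 1), -1 / (2 * x + 1), 0, 0, 0, 0;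
     x / (2 * x + 1), 1 / (2 * x + 1), 0, 0, 0, 0;
     0, 0, -((x + 2) * (x + 3)) / (2 * (2 * x + 1) * (2 * x + 3)),
       (x + 3) / (2 * (2 * x + 1) * (2 * x + 3)),
       (x + 1) * (6 + 2 * x - x ^ 2) / (2 * (2 * x + 1) * (2 * x + 3)),
       x * (x + 1) / (2 * (2 * x + 1) * (2 * x + 3));
     0, 0, x * (x + 1) / (2 * (2 * x - 1) * (2 * x + 1)),
       -(x + 1) / (2 * (2 * x - 1) * (2 * x + 1)),
       x ^ 2 * (x + 1) / (2 * (2 * x - 1) * (2 * x + 1)),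
       -(x * (x + 1)) / (2 * (2 * x - 1) * (2 * x + 1));
     0, 0, (x - 1) * (2 - x) / (2 * (2 * x - 1) * (2 * x + 1)),
       (2 - x) / (2 * (2 * x - 1) * (2 * x + 1)),
       x * (x ^ 2 + 4 * x - 3) / (2 * (2 * x - 1) * (2 * x + 1)),
       x * (x + 1) / (2 * (2 * x - 1) * (2 * x + 1));
     0, 0, x * (x + 1) / (2 * (2 * x + 1) * (2 * x + 3)),
       x / (2 * (2 * x + 1) * (2 * x + 3)),
       -(x * (x + 1) ^ 2) / (2 * (2 * x + 1) * (2 * x + 3)),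
       -(x * (x + 1)) / (2 * (2 * x + 1) * (2 * x + 3))]

lemma rowR_mul_colR {x : ℝ} (hx : 1 ≤ x) : rowR x * colR x = 1 := by
  have h0 : x ≠ 0 := by linarith
  have h1 : x + 1 ≠ 0 := by linarith
  have h2 : x * 2 + 1 ≠ 0 := by linarith
  have h3 : x * 2 + 3 ≠ 0 := by linarith
  have h4 : x * 2 - 1 ≠ 0 := by linarith
  ext i j
  fin_cases i <;> fin_cases j <;>
    simp [rowR, colR, Matrix.mul_apply, Fin.sum_univ_six] <;> field_simp <;> ring

lemma genMat_mul_colR {k : ℕ} (hk : 1 ≤ k) :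
    genMat k * colR k = colR k * Matrix.diagonal (evR k) := by
  have h0 : (k : ℝ) ≠ 0 := by positivity
  have h1 : (k : ℝ) + 1 ≠ 0 := by positivity
  ext i j
  rw [Matrix.mul_diagonal]
  fin_cases i <;> fin_cases j <;>
    simp [genMat, evR, colR, Matrix.mul_apply, Fin.sum_univ_six] <;> field_simp <;> ring

/-- The eigenvalues of `L₀` on the components of degree `k`. -/
def ev (k : ℕ) : Fin 6 → ℤ :=
  if k = 0 then fun _ => -2 else ![k, -(k + 1), k + 1, k - 1, -k, -(k + 2)]

/-- The eigenvectors of `L₀` on the components of degree `k`. -/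
def colMat (k : ℕ) : Matrix (Fin 6) (Fin 6) ℝ := if k = 0 then 1 else colR k

/-- The left eigenvectors of `L₀` on the components of degree `k`. -/
def rowMat (k : ℕ) : Matrix (Fin 6) (Fin 6) ℝ := if k = 0 then 1 else rowR k

/-- The matrix of `L₀` on the components of degree `k` of elements of `X`. -/
def symb (k : ℕ) : Matrix (Fin 6) (Fin 6) ℝ := if k = 0 then (-2 : ℝ) • 1 else genMat k

lemma ev_cast {k : ℕ} (hk : k ≠ 0) (i : Fin 6) : (ev k i : ℝ) = evR k i := by
  rw [ev, if_neg hk]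
  fin_cases i <;> simp [evR]

lemma rowMat_mul_colMat (k : ℕ) : rowMat k * colMat k = 1 := by
  unfold rowMat colMat
  split_ifs with hk
  · exact mul_one 1
  · exact rowR_mul_colR (by exact_mod_cast Nat.one_le_iff_ne_zero.2 hk)

lemma colMat_mul_rowMat (k : ℕ) : colMat k * rowMat k = 1 :=
  mul_eq_one_comm.1 (rowMat_mul_colMat k)

lemma symb_mul_colMat (k : ℕ) :
    symb k * colMat k = colMat k * Matrix.diagonal fun i => (ev k i : ℝ) := by
  rcases eq_or_ne k 0 with rfl | hk
  · ext i j
    simp [symb, colMat, ev, Matrix.one_apply]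
  · have : (fun i => (ev k i : ℝ)) = evR k := funext (ev_cast hk)
    rw [this, symb, colMat, if_neg hk, if_neg hk]
    exact genMat_mul_colR (Nat.one_le_iff_ne_zero.2 hk)

lemma rowMat_mul_symb (k : ℕ) :
    rowMat k * symb k = (Matrix.diagonal fun i => (ev k i : ℝ)) * rowMat k := by
  calc _ = rowMat k * (symb k * colMat k) * rowMat k := by
        rw [mul_assoc, mul_assoc, colMat_mul_rowMat, mul_one]
    _ = _ := by rw [symb_mul_colMat, ← mul_assoc, rowMat_mul_colMat, one_mul]

open Classical in
/-- The exponential factors of `e^{L₀ s} P_S` on the components of degree `k`. -/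
def expDiag (S : Set ℤ) (s : ℝ) (k : ℕ) (i : Fin 6) : ℝ :=
  if ev k i ∈ S then Real.exp (ev k i * s) else 0

/-- The matrix of `e^{L₀ s} P_S` on the components of degree `k`. -/
def expMat (S : Set ℤ) (s : ℝ) (k : ℕ) : Matrix (Fin 6) (Fin 6) ℝ :=
  colMat k * Matrix.diagonal (expDiag S s k) * rowMat k

lemma expMat_mul_expMat (S : Set ℤ) (s t : ℝ) (k : ℕ) :
    expMat S s k * expMat S t k = expMat S (s + t) k := by
  have h : Matrix.diagonal (expDiag S s k) * Matrix.diagonal (expDiag S t k)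
      = Matrix.diagonal (expDiag S (s + t) k) := by
    rw [Matrix.diagonal_mul_diagonal]
    congr 1
    funext i
    unfold expDiag
    split_ifs
    · rw [← Real.exp_add, mul_add]
    · exact mul_zero 0
  calc _ = colMat k * Matrix.diagonal (expDiag S s k) * (rowMat k * colMat k)
        * Matrix.diagonal (expDiag S t k) * rowMat k := by
          simp only [expMat, mul_assoc]
    _ = _ := by rw [rowMat_mul_colMat, mul_one, mul_assoc (colMat k), h, expMat]

lemma expMat_apply (S : Set ℤ) (s : ℝ) (k : ℕ) (i j : Fin 6) :
    expMat S s k i j = ∑ l, colMat k i l * expDiag S s k l * rowMat k l j := by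
  rw [expMat, Matrix.mul_apply]
  simp only [Matrix.mul_diagonal]

lemma expMat_zero_apply (S : Set ℤ) (s : ℝ) {i j : Fin 6} (h : i ≠ j) : expMat S s 0 i j = 0 := by
  simp [expMat, colMat, rowMat, h]

/-! ### Uniform bounds -/

lemma abs_expMat_le {S : Set ℤ} {s c : ℝ} {k : ℕ}
    (h : ∀ m ∈ S, Real.exp (m * s) ≤ Real.exp (c * s)) (i j : Fin 6) :
    |expMat S s k i j| ≤ (∑ l, |colMat k i l| * |rowMat k l j|) * Real.exp (c * s) := by
  rw [expMat_apply, Finset.sum_mul]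
  refine (Finset.abs_sum_le_sum_abs _ _).trans (Finset.sum_le_sum fun l _ => ?_)
  have : |expDiag S s k l| ≤ Real.exp (c * s) := by
    unfold expDiag
    split_ifs with hl
    · rw [Real.abs_exp]
      exact h _ hl
    · simpa using (Real.exp_pos _).le
  rw [abs_mul, abs_mul, mul_right_comm]
  gcongr

/-- The matrices `M` are bounded by `B` in the norm given by the energy. -/
def EnergyBound (k : ℕ) (B : ℝ) (M : Matrix (Fin 6) (Fin 6) ℝ) : Prop :=
  ∀ i j, wt k ^ ord i * M i j ^ 2 ≤ B ^ 2 * wt k ^ ord j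

lemma wt_pos (k : ℕ) : 0 < wt k := by
  unfold wt
  split_ifs with hk
  · exact one_pos
  · have : (0 : ℝ) < k := by exact_mod_cast Nat.pos_of_ne_zero hk
    positivity

lemma one_le_wt (k : ℕ) : 1 ≤ wt k := by
  unfold wt
  split_ifs with hk
  · exact le_rfl
  · have : (1 : ℝ) ≤ k := by exact_mod_cast Nat.one_le_iff_ne_zero.2 hk
    nlinarith

lemma ord_le (i : Fin 6) : ord i ≤ 2 := by
  fin_cases i <;> simp [ord]

lemma energyBound_of_abs_le {k : ℕ} {B : ℝ} {M : Matrix (Fin 6) (Fin 6) ℝ} (h : ∀ i j, |M i j| ≤ B) :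
    EnergyBound k (wt k * B) M := by
  intro i j
  have hB : 0 ≤ B := (abs_nonneg _).trans (h 0 0)
  have h1 : wt k ^ ord i ≤ wt k ^ 2 := pow_le_pow_right₀ (one_le_wt k) (ord_le i)
  have h2 : M i j ^ 2 ≤ B ^ 2 := by
    rw [← sq_abs]
    exact pow_le_pow_left₀ (abs_nonneg _) (h i j) 2
  calc wt k ^ ord i * M i j ^ 2 ≤ wt k ^ 2 * B ^ 2 :=
        mul_le_mul h1 h2 (sq_nonneg _) (sq_nonneg _)
    _ = (wt k * B) ^ 2 * 1 := by ring
    _ ≤ _ := by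
        gcongr
        exact one_le_pow₀ (one_le_wt k)

/-- For k ≥ 1 the weight lies between k² and 2k², so powers of k can replace square roots of
weights. With orders at most 2 this loses at most 4 in the squares, hence the factor 2. -/
lemma energyBound_of_scaled {k : ℕ} (hk : k ≠ 0) {B : ℝ} {M : Matrix (Fin 6) (Fin 6) ℝ}
    (h : ∀ i j, |(k : ℝ) ^ ord i * M i j| ≤ B * k ^ ord j) : EnergyBound k (2 * B) M := by
  intro i j
  have hk1 : (1 : ℝ) ≤ k := by exact_mod_cast Nat.one_le_iff_ne_zero.2 hk
  have hw : wt k = k * (k + 1) := if_neg hk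
  have h1 : wt k ^ ord i ≤ 4 * (k : ℝ) ^ (2 * ord i) := by
    have : wt k ≤ 2 * (k : ℝ) ^ 2 := by rw [hw]; nlinarith
    calc wt k ^ ord i ≤ (2 * (k : ℝ) ^ 2) ^ ord i := pow_le_pow_left₀ (wt_nonneg k) this _
      _ = 2 ^ ord i * (k : ℝ) ^ (2 * ord i) := by rw [mul_pow, pow_mul]
      _ ≤ 2 ^ 2 * (k : ℝ) ^ (2 * ord i) := by
          gcongr
          · norm_num
          · exact ord_le i
      _ = _ := by norm_num
  have h2 : (k : ℝ) ^ (2 * ord j) ≤ wt k ^ ord j := by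
    rw [pow_mul]
    exact pow_le_pow_left₀ (by positivity) (by rw [hw]; nlinarith) _
  have h3 : ((k : ℝ) ^ ord i * M i j) ^ 2 ≤ (B * k ^ ord j) ^ 2 := by
    rw [← sq_abs]
    exact pow_le_pow_left₀ (abs_nonneg _) (h i j) 2
  calc wt k ^ ord i * M i j ^ 2 ≤ 4 * (k : ℝ) ^ (2 * ord i) * M i j ^ 2 := by gcongr
    _ = 4 * ((k : ℝ) ^ ord i * M i j) ^ 2 := by ring
    _ ≤ 4 * (B * k ^ ord j) ^ 2 := by gcongr
    _ = (2 * B) ^ 2 * k ^ (2 * ord j) := by ring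
    _ ≤ _ := by gcongr

lemma EnergyBound.mono {k : ℕ} {B B' : ℝ} {M : Matrix (Fin 6) (Fin 6) ℝ} (h : EnergyBound k B M)
    (hB : 0 ≤ B) (hBB' : B ≤ B') : EnergyBound k B' M := fun i j =>
  (h i j).trans (by have := wt_nonneg k; gcongr)

/-- The bound for low degrees. -/
lemma exists_low_bound (n : ℕ) : ∃ B, 0 ≤ B ∧ ∀ (S : Set ℤ) (s c : ℝ),
    (∀ m ∈ S, Real.exp (m * s) ≤ Real.exp (c * s)) → ∀ k < n,
      EnergyBound k (B * Real.exp (c * s)) (expMat S s k) := by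
  set b : ℕ → ℝ := fun k => ∑ i, ∑ j, ∑ l, |colMat k i l| * |rowMat k l j| with hb
  have hb0 : ∀ k, 0 ≤ b k := fun k => by positivity
  have hb1 : ∀ k, 0 ≤ wt k * b k := fun k => mul_nonneg (wt_nonneg k) (hb0 k)
  refine ⟨∑ k ∈ Finset.range n, wt k * b k, Finset.sum_nonneg fun k _ => hb1 k,
    fun S s c h k hk => ?_⟩
  refine (energyBound_of_abs_le (B := b k * Real.exp (c * s)) fun i j => ?_).mono
    (mul_nonneg (wt_nonneg k) (mul_nonneg (hb0 k) (Real.exp_pos _).le)) ?_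
  · refine (abs_expMat_le h i j).trans (mul_le_mul_of_nonneg_right ?_ (Real.exp_pos _).le)
    calc _ ≤ ∑ j, ∑ l, |colMat k i l| * |rowMat k l j| :=
          Finset.single_le_sum (f := fun j => ∑ l, |colMat k i l| * |rowMat k l j|)
            (fun _ _ => by positivity) (Finset.mem_univ j)
      _ ≤ _ := Finset.single_le_sum (f := fun i => ∑ j, ∑ l, |colMat k i l| * |rowMat k l j|)
            (fun _ _ => by positivity) (Finset.mem_univ i)
  · rw [← mul_assoc]
    refine mul_le_mul_of_nonneg_right ?_ (Real.exp_pos _).le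
    exact Finset.single_le_sum (f := fun k => wt k * b k) (fun k _ => hb1 k) (Finset.mem_range.2 hk)

/-- A factor x|t| is paid for by the gap a - c ≥ x/4 between the actual and the claimed exponent,
via y ≤ e^y. -/
lemma mul_exp_le {x a c t : ℝ} (ht : t ≤ 0) (h : x ≤ 4 * (a - c)) :
    x * (-t) * Real.exp (a * t) ≤ 4 * Real.exp (c * t) := by
  have h1 : (a - c) * (-t) ≤ Real.exp (-((a - c) * t)) := by
    have := Real.add_one_le_exp (-((a - c) * t))
    linarith
  have h2 : x * (-t) ≤ 4 * Real.exp (-((a - c) * t)) := by nlinarith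
  calc x * (-t) * Real.exp (a * t) ≤ 4 * Real.exp (-((a - c) * t)) * Real.exp (a * t) := by
        gcongr
    _ = 4 * Real.exp (c * t) := by
        rw [mul_assoc, ← Real.exp_add]
        ring_nf

/-- Two rank one terms with almost opposite coefficients and exponents at distance two. -/
lemma abs_pair_le {x a c t C r q p m P Q : ℝ} (ht : t ≤ 0) (hx : 0 < x) (h : x ≤ 4 * (a - c))
    (hp : |r * p| ≤ C * x ^ 2) (hpm : |r * (p - m)| ≤ C * x)
    (hP : x * |P| ≤ C * q) (hQ : x * |Q| ≤ C * q) (hPQ : x ^ 2 * |P + Q| ≤ C * q) :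
    |r * (p * Real.exp ((a + 2) * t) * P + m * Real.exp (a * t) * Q)|
      ≤ 10 * C ^ 2 * q * Real.exp (c * t) := by
  have hac : c < a := by linarith
  have hC : 0 ≤ C := by
    have := (abs_nonneg _).trans hpm
    by_contra hC
    nlinarith
  have hq : 0 ≤ C * q := le_trans (by positivity) hP
  have hac' : Real.exp (a * t) ≤ Real.exp (c * t) := Real.exp_le_exp.2 (by nlinarith)
  have he := Real.exp_pos (a * t)
  have hd : |Real.exp ((a + 2) * t) - Real.exp (a * t)| ≤ 2 * (-t) * Real.exp (a * t) := by
    have h1 : Real.exp ((a + 2) * t) = Real.exp (2 * t) * Real.exp (a * t) := by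
      rw [← Real.exp_add]
      ring_nf
    have h2 := Real.add_one_le_exp (2 * t)
    have h3 : Real.exp (2 * t) ≤ 1 := Real.exp_le_one_iff.2 (by linarith)
    rw [h1, abs_le]
    constructor <;> nlinarith
  -- Each of the three terms contains one small quantity: P + Q, the difference of the exponentials,
  -- or p - m. The middle one is where `mul_exp_le` enters; the constants add up to 1 + 8 + 1 = 10.
  have e : r * (p * Real.exp ((a + 2) * t) * P + m * Real.exp (a * t) * Q)
      = r * p * (P + Q) * Real.exp (a * t)
        + r * p * P * (Real.exp ((a + 2) * t) - Real.exp (a * t))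
        - r * (p - m) * Q * Real.exp (a * t) := by ring
  have t1 : |r * p * (P + Q) * Real.exp (a * t)| ≤ C ^ 2 * q * Real.exp (c * t) := by
    rw [abs_mul, abs_mul, Real.abs_exp]
    calc _ ≤ C * x ^ 2 * |P + Q| * Real.exp (c * t) := by gcongr
      _ = C * (x ^ 2 * |P + Q|) * Real.exp (c * t) := by ring
      _ ≤ C * (C * q) * Real.exp (c * t) := by gcongr
      _ = _ := by ring
  have t2 : |r * p * P * (Real.exp ((a + 2) * t) - Real.exp (a * t))|
      ≤ 8 * C ^ 2 * q * Real.exp (c * t) := by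
    rw [abs_mul, abs_mul]
    calc _ ≤ C * x ^ 2 * |P| * (2 * (-t) * Real.exp (a * t)) := by gcongr
      _ = 2 * C * (x * |P|) * (x * (-t) * Real.exp (a * t)) := by ring
      _ ≤ 2 * C * (C * q) * (4 * Real.exp (c * t)) := by
          refine mul_le_mul (mul_le_mul_of_nonneg_left hP (by positivity)) (mul_exp_le ht h) ?_
            (by positivity)
          have : 0 ≤ -t := by linarith
          positivity
      _ = _ := by ring
  have t3 : |r * (p - m) * Q * Real.exp (a * t)| ≤ C ^ 2 * q * Real.exp (c * t) := by
    rw [abs_mul, abs_mul, Real.abs_exp]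
    calc _ ≤ C * x * |Q| * Real.exp (c * t) := by gcongr
      _ = C * (x * |Q|) * Real.exp (c * t) := by ring
      _ ≤ C * (C * q) * Real.exp (c * t) := by gcongr
      _ = _ := by ring
  rw [e]
  have s1 := abs_sub (r * p * (P + Q) * Real.exp (a * t)
        + r * p * P * (Real.exp ((a + 2) * t) - Real.exp (a * t)))
        (r * (p - m) * Q * Real.exp (a * t))
  have s2 := abs_add_le (r * p * (P + Q) * Real.exp (a * t))
        (r * p * P * (Real.exp ((a + 2) * t) - Real.exp (a * t)))
  linarith

/-! ### Sizes of the right and left eigenvectors -/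

lemma mul_abs_div_le {y a b c : ℝ} (hb : 0 < b) (h1 : -(c * b) ≤ y * a) (h2 : y * a ≤ c * b)
    (hy : 0 < y) : y * |a / b| ≤ c := by
  rw [abs_div, abs_of_pos hb, ← mul_div_assoc, div_le_iff₀ hb]
  refine le_trans (le_of_eq ?_) (abs_le.2 ⟨h1, h2⟩)
  rw [abs_mul, abs_of_pos hy]

lemma mul_abs_le {y a c : ℝ} (h1 : -c ≤ y * a) (h2 : y * a ≤ c) (hy : 0 < y) : y * |a| ≤ c := by
  simpa using mul_abs_div_le one_pos (by simpa using h1) (by simpa using h2) hy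

lemma abs_colR_le {x : ℝ} (hx : 4 ≤ x) (i l : Fin 6) : x ^ ord i * |colR x i l| ≤ 6 * x ^ 2 := by
  -- In y = x - 4 ≥ 0 the inequalities, cleared of denominators, become polynomials with nonnegative
  -- coefficients, which `positivity` recognises. The later estimates use the same shift.
  obtain ⟨y, rfl⟩ : ∃ y, x = y + 4 := ⟨x - 4, by ring⟩
  have hy : 0 ≤ y := by linarith
  fin_cases i <;> fin_cases l <;>
    simp only [colR, ord, Matrix.of_apply, Matrix.cons_val, Fin.reduceFinMk, Fin.zero_eta,
      Fin.mk_one, abs_zero, mul_zero, Fin.isValue] <;>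
    first
    | positivity
    | (refine mul_abs_div_le (by positivity) ?_ ?_ (by positivity) <;>
      (rw [← sub_nonneg]; ring_nf; positivity))
    | (refine mul_abs_le ?_ ?_ (by positivity) <;> (rw [← sub_nonneg]; ring_nf; positivity))

/-- In the curl block the right eigenvectors are only of size x, which balances the 1/x of the left
ones; no cancellation is needed there. -/
lemma abs_colR_curl_le {x : ℝ} (hx : 4 ≤ x) (i : Fin 6) :
    x ^ ord i * |colR x i 0| ≤ 6 * x ∧ x ^ ord i * |colR x i 1| ≤ 6 * x := by
  obtain ⟨y, rfl⟩ : ∃ y, x = y + 4 := ⟨x - 4, by ring⟩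
  have hy : 0 ≤ y := by linarith
  fin_cases i <;>
    simp only [colR, ord, Matrix.of_apply, Matrix.cons_val, Fin.reduceFinMk, Fin.zero_eta,
      Fin.mk_one, abs_zero, mul_zero, Fin.isValue] <;> constructor <;>
    first
    | positivity
    | (refine mul_abs_le ?_ ?_ (by positivity) <;> (rw [← sub_nonneg]; ring_nf; positivity))

/-- Right eigenvectors of size x² whose eigenvalues differ by two agree to leading order: one power
of x is gained. -/
lemma abs_colR_sub_le {x : ℝ} (hx : 4 ≤ x) (i : Fin 6) :
    x ^ ord i * |colR x i 2 - colR x i 3| ≤ 6 * x ∧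
    x ^ ord i * |colR x i 5 - colR x i 4| ≤ 6 * x := by
  have e1 : colR x i 2 - colR x i 3 = ![0, 0, -2, 4 * x - 2, 0, (2 * x - 4) / (x + 1)] i := by
    have : x + 1 ≠ 0 := by linarith
    fin_cases i <;> simp [colR] <;> field_simp <;> ring
  have e2 : colR x i 5 - colR x i 4 = ![0, 0, 2, 4 * x + 6, 0, -(2 * x + 6) / x] i := by
    have : x ≠ 0 := by linarith
    fin_cases i <;> simp [colR] <;> field_simp <;> ring
  rw [e1, e2]
  obtain ⟨y, rfl⟩ : ∃ y, x = y + 4 := ⟨x - 4, by ring⟩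
  have hy : 0 ≤ y := by linarith
  fin_cases i <;>
    simp only [ord, Matrix.cons_val, Fin.reduceFinMk, Fin.zero_eta,
      Fin.mk_one, abs_zero, mul_zero, Fin.isValue] <;> constructor <;>
    first
    | positivity
    | (refine mul_abs_div_le (by positivity) ?_ ?_ (by positivity) <;>
      (rw [← sub_nonneg]; ring_nf; positivity))
    | (refine mul_abs_le ?_ ?_ (by positivity) <;> (rw [← sub_nonneg]; ring_nf; positivity))

lemma abs_rowR_le {x : ℝ} (hx : 4 ≤ x) (l j : Fin 6) : x * |rowR x l j| ≤ 6 * x ^ ord j := by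
  obtain ⟨y, rfl⟩ : ∃ y, x = y + 4 := ⟨x - 4, by ring⟩
  have hy : 0 ≤ y := by linarith
  fin_cases l <;> fin_cases j <;>
    simp only [rowR, ord, Matrix.of_apply, Matrix.cons_val, Fin.reduceFinMk, Fin.zero_eta, Fin.mk_one,
      abs_zero, mul_zero, Fin.isValue] <;>
    first
    | positivity
    | (refine mul_abs_div_le (by nlinarith) ?_ ?_ (by positivity) <;>
      (rw [← sub_nonneg]; ring_nf; positivity))

/-- The dual statement: the left eigenvectors of such a pair are opposite to leading order, which
gains one more power of 1/x over `abs_rowR_le`. -/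
lemma abs_rowR_add_le {x : ℝ} (hx : 4 ≤ x) (j : Fin 6) :
    x ^ 2 * |rowR x 2 j + rowR x 3 j| ≤ 6 * x ^ ord j ∧
    x ^ 2 * |rowR x 5 j + rowR x 4 j| ≤ 6 * x ^ ord j := by
  have h2 : x * 2 + 1 ≠ 0 := by linarith
  have h3 : x * 2 + 3 ≠ 0 := by linarith
  have h4 : x * 2 - 1 ≠ 0 := by linarith
  have e1 : rowR x 2 j + rowR x 3 j = ![0, 0, -4 * x ^ 2 - 4 * x + 6, -6,
      (x + 1) * (8 * x ^ 2 + 10 * x - 6), -4 * x * (x + 1)] j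
        / (2 * (2 * x + 1) * (2 * x + 3) * (2 * x - 1)) := by
    fin_cases j <;> simp [rowR] <;> field_simp <;> ring
  have e2 : rowR x 5 j + rowR x 4 j = ![0, 0, 4 * x ^ 2 + 4 * x - 6, 6,
      x * (8 * x ^ 2 + 6 * x - 8), 4 * x * (x + 1)] j
        / (2 * (2 * x + 1) * (2 * x + 3) * (2 * x - 1)) := by
    fin_cases j <;> simp [rowR] <;> field_simp <;> ring
  rw [e1, e2]
  have hD : 0 < 2 * (2 * x + 1) * (2 * x + 3) * (2 * x - 1) :=
    mul_pos (by positivity) (by linarith)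
  obtain ⟨y, rfl⟩ : ∃ y, x = y + 4 := ⟨x - 4, by ring⟩
  have hy : 0 ≤ y := by linarith
  constructor <;> refine mul_abs_div_le hD ?_ ?_ (by positivity) <;> fin_cases j <;>
    simp only [ord, Matrix.cons_val, Fin.reduceFinMk, Fin.zero_eta,
      Fin.mk_one, mul_zero, Fin.isValue] <;>
    (rw [← sub_nonneg]; ring_nf; positivity)

lemma abs_single_le {x a c t C r q p P : ℝ} (h : a * t ≤ c * t)
    (hp : |r * p| ≤ C * x) (hP : x * |P| ≤ C * q) (hC : 0 ≤ C) :
    |r * (p * Real.exp (a * t) * P)| ≤ C ^ 2 * q * Real.exp (c * t) := by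
  have e : r * (p * Real.exp (a * t) * P) = r * p * P * Real.exp (a * t) := by ring
  have hCx : 0 ≤ C * x := (abs_nonneg _).trans hp
  rw [e, abs_mul, abs_mul, Real.abs_exp]
  calc _ ≤ C * x * |P| * Real.exp (c * t) := by gcongr
    _ = C * (x * |P|) * Real.exp (c * t) := by ring
    _ ≤ C * (C * q) * Real.exp (c * t) := by gcongr
    _ = _ := by ring

/-- In these degrees the pair k+1, k-1 lies wholly inside S and the pair -k, -(k+2) wholly outside.
The exponent k - 1 + 2 is left unsimplified to fit `abs_pair_le`. -/
lemma expDiag_Ici {k : ℕ} (hk : 4 ≤ k) (s : ℝ) : expDiag (Set.Ici 2) s k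
    = ![Real.exp (k * s), 0, Real.exp ((k - 1 + 2) * s), Real.exp ((k - 1) * s), 0, 0] := by
  have hk0 : k ≠ 0 := by omega
  have hk1 : (2 : ℤ) ≤ k + 1 := by omega
  funext i
  fin_cases i <;> simp [expDiag, ev, hk0, hk1] <;> first | omega | (left; ring)

lemma expDiag_Iic {k : ℕ} (hk : 4 ≤ k) (s : ℝ) : expDiag (Set.Iic (-1)) s k
    = ![0, Real.exp ((k + 1) * -s), 0, 0, Real.exp (k * -s), Real.exp ((k + 2) * -s)] := by
  have hk0 : k ≠ 0 := by omega
  funext i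
  fin_cases i <;> simp [expDiag, ev, hk0] <;> first | omega | ring_nf

lemma expMat_eq_zero {k : ℕ} (hk : 4 ≤ k) (s : ℝ) {m : ℤ} (hm : m = 0 ∨ m = 1) :
    expMat {m} s k = 0 := by
  have hk0 : k ≠ 0 := by omega
  have : expDiag {m} s k = 0 := by
    funext i
    fin_cases i <;> simp [expDiag, ev, hk0] <;> omega
  simp [expMat, this]

/-- The constant is 396 = 6² + 10·6²: one curl eigenvalue and one pair, with entrywise constant 6.
The outer 2 is that of `energyBound_of_scaled`. -/
lemma energyBound_Ici {k : ℕ} (hk : 4 ≤ k) {s : ℝ} (hs : s ≤ 0) :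
    EnergyBound k (2 * (396 * Real.exp (2 * s))) (expMat (Set.Ici 2) s k) := by
  have hk0 : k ≠ 0 := by omega
  have hx : (4 : ℝ) ≤ k := by exact_mod_cast hk
  refine energyBound_of_scaled hk0 fun i j => ?_
  have hr : ∀ p : ℝ, |(k : ℝ) ^ ord i * p| = (k : ℝ) ^ ord i * |p| := fun p => by
    rw [abs_mul, abs_of_nonneg (by positivity)]
  have b1 := abs_single_le (a := k) (c := 2) (t := s) (by nlinarith)
    ((hr _).trans_le (abs_colR_curl_le hx i).1) (abs_rowR_le hx 0 j) (by norm_num)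
  -- The gap condition k ≤ 4((k - 1) - 2) is exactly k ≥ 4; this fixes the threshold between low and
  -- high degrees.
  have b2 := abs_pair_le (a := k - 1) (c := 2) (t := s) hs (by linarith) (by linarith)
    ((hr _).trans_le (abs_colR_le hx i 2)) ((hr _).trans_le (abs_colR_sub_le hx i).1)
    (abs_rowR_le hx 2 j) (abs_rowR_le hx 3 j) (abs_rowR_add_le hx j).1
  rw [expMat_apply, expDiag_Ici hk, Fin.sum_univ_six, colMat, rowMat, if_neg hk0, if_neg hk0]
  simp only [Matrix.cons_val, mul_zero, zero_mul, add_zero]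
  rw [add_assoc, mul_add]
  refine (abs_add_le _ _).trans ((add_le_add b1 b2).trans (le_of_eq ?_))
  ring

lemma energyBound_Iic {k : ℕ} (hk : 4 ≤ k) {s : ℝ} (hs : 0 ≤ s) :
    EnergyBound k (2 * (396 * Real.exp (-1 * s))) (expMat (Set.Iic (-1)) s k) := by
  have hk0 : k ≠ 0 := by omega
  have hx : (4 : ℝ) ≤ k := by exact_mod_cast hk
  refine energyBound_of_scaled hk0 fun i j => ?_
  have hr : ∀ p : ℝ, |(k : ℝ) ^ ord i * p| = (k : ℝ) ^ ord i * |p| := fun p => by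
    rw [abs_mul, abs_of_nonneg (by positivity)]
  have b1 := abs_single_le (a := k + 1) (c := 1) (t := -s) (by nlinarith)
    ((hr _).trans_le (abs_colR_curl_le hx i).2) (abs_rowR_le hx 1 j) (by norm_num)
  -- With t = -s the exponents become k + 2 and k, so column 5 takes the part of the larger exponent
  -- and column 4 that of the smaller.
  have b2 := abs_pair_le (a := k) (c := 1) (t := -s) (by linarith) (by linarith) (by linarith)
    ((hr _).trans_le (abs_colR_le hx i 5)) ((hr _).trans_le (abs_colR_sub_le hx i).2)
    (abs_rowR_le hx 5 j) (abs_rowR_le hx 4 j) (abs_rowR_add_le hx j).2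
  rw [expMat_apply, expDiag_Iic hk, Fin.sum_univ_six, colMat, rowMat, if_neg hk0, if_neg hk0]
  simp only [Matrix.cons_val, mul_zero, zero_mul, add_zero, zero_add]
  rw [add_assoc, add_comm (colR k i 4 * _ * _), mul_add]
  refine (abs_add_le _ _).trans ((add_le_add b1 b2).trans (le_of_eq ?_))
  ring_nf

/-- The uniform bound for all degrees, from that for high degrees. -/
lemma exists_bound_of_high {S : Set ℤ} {J : Set ℝ} {c B : ℝ} (hB : 0 ≤ B)
    (h : ∀ m ∈ S, ∀ s ∈ J, Real.exp (m * s) ≤ Real.exp (c * s))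
    (hk : ∀ k, 4 ≤ k → ∀ s ∈ J, EnergyBound k (B * Real.exp (c * s)) (expMat S s k)) :
    ∃ C, 0 ≤ C ∧ ∀ s ∈ J, ∀ k, EnergyBound k (C * Real.exp (c * s)) (expMat S s k) := by
  obtain ⟨B', hB', h'⟩ := exists_low_bound 4
  refine ⟨B + B', by positivity, fun s hs k => ?_⟩
  rcases lt_or_ge k 4 with h4 | h4
  · exact (h' S s c (fun m hm => h m hm s hs) k h4).mono (by positivity)
      (mul_le_mul_of_nonneg_right (by linarith) (Real.exp_pos _).le)
  · exact (hk k h4 s hs).mono (by positivity)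
      (mul_le_mul_of_nonneg_right (by linarith) (Real.exp_pos _).le)

lemma exists_bound_Ici : ∃ C, 0 ≤ C ∧ ∀ s ≤ 0, ∀ k,
    EnergyBound k (C * Real.exp (2 * s)) (expMat (Set.Ici 2) s k) := by
  refine exists_bound_of_high (J := Set.Iic 0) (B := 2 * 396) (by norm_num)
    (fun m hm s hs => Real.exp_le_exp.2 ?_) fun k hk s hs => by
      simpa only [mul_assoc] using energyBound_Ici hk hs
  have : (2 : ℝ) ≤ m := by exact_mod_cast hm
  exact mul_le_mul_of_nonpos_right this hs

lemma exists_bound_Iic : ∃ C, 0 ≤ C ∧ ∀ s ≥ 0, ∀ k,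
    EnergyBound k (C * Real.exp (-1 * s)) (expMat (Set.Iic (-1)) s k) := by
  refine exists_bound_of_high (J := Set.Ici 0) (B := 2 * 396) (by norm_num)
    (fun m hm s hs => Real.exp_le_exp.2 ?_) fun k hk s hs => by
      simpa only [mul_assoc] using energyBound_Iic hk hs
  have : (m : ℝ) ≤ -1 := by exact_mod_cast hm
  exact mul_le_mul_of_nonneg_right this hs

lemma exists_bound_singleton {m : ℤ} (hm : m = 0 ∨ m = 1) :
    ∃ C, 0 ≤ C ∧ ∀ k, EnergyBound k C (expMat {m} 0 k) := by
  -- B = 0 suffices for high degrees, since neither 0 nor 1 is an eigenvalue there.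
  obtain ⟨C, hC, h⟩ := exists_bound_of_high (S := {m}) (J := {0}) (c := 0) (B := 0) le_rfl
    (fun _ _ s hs => by simp [Set.mem_singleton_iff.1 hs]) fun k hk s hs i j => by
      rw [expMat_eq_zero hk s hm]
      simp
  exact ⟨C, hC, fun k => by simpa using h 0 rfl k⟩

/-! ### Multiplier operators -/

/-- 36 = 6·6: Cauchy–Schwarz over the six columns, then the sum over the six rows. -/
lemma energy_mulV_le {k : ℕ} {B : ℝ} {M : Matrix (Fin 6) (Fin 6) ℝ} (h : EnergyBound k B M)
    (v : Fin 6 → Fun2) : energy k (mulV M v) ≤ 36 * B ^ 2 * energy k v := by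
  have h1 : ∀ i, wt k ^ ord i * ‖mulV M v i‖ ^ 2 ≤ 6 * B ^ 2 * energy k v := fun i => by
    have hn : ‖mulV M v i‖ ≤ ∑ j, |M i j| * ‖v j‖ := by
      refine (norm_sum_le _ _).trans (le_of_eq (Finset.sum_congr rfl fun j _ => ?_))
      rw [norm_smul, Complex.norm_real, Real.norm_eq_abs]
    have hs : (∑ j, |M i j| * ‖v j‖) ^ 2 ≤ 6 * ∑ j, (|M i j| * ‖v j‖) ^ 2 := by
      simpa using sq_sum_le_card_mul_sum_sq (s := (Finset.univ : Finset (Fin 6)))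
        (f := fun j => |M i j| * ‖v j‖)
    calc wt k ^ ord i * ‖mulV M v i‖ ^ 2
        ≤ wt k ^ ord i * (6 * ∑ j, (|M i j| * ‖v j‖) ^ 2) := by
          have := wt_nonneg k
          gcongr
          exact (pow_le_pow_left₀ (norm_nonneg _) hn 2).trans hs
      _ = 6 * ∑ j, wt k ^ ord i * M i j ^ 2 * ‖v j‖ ^ 2 := by
          rw [mul_left_comm, Finset.mul_sum]
          simp only [mul_pow, sq_abs, mul_assoc]
      _ ≤ 6 * ∑ j, B ^ 2 * wt k ^ ord j * ‖v j‖ ^ 2 := by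
          refine mul_le_mul_of_nonneg_left (Finset.sum_le_sum fun j _ => ?_) (by norm_num)
          exact mul_le_mul_of_nonneg_right (h i j) (sq_nonneg _)
      _ = _ := by
          rw [energy, mul_assoc, Finset.mul_sum (a := B ^ 2)]
          simp only [mul_assoc]
  calc energy k (mulV M v) ≤ ∑ _i : Fin 6, 6 * B ^ 2 * energy k v :=
        Finset.sum_le_sum fun i _ => h1 i
    _ = _ := by simp; ring

lemma energy_sub_le (k : ℕ) (v w : Fin 6 → Fun2) :
    energy k (v - w) ≤ 2 * energy k v + 2 * energy k w := by
  simp only [energy, Finset.mul_sum, ← Finset.sum_add_distrib]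
  refine Finset.sum_le_sum fun i _ => ?_
  have h := norm_sub_le (v i) (w i)
  have h2 : ‖v i - w i‖ ^ 2 ≤ 2 * ‖v i‖ ^ 2 + 2 * ‖w i‖ ^ 2 := by
    nlinarith [norm_nonneg (v i - w i), sq_nonneg (‖v i‖ - ‖w i‖)]
  calc _ ≤ wt k ^ ord i * (2 * ‖v i‖ ^ 2 + 2 * ‖w i‖ ^ 2) :=
        mul_le_mul_of_nonneg_left h2 (pow_nonneg (wt_nonneg k) _)
    _ = _ := by ring

lemma normX_sub_sq_le (Ξ Θ : X) : normX (Ξ - Θ) ^ 2 ≤ 2 * normX Ξ ^ 2 + 2 * normX Θ ^ 2 := by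
  refine hasSum_le (fun k => ?_) (hasSum_energy (Ξ - Θ))
    (((hasSum_energy Ξ).mul_left 2).add ((hasSum_energy Θ).mul_left 2))
  rw [mode_sub]
  exact energy_sub_le k _ _

lemma energy_mode_le (Ξ : X) (k : ℕ) : energy k (mode Ξ k) ≤ normX Ξ ^ 2 :=
  le_hasSum (hasSum_energy Ξ) k fun j _ => energy_nonneg j _

lemma eq_zero_of_energy {k : ℕ} {v : Fin 6 → Fun2} (h : energy k v ≤ 0) : v = 0 := by
  have h0 : energy k v = 0 := le_antisymm h (energy_nonneg k v)
  funext i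
  have := (Finset.sum_eq_zero_iff_of_nonneg fun i _ =>
    mul_nonneg (pow_nonneg (wt_nonneg k) (ord i)) (sq_nonneg ‖v i‖)).1 h0 i (Finset.mem_univ i)
  simpa [(wt_pos k).ne'] using this

lemma mode_zero (k : ℕ) : mode 0 k = 0 := by
  funext i
  simp [mode]

lemma eq_zero_of_normX {Ξ : X} (h : normX Ξ ≤ 0) : Ξ = 0 := by
  have h0 : normX Ξ = 0 := le_antisymm h (normX_nonneg Ξ)
  refine mode_ext fun k => ?_
  rw [mode_zero]
  refine eq_zero_of_energy ((energy_mode_le Ξ k).trans ?_)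
  rw [h0]
  norm_num

lemma mode_mem (Ξ : X) (k : ℕ) (i : Fin 6) : mode Ξ k i ∈ Y k := harm_mem k _

lemma mode_zero_eq (Ξ : X) {i : Fin 6} (hi : i ≠ 5) : mode Ξ 0 i = 0 := harm_zero_coord Ξ hi

/-- The operator acting by the matrix `M k` on the components of degree `k`. -/
lemma exists_multiplier {M : ℕ → Matrix (Fin 6) (Fin 6) ℝ} {B : ℝ} (hB : 0 ≤ B)
    (h : ∀ k, EnergyBound k B (M k)) (h0 : ∀ i, i ≠ 5 → M 0 i 5 = 0) :
    ∃ T : X →ₗ[ℂ] X, (∀ Ξ k, mode (T Ξ) k = mulV (M k) (mode Ξ k)) ∧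
      ∀ Ξ, normX (T Ξ) ≤ 6 * B * normX Ξ := by
  have hle : ∀ Ξ k, energy k (mulV (M k) (mode Ξ k)) ≤ 36 * B ^ 2 * energy k (mode Ξ k) :=
    fun Ξ k => energy_mulV_le (h k) _
  have hex : ∀ Ξ : X, ∃ Θ : X, ∀ k, mode Θ k = mulV (M k) (mode Ξ k) := fun Ξ => by
    refine exists_mode (fun k i => mulV_mem _ (mode_mem Ξ k) i)
      (Summable.of_nonneg_of_le (fun k => energy_nonneg k _) (hle Ξ)
        ((hasSum_energy Ξ).summable.mul_left _)) fun i hi => ?_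
    -- In degree 0 the input lives in coordinate 5 alone, so `h0` on that column keeps the output in
    -- X.
    refine Finset.sum_eq_zero fun j _ => ?_
    rcases eq_or_ne j 5 with rfl | hj
    · rw [h0 i hi, Complex.ofReal_zero, zero_smul]
    · rw [mode_zero_eq Ξ hj, smul_zero]
  choose T hT using hex
  refine ⟨⟨⟨T, fun Ξ Θ => mode_ext fun k => ?_⟩, fun c Ξ => mode_ext fun k => ?_⟩, hT, fun Ξ => ?_⟩
  · rw [hT, mode_add, mode_add, mulV_add, hT, hT]
  · simp only [RingHom.id_apply]
    rw [hT, mode_smul, mode_smul, mulV_smul, hT]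
  · refine abs_le_of_sq_le_sq' ?_ (mul_nonneg (by positivity) (normX_nonneg Ξ)) |>.2
    have h1 := hasSum_energy (T Ξ)
    simp only [hT] at h1
    calc normX (T Ξ) ^ 2 ≤ 36 * B ^ 2 * normX Ξ ^ 2 :=
          hasSum_le (hle Ξ) h1 ((hasSum_energy Ξ).mul_left _)
      _ = _ := by ring

/-! ### Eigenspaces -/

/-- The formulas for the eigenvectors degenerate at k = 0. There only ϑ^∗ is present, and on it
`genMat 0` is multiplication by -2, so a scalar matrix may replace it and all six eigenvalues may be
declared to be -2. -/
lemma mulV_symb {k : ℕ} {v : Fin 6 → Fun2} (h0 : k = 0 → ∀ i, i ≠ 5 → v i = 0) :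
    mulV (genMat k) v = mulV (symb k) v := by
  unfold symb
  split_ifs with hk
  · subst hk
    have h := h0 rfl
    funext i
    simp only [mulV]
    refine Finset.sum_congr rfl fun j _ => ?_
    rcases eq_or_ne j 5 with rfl | hj
    · fin_cases i <;> simp [genMat]
    · rw [h j hj, smul_zero, smul_zero]
  · rfl

lemma mulV_diagonal (d : Fin 6 → ℝ) (v : Fin 6 → Fun2) (i : Fin 6) :
    mulV (Matrix.diagonal d) v i = (d i : ℂ) • v i := by
  unfold mulV
  rw [Finset.sum_eq_single i]
  · rw [Matrix.diagonal_apply_eq]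
  · intro j _ hj
    rw [Matrix.diagonal_apply_ne' _ hj, Complex.ofReal_zero, zero_smul]
  · simp

lemma InE.symb_mode {m : ℤ} {Ξ : X} (h : InE m Ξ) (k : ℕ) :
    mulV (symb k) (mode Ξ k) = (m : ℂ) • mode Ξ k := by
  rw [← mulV_symb, ← IsL0.mode_eq h, mode_smul]
  rintro rfl i hi
  exact mode_zero_eq Ξ hi

-- Applying the left eigenvectors to the eigenvalue equation shows that `mulV (rowMat k) v` is
-- supported on indices l with `ev k l = m`; on these the diagonal factor is one and the same
-- scalar.
open Classical in
lemma mulV_expMat_eigen {S : Set ℤ} {s : ℝ} {m : ℤ} {k : ℕ} {v : Fin 6 → Fun2}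
    (h : mulV (symb k) v = (m : ℂ) • v) :
    mulV (expMat S s k) v = if m ∈ S then (Real.exp (m * s) : ℂ) • v else 0 := by
  have h1 : ∀ i, (ev k i : ℂ) • mulV (rowMat k) v i = (m : ℂ) • mulV (rowMat k) v i := fun i => by
    have := congrFun (congrArg (mulV (rowMat k)) h) i
    rw [mulV_mulV, rowMat_mul_symb, ← mulV_mulV, mulV_diagonal, mulV_smul] at this
    simpa using this
  have h2 : mulV (Matrix.diagonal (expDiag S s k)) (mulV (rowMat k) v)
      = ((if m ∈ S then Real.exp (m * s) else 0 : ℝ) : ℂ) • mulV (rowMat k) v := by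
    funext i
    rw [mulV_diagonal, Pi.smul_apply]
    rcases eq_or_ne (mulV (rowMat k) v i) 0 with h0 | h0
    · rw [h0, smul_zero, smul_zero]
    · have : ev k i = m := by exact_mod_cast smul_left_injective ℂ h0 (h1 i)
      rw [expDiag, this]
  rw [expMat, ← mulV_mulV, ← mulV_mulV, h2, mulV_smul, mulV_mulV, colMat_mul_rowMat, mulV_one]
  split_ifs
  · rfl
  · rw [Complex.ofReal_zero, zero_smul]

lemma exists_expProj {S : Set ℤ} {s B : ℝ} (hB : 0 ≤ B)
    (h : ∀ k, EnergyBound k B (expMat S s k)) :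
    ∃ T : X →ₗ[ℂ] X, (∀ Ξ k, mode (T Ξ) k = mulV (expMat S s k) (mode Ξ k)) ∧
      (∀ Ξ, normX (T Ξ) ≤ 6 * B * normX Ξ) ∧ IsExpProj S s T := by
  obtain ⟨T, hT, hTB⟩ := exists_multiplier hB h fun i hi => expMat_zero_apply S s hi
  refine ⟨T, hT, hTB, ⟨_, hTB⟩, fun m Ξ hΞ => mode_ext fun k => ?_⟩
  rw [hT, mulV_expMat_eigen (hΞ.symb_mode k)]
  split_ifs
  · rw [mode_smul]
  · rw [mode_zero]

/-! ### Uniqueness -/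

/-- The element of `X` with a single component, of degree `k`. -/
lemma exists_single {k : ℕ} {v : Fin 6 → Fun2} (hv : ∀ i, v i ∈ Y k)
    (h0 : k = 0 → ∀ i, i ≠ 5 → v i = 0) : ∃ Ξ, coord Ξ = v := by
  refine exists_coord (fun i => mem_Hs_of_mem_Y (hv i) _) fun i hi => ?_
  rcases eq_or_ne k 0 with hk | hk
  · rw [h0 hk i hi, map_zero]
  · exact harm_of_mem_ne hk.symm (hv i)

lemma mode_single {k : ℕ} {Ξ : X} (h : ∀ i, coord Ξ i ∈ Y k) (j : ℕ) :
    mode Ξ j = if j = k then coord Ξ else 0 := by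
  funext i
  split_ifs with hj
  · subst hj
    exact harm_of_mem (h i)
  · exact harm_of_mem_ne hj (h i)

lemma mulV_symb_eigen (k : ℕ) (l : Fin 6) (f : Fun2) :
    mulV (symb k) (mulV (colMat k) (Pi.single l f))
      = (ev k l : ℂ) • mulV (colMat k) (Pi.single l f) := by
  rw [mulV_mulV, symb_mul_colMat, ← mulV_mulV, ← mulV_smul]
  congr 1
  funext i
  rw [mulV_diagonal, Pi.smul_apply]
  rcases eq_or_ne i l with rfl | hil
  · push_cast
    rfl
  · rw [Pi.single_eq_of_ne hil, smul_zero, smul_zero]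

lemma mulV_eq_sum_single (M : Matrix (Fin 6) (Fin 6) ℝ) (u : Fin 6 → Fun2) :
    mulV M u = ∑ l, mulV M (Pi.single l (u l)) := by
  funext i
  simp only [mulV, Finset.sum_apply]
  rw [Finset.sum_comm]
  refine Finset.sum_congr rfl fun j _ => ?_
  rw [← Finset.smul_sum, Finset.sum_pi_single]
  simp

lemma inE_of_mem_Y {k : ℕ} {m : ℤ} {Ξ : X} (h : ∀ i, coord Ξ i ∈ Y k)
    (e : mulV (genMat k) (coord Ξ) = (m : ℂ) • coord Ξ) : InE m Ξ := by
  have h1 : coord ((m : ℂ) • Ξ) = mulV (genMat k) (coord Ξ) := by rw [e, map_smul]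
  exact isL0_of_mem_Y h h1

lemma exists_eigenvector {k : ℕ} (l : Fin 6) {f : Fun2} (hf : f ∈ Y k)
    (h0 : k = 0 → l ≠ 5 → f = 0) :
    ∃ Ξ, coord Ξ = mulV (colMat k) (Pi.single l f) ∧ InE (ev k l) Ξ := by
  have hY : ∀ i, mulV (colMat k) (Pi.single l f) i ∈ Y k := mulV_mem _ fun i => by
    rcases eq_or_ne i l with rfl | hi
    · rwa [Pi.single_eq_same]
    · rw [Pi.single_eq_of_ne hi]
      exact zero_mem _
  have hY0 : k = 0 → ∀ i, i ≠ 5 → mulV (colMat k) (Pi.single l f) i = 0 := by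
    rintro rfl i hi
    rw [colMat, if_pos rfl, mulV_one]
    rcases eq_or_ne i l with rfl | hil
    · rw [Pi.single_eq_same, h0 rfl hi]
    · rw [Pi.single_eq_of_ne hil]
  obtain ⟨Ξ, hΞ⟩ := exists_single hY hY0
  refine ⟨Ξ, hΞ, inE_of_mem_Y (k := k) (fun i => ?_) ?_⟩
  · rw [hΞ]
    exact hY i
  · rw [hΞ, mulV_symb hY0]
    exact mulV_symb_eigen k l f

/-- The elements of `X` of degree `k` are sums of eigenvectors of `L₀`. -/
lemma exists_eigen_sum {k : ℕ} {Ξ : X} (hΞ : ∀ i, coord Ξ i ∈ Y k) :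
    ∃ Θ : Fin 6 → X, (∀ l, InE (ev k l) (Θ l)) ∧ Ξ = ∑ l, Θ l := by
  have h0 : ∀ l, k = 0 → l ≠ 5 → mulV (rowMat k) (coord Ξ) l = 0 := by
    rintro l rfl hl
    rw [rowMat, if_pos rfl, mulV_one, ← mode_zero_eq Ξ hl, mode_single hΞ, if_pos rfl]
  choose Θ hΘ hE using fun l => exists_eigenvector l (mulV_mem (rowMat k) hΞ l) (h0 l)
  refine ⟨Θ, hE, coord_injective ?_⟩
  rw [map_sum]
  simp only [hΘ]
  rw [← mulV_eq_sum_single, mulV_mulV, colMat_mul_rowMat, mulV_one]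

lemma eq_zero_of_eigen {D : X →ₗ[ℂ] X} (hD : ∀ (m : ℤ) (Ξ : X), InE m Ξ → D Ξ = 0) {k : ℕ} {Ξ : X}
    (hΞ : ∀ i, coord Ξ i ∈ Y k) : D Ξ = 0 := by
  obtain ⟨Θ, hE, rfl⟩ := exists_eigen_sum hΞ
  have h : ∀ l, D (Θ l) = 0 := fun l => hD _ _ (hE l)
  rw [map_sum]
  simp only [h, Finset.sum_const_zero]

/-- The expansion of an element of `X` in components of degree `k`. -/
lemma exists_expansion (Ξ : X) : ∃ Θ : ℕ → X, (∀ k i, coord (Θ k) i ∈ Y k) ∧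
    Tendsto (fun N => normX (Ξ - ∑ k ∈ Finset.range N, Θ k) ^ 2) atTop (𝓝 0) := by
  choose Θ hΘ using fun k => exists_single (mode_mem Ξ k) (fun hk i hi => by
    subst hk
    exact mode_zero_eq Ξ hi)
  have hΘY : ∀ k i, coord (Θ k) i ∈ Y k := fun k => by simpa only [hΘ] using mode_mem Ξ k
  have hmode : ∀ N j, mode (Ξ - ∑ k ∈ Finset.range N, Θ k) j
      = if j < N then 0 else mode Ξ j := fun N j => by
    have : mode (∑ k ∈ Finset.range N, Θ k) j = ∑ k ∈ Finset.range N, mode (Θ k) j := by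
      funext i
      simp [mode]
    rw [mode_sub, this]
    simp only [mode_single (hΘY _), hΘ]
    rw [Finset.sum_ite_eq]
    simp only [Finset.mem_range]
    split_ifs
    · exact sub_self _
    · exact sub_zero _
  have htail : ∀ N, normX (Ξ - ∑ k ∈ Finset.range N, Θ k) ^ 2
      = normX Ξ ^ 2 - ∑ k ∈ Finset.range N, energy k (mode Ξ k) := fun N => by
    refine (hasSum_energy _).unique ?_
    have h1 : HasSum (fun k => if k < N then energy k (mode Ξ k) else 0)
        (∑ k ∈ Finset.range N, if k < N then energy k (mode Ξ k) else 0) :=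
      hasSum_sum_of_ne_finset_zero fun k hk => if_neg (by simpa using hk)
    have h2 : (∑ k ∈ Finset.range N, if k < N then energy k (mode Ξ k) else 0)
        = ∑ k ∈ Finset.range N, energy k (mode Ξ k) :=
      Finset.sum_congr rfl fun k hk => if_pos (Finset.mem_range.1 hk)
    have h3 : ∀ k, energy k (mode (Ξ - ∑ k ∈ Finset.range N, Θ k) k)
        = energy k (mode Ξ k) - if k < N then energy k (mode Ξ k) else 0 := fun k => by
      rw [hmode]
      split_ifs
      · simp [energy]
      · simp
    rw [← h2]
    simp only [h3]
    exact (hasSum_energy Ξ).sub h1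
  refine ⟨Θ, hΘY, ?_⟩
  simp only [htail]
  have := (hasSum_energy Ξ).tendsto_sum_nat.const_sub (normX Ξ ^ 2)
  rwa [sub_self] at this

/-- D does not change when finitely many degrees are removed from Ξ, and the norm of what remains
tends to zero. The bound is on squares because `normX_sub_sq_le` provides it in that form, in place
of a triangle inequality for `normX`. -/
lemma eq_zero_of_forall_eigen {D : X →ₗ[ℂ] X} {K : ℝ}
    (hD : ∀ Ξ, normX (D Ξ) ^ 2 ≤ K * normX Ξ ^ 2)
    (hE : ∀ (m : ℤ) (Ξ : X), InE m Ξ → D Ξ = 0) (Ξ : X) : D Ξ = 0 := by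
  obtain ⟨Θ, hΘ, hlim⟩ := exists_expansion Ξ
  have hz : ∀ k, D (Θ k) = 0 := fun k => eq_zero_of_eigen hE (hΘ k)
  have e : ∀ N, D (Ξ - ∑ k ∈ Finset.range N, Θ k) = D Ξ := fun N => by
    rw [map_sub, map_sum]
    simp only [hz, Finset.sum_const_zero, sub_zero]
  have hle : ∀ N, normX (D Ξ) ^ 2 ≤ K * normX (Ξ - ∑ k ∈ Finset.range N, Θ k) ^ 2 := fun N => by
    have := hD (Ξ - ∑ k ∈ Finset.range N, Θ k)
    rwa [e] at this
  have h0 : normX (D Ξ) ^ 2 ≤ 0 := by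
    have := ge_of_tendsto' (hlim.const_mul K) hle
    rwa [mul_zero] at this
  refine eq_zero_of_normX (le_of_eq ?_)
  exact (pow_eq_zero_iff two_ne_zero).1 (le_antisymm h0 (sq_nonneg _))

lemma eq_of_eigen {T T' : X →ₗ[ℂ] X} (hT : BoundedX T) (hT' : BoundedX T')
    (h : ∀ (m : ℤ) (Ξ : X), InE m Ξ → T Ξ = T' Ξ) : T = T' := by
  obtain ⟨C, hC⟩ := hT
  obtain ⟨C', hC'⟩ := hT'
  have hD : ∀ Ξ, normX ((T - T') Ξ) ^ 2 ≤ (2 * C ^ 2 + 2 * C' ^ 2) * normX Ξ ^ 2 := fun Ξ => by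
    have h1 := pow_le_pow_left₀ (normX_nonneg _) (hC Ξ) 2
    have h2 := pow_le_pow_left₀ (normX_nonneg _) (hC' Ξ) 2
    have h3 := normX_sub_sq_le (T Ξ) (T' Ξ)
    rw [LinearMap.sub_apply]
    nlinarith
  have hE : ∀ (m : ℤ) (Ξ : X), InE m Ξ → (T - T') Ξ = 0 := fun m Ξ hΞ => by
    rw [LinearMap.sub_apply, h m Ξ hΞ, sub_self]
  rw [← sub_eq_zero]
  exact LinearMap.ext (eq_zero_of_forall_eigen hD hE)

lemma IsExpProj.unique {S : Set ℤ} {s : ℝ} {T T' : X →ₗ[ℂ] X} (h : IsExpProj S s T)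
    (h' : IsExpProj S s T') : T = T' :=
  eq_of_eigen h.1 h'.1 fun m Ξ hΞ => by rw [h.2 m Ξ hΞ, h'.2 m Ξ hΞ]

lemma isSpecProj_iff {S : Set ℤ} {P : X →ₗ[ℂ] X} : IsSpecProj S P ↔ IsExpProj S 0 P := by
  simp [IsSpecProj, IsExpProj]

lemma existsUnique_isSpecProj {S : Set ℤ} {B : ℝ} (hB : 0 ≤ B)
    (h : ∀ k, EnergyBound k B (expMat S 0 k)) : ∃! P, IsSpecProj S P := by
  obtain ⟨T, -, -, hT⟩ := exists_expProj hB h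
  exact ⟨T, isSpecProj_iff.2 hT, fun P hP => (isSpecProj_iff.1 hP).unique hT⟩

lemma IsExpProj.normX_le {S : Set ℤ} {s B : ℝ} {T : X →ₗ[ℂ] X} (hT : IsExpProj S s T) (hB : 0 ≤ B)
    (h : ∀ k, EnergyBound k B (expMat S s k)) (Ξ : X) : normX (T Ξ) ≤ 6 * B * normX Ξ := by
  obtain ⟨T', -, hT'B, hT'⟩ := exists_expProj hB h
  rw [hT.unique hT']
  exact hT'B Ξ

/-! ### The semigroups -/

lemma continuous_energy_expMat (S : Set ℤ) (k : ℕ) (v w : Fin 6 → Fun2) :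
    Continuous fun t => energy k (mulV (expMat S t k) v - w) := by
  have h1 : ∀ l, Continuous fun t => expDiag S t k l := fun l => by
    unfold expDiag
    split_ifs <;> fun_prop
  have h2 : ∀ i j, Continuous fun t => expMat S t k i j := fun i j => by
    simp only [expMat_apply]
    fun_prop
  simp only [energy, mulV, Pi.sub_apply]
  fun_prop

/-- The semigroup law is checked on the matrices degree by degree. For strong continuity each degree
contributes a continuous function of t, and because c·t ≤ 0 on J the sum over degrees has a majorant
independent of t. -/
lemma exists_isSemigroup {S : Set ℤ} {J : Set ℝ} {B c : ℝ} {P : X →ₗ[ℂ] X} (hP : IsSpecProj S P)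
    (hB : 0 ≤ B) (h0 : (0 : ℝ) ∈ J) (hadd : ∀ s ∈ J, ∀ t ∈ J, s + t ∈ J) (hc : ∀ s ∈ J, c * s ≤ 0)
    (h : ∀ s ∈ J, ∀ k, EnergyBound k (B * Real.exp (c * s)) (expMat S s k)) :
    ∃ T, IsSemigroup S P J T := by
  -- Off J no bound is available; T is set to zero there, where nothing is required of it.
  have hex : ∀ s, ∃ T : X →ₗ[ℂ] X, s ∈ J →
      (∀ Ξ k, mode (T Ξ) k = mulV (expMat S s k) (mode Ξ k)) ∧ IsExpProj S s T := fun s => by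
    by_cases hs : s ∈ J
    · obtain ⟨T, hT, -, hT'⟩ := exists_expProj (by positivity) (h s hs)
      exact ⟨T, fun _ => ⟨hT, hT'⟩⟩
    · exact ⟨0, fun hs' => absurd hs' hs⟩
  choose T hT using hex
  refine ⟨T, fun s hs => (hT s hs).2, (hT 0 h0).2.unique (isSpecProj_iff.1 hP),
    fun s hs t ht => ?_, fun Ξ s hs => ?_⟩
  · refine LinearMap.ext fun Ξ => mode_ext fun k => ?_
    rw [(hT _ (hadd s hs t ht)).1, LinearMap.comp_apply, (hT s hs).1, (hT t ht).1, mulV_mulV,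
      expMat_mul_expMat]
  have hb : ∀ t ∈ J, ∀ k, energy k (mulV (expMat S t k) (mode Ξ k))
      ≤ 36 * B ^ 2 * energy k (mode Ξ k) := fun t ht k => by
    refine (energy_mulV_le (h t ht k) _).trans ?_
    have h1 : Real.exp (c * t) ≤ 1 := Real.exp_le_one_iff.2 (hc t ht)
    have h2 : B * Real.exp (c * t) ≤ B := mul_le_of_le_one_right hB h1
    have := energy_nonneg k (mode Ξ k)
    gcongr
  have hsq : Tendsto (fun t => ∑' k, energy k (mulV (expMat S t k) (mode Ξ k)
      - mulV (expMat S s k) (mode Ξ k))) (𝓝[J] s) (𝓝 (∑' _ : ℕ, (0 : ℝ))) := by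
    -- 144 = 2·36 + 2·36, from `energy_sub_le` and the bound `hb` at t and at s.
    refine tendsto_tsum_of_dominated_convergence
      (bound := fun k => 144 * B ^ 2 * energy k (mode Ξ k))
      ((hasSum_energy Ξ).summable.mul_left _) (fun k => ?_) ?_
    · refine tendsto_nhdsWithin_of_tendsto_nhds
        ((continuous_energy_expMat S k _ _).tendsto' s 0 ?_)
      simp [energy]
    · filter_upwards [self_mem_nhdsWithin] with t ht k
      rw [Real.norm_eq_abs, abs_of_nonneg (energy_nonneg k _)]
      have := energy_sub_le k (mulV (expMat S t k) (mode Ξ k)) (mulV (expMat S s k) (mode Ξ k))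
      linarith [hb t ht k, hb s hs k]
  rw [tsum_zero] at hsq
  have hroot := (Real.continuous_sqrt.tendsto' 0 0 Real.sqrt_zero).comp hsq
  refine hroot.congr' ?_
  filter_upwards [self_mem_nhdsWithin] with t ht
  have e := (hasSum_energy (T t Ξ - T s Ξ)).tsum_eq
  simp only [mode_sub, (hT t ht).1, (hT s hs).1] at e
  rw [Function.comp_apply, e, Real.sqrt_sq (normX_nonneg _)]

lemma IsSemigroup.normX_le {S : Set ℤ} {P : X →ₗ[ℂ] X} {J : Set ℝ} {T : ℝ → X →ₗ[ℂ] X}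
    (hT : IsSemigroup S P J T) {B C c s : ℝ} (hs : s ∈ J) (hB : 0 ≤ B) (hC : 6 * B ≤ C)
    (h : ∀ k, EnergyBound k (B * Real.exp (c * s)) (expMat S s k)) (Ξ : X) :
    normX (T s Ξ) ≤ C * Real.exp (c * s) * normX Ξ := by
  refine ((hT.isExpProj s hs).normX_le (mul_nonneg hB (Real.exp_pos _).le) h Ξ).trans ?_
  rw [← mul_assoc]
  exact mul_le_mul_of_nonneg_right (mul_le_mul_of_nonneg_right hC (Real.exp_pos _).le)
    (normX_nonneg Ξ)

lemma IsSpecProj.normX_le {S : Set ℤ} {P : X →ₗ[ℂ] X} (hP : IsSpecProj S P) {B : ℝ} (hB : 0 ≤ B)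
    (h : ∀ k, EnergyBound k B (expMat S 0 k)) (Ξ : X) : normX (P Ξ) ≤ 6 * B * normX Ξ :=
  (isSpecProj_iff.1 hP).normX_le hB h Ξ

end StokesSphere

end

/-! ### The spectral projections and semigroups with a common constant -/

set_option maxHeartbeats 1000000 in
theorem lemma3p5 :
    (∃! P, StokesSphere.IsSpecProj {0} P) ∧
    (∃! P, StokesSphere.IsSpecProj {1} P) ∧
    (∃! P, StokesSphere.IsSpecProj (Set.Ici 2) P) ∧
    (∃! P, StokesSphere.IsSpecProj (Set.Iic (-1)) P) ∧
    ∃ C : ℝ, ∀ P₀ P₁ Pge Ple : StokesSphere.X →ₗ[ℂ] StokesSphere.X,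
      StokesSphere.IsSpecProj {0} P₀ → StokesSphere.IsSpecProj {1} P₁ →
      StokesSphere.IsSpecProj (Set.Ici 2) Pge → StokesSphere.IsSpecProj (Set.Iic (-1)) Ple →
      (∀ Ξ, StokesSphere.normX (P₀ Ξ) + StokesSphere.normX (P₁ Ξ) + StokesSphere.normX (Pge Ξ)
        + StokesSphere.normX (Ple Ξ) ≤ C * StokesSphere.normX Ξ) ∧
      (∃ T, StokesSphere.IsSemigroup (Set.Ici 2) Pge (Set.Iic 0) T) ∧
      (∀ T, StokesSphere.IsSemigroup (Set.Ici 2) Pge (Set.Iic 0) T →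
        ∀ s ≤ 0, ∀ Ξ, StokesSphere.normX (T s Ξ)
          ≤ C * Real.exp (2 * s) * StokesSphere.normX Ξ) ∧
      (∃ T, StokesSphere.IsSemigroup (Set.Iic (-1)) Ple (Set.Ici 0) T) ∧
      (∀ T, StokesSphere.IsSemigroup (Set.Iic (-1)) Ple (Set.Ici 0) T →
        ∀ s ≥ 0, ∀ Ξ, StokesSphere.normX (T s Ξ)
          ≤ C * Real.exp (-s) * StokesSphere.normX Ξ) := by
  obtain ⟨C₀, hC₀, h₀⟩ := StokesSphere.exists_bound_singleton (m := 0) (Or.inl rfl)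
  obtain ⟨C₁, hC₁, h₁⟩ := StokesSphere.exists_bound_singleton (m := 1) (Or.inr rfl)
  obtain ⟨C₂, hC₂, h₂⟩ := StokesSphere.exists_bound_Ici
  obtain ⟨C₃, hC₃, h₃⟩ := StokesSphere.exists_bound_Iic
  have h₂' : ∀ k, StokesSphere.EnergyBound k C₂ (StokesSphere.expMat (Set.Ici 2) 0 k) :=
    fun k => by simpa using h₂ 0 le_rfl k
  have h₃' : ∀ k, StokesSphere.EnergyBound k C₃ (StokesSphere.expMat (Set.Iic (-1)) 0 k) :=
    fun k => by simpa using h₃ 0 le_rfl k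
  have e₂ : 6 * C₂ ≤ 6 * (C₀ + C₁ + C₂ + C₃) := by linarith
  have e₃ : 6 * C₃ ≤ 6 * (C₀ + C₁ + C₂ + C₃) := by linarith
  refine ⟨StokesSphere.existsUnique_isSpecProj hC₀ h₀, StokesSphere.existsUnique_isSpecProj hC₁ h₁,
    StokesSphere.existsUnique_isSpecProj hC₂ h₂', StokesSphere.existsUnique_isSpecProj hC₃ h₃', ?_⟩
  -- The 6 converts an entrywise energy bound into an operator bound. The sum of the four constants
  -- serves the projections together and dominates each semigroup separately; by uniqueness, the
  -- bounds hold for whichever operators are given.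
  refine ⟨6 * (C₀ + C₁ + C₂ + C₃), fun P₀ P₁ Pge Ple hP₀ hP₁ hPge hPle => ?_⟩
  refine ⟨fun Ξ => ?_, ?_, ?_, ?_, ?_⟩
  · refine (add_le_add (add_le_add (add_le_add (hP₀.normX_le hC₀ h₀ Ξ) (hP₁.normX_le hC₁ h₁ Ξ))
      (hPge.normX_le hC₂ h₂' Ξ)) (hPle.normX_le hC₃ h₃' Ξ)).trans (le_of_eq ?_)
    ring
  · exact StokesSphere.exists_isSemigroup (c := 2) hPge hC₂ Set.self_mem_Iic
      (fun s hs t ht => Set.mem_Iic.2 (add_nonpos hs ht))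
      (fun s hs => mul_nonpos_of_nonneg_of_nonpos zero_le_two hs) h₂
  · intro T hT s hs Ξ
    exact hT.normX_le hs hC₂ e₂ (h₂ s hs) Ξ
  · exact StokesSphere.exists_isSemigroup (c := -1) hPle hC₃ Set.self_mem_Ici
      (fun s hs t ht => Set.mem_Ici.2 (add_nonneg hs ht))
      (fun s hs => mul_nonpos_of_nonpos_of_nonneg (by norm_num) hs) h₃
  · intro T hT s hs Ξ
    rw [← neg_one_mul s]
    exact hT.normX_le hs hC₃ e₃ (h₃ s hs) Ξ
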